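/- **Setting.** A linear time-invariant plant $x_{k+1}=Fx_k+n_k$, $y_{i,k}=H_ix_k+v_{i,k}$ with $x_k\in\mathbb R^n$ and $y_{i,k}\in\mathbb R^p$ ($n,p\ge 1$) is observed by $m$ sensors. The noise covariances are $Q_k$, $R_{i,k}$ and the initial error covariance is $P_0$. All of $F,H_i,Q_k,R_{i,k},P_0$ are public and fixed. Let $\mathcal H$ be the stacked matrix of the $H_i$, $\mathcal R_k=\mathrm{diag}(R_{1,k},\dots,R_{m,k})$, and let $\dagger$ be the Moore–Penrose pseudoinverse. Put $$P_k^-=FP_{k-1}F^T+Q_k,\quad P_k=\big((P_k^-)^{-1}+\mathcal H^T\mathcal R_k^\dagger\mathcal H\big)^{-1},\quad \mathcal K_k=P_k\mathcal H^T\mathcal R_k^\dagger=[K_{1,k},\dots,K_{m,k}],$$ $$\hat x_k=F\hat x_{k-1}+\mathcal K_k(\mathcal Y_k-\mathcal HF\hat x_{k-1}),\qquad \mathcal Y_k=[y_{1,k}^T,\dots,y_{m,k}^T]^T,$$ where $P_k^-$ is assumed invertible for $1\le k\le K$. **Encoding.** A real number $a$ is represented by the integer nearest to $a\beta^e$, with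 a public base $\beta\ge2$ and a public exponent $e$. Products add exponents, and summands are brought to a common exponent by multiplication with powers of $\beta^e$. **Protocol** ($K$ time steps). On the security parameter $1^\kappa$ the query node $Q$ runs a polynomial-time key generator, whose output consists of two distinct $\kappa$-bit primes except with negligible probability. It publishes their product $N$ as a Paillier public key and keeps the primes as private key. It sends the Paillier encryption of its encoded initial state $\hat x_0$, and $P_0$ in the clear, to the aggregator $A$. At each time $k=1,\dots,K$ every sensor $i$ sends to $A$ the encryption of its encoded measurement $y_{i,k}$, and $R_{i,k}$ in the clear. The aggregator evaluates the above recursion homomorphically, with the encoded matrices $F,\mathcal H,\mathcal K_k$, and sends the encryption of $\hat x_k$ together with $P_k$ to $Q$, who decrypts. Every message from a sensor to $A$, from $Q$ to $A$ and from $A$ to $Q$ travels over a channel that is in addition encrypted with a private-key scheme (which decrypts correctly), with an independent key for each channel. **Privacy.** The function $f$ computed gives to $Q$ the estimates $\hat x_1,\dots,\hat x_K$ of the recursion on encoded numbers, and nothing to the other parties. The view of a coalition consists of the public parameters, the inputs of its members, their coins (for encryption and, in the case of $Q$, key generation), the public key, the messages received, what $A$ resp. $Q$ computes from them (for $A$ the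 encrypted estimates; for $Q$ the private key and the decrypted estimates), and the traffic between parties outside the coalition as it appears on the encrypted channels. The protocol is *private against the coalition, with simulator $S$,* if 1. for all private data that are generated by a probabilistic polynomial-time algorithm from $1^\kappa$ (in particular for all fixed private data), the output of $S$ on $1^\kappa$, the name of the coalition and the coalition's inputs and outputs is computationally indistinguishable (by probabilistic polynomial-time distinguishers, as $\kappa\to\infty$) from the view of the coalition, even for distinguishers that are also given all the private data; and 2. the inputs and outputs of the coalition do not determine the private data of the others: for all private data and every time $k\le K$, the encoded measurements at time $k$ of the sensors outside the coalition can take infinitely many values consistent with the coalition's inputs and outputs, and so can the encoded initial state if $Q$ is not in the coalition. **Theorem 1.** Assume that the decisional composite residuosity assumption holds for the key generator and that the channel encryption has indistinguishable encryptions (for several messages of equal lengths). Then: * (Estimation.) For all fixed private data, $Q$ obtains the estimates of the recursion on encoded numbers except with negligible probability. As $e\to\infty$ these estimates, for encoded real data, converge after decoding to the Kalman estimates $\hat x_k$ for these data. * There is one probabilistic polynomial-time simulator $S$ with which the protocol is private against * every coalition of sensors, * every coalition of the aggregator with sensors, * every coalition of the query node with sensors for which $p\,m_r>n$, where $m_r$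 is the number of sensors outside the coalition, where in each case at least one sensor is outside the coalition. In the last case, moreover, for all real data and all $k\le K$ the linear system $$K_{r,k}Y=z_k,\qquad z_k=\hat x_k-(I-\mathcal K_k\mathcal H)F\hat x_{k-1}-\sum_{i\text{ in the coalition}}K_{i,k}y_{i,k},$$ which the coalition obtains for the vector $Y_{r,k}$ of the measurements of the other sensors (with $K_{r,k}\in\mathbb R^{n\times pm_r}$ the corresponding blocks of $\mathcal K_k$), is satisfied by $Y_{r,k}$ and has infinitely many solutions. -/

import Mathlib

open Filter Topology

namespace PrivateKalman

noncomputable section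

/-! ## Probabilistic polynomial time

A first-order imperative language on finite trees whose leaves are natural numbers, with bit-length
cost.  Every instruction charges one unit plus the bit size of the tree it is applied to; coin
tosses are fair and independent.  Since every single instruction can be carried out by a Turing
machine in time polynomial in the size of its argument, and since the size of the argument and
counted loops are available (so that polynomially many machine steps can be simulated), the
programs of polynomial cost are exactly the probabilistic polynomial-time algorithms. -/

/-- Finite objects (bit strings are natural numbers, tuples and lists are nested pairs). -/
inductive Data : Type where
  | num : ℕ → Data
  | pair : Data → Data → Data

namespace Data

/-- Bit size. -/
def size : Data → ℕ
  | num a => Nat.size a + 1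
  | pair a b => size a + size b + 1

def left : Data → Data
  | num _ => num 0
  | pair a _ => a

def right : Data → Data
  | num _ => num 0
  | pair _ b => b

def toNat : Data → ℕ
  | num a => a
  | pair _ _ => 0

/-- Lists, terminated by `num 0`. -/
def list : List Data → Data
  | [] => num 0
  | a :: l => pair a (list l)

/-- Vectors. -/
def vec {k : ℕ} (f : Fin k → Data) : Data := list (List.ofFn f)

/-- Integers, as sign and absolute value. -/
def int (z : ℤ) : Data := pair (num (if z < 0 then 1 else 0)) (num z.natAbs)

/-- The security parameter `1^κ`, a string of `κ + 1` bits. -/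
def security (κ : ℕ) : Data := num (2 ^ κ)

end Data

/-- Programs. -/
inductive Prog : Type where
  /-- identity -/
  | skip : Prog
  /-- a constant -/
  | const : Data → Prog
  /-- first component -/
  | fst : Prog
  /-- second component -/
  | snd : Prog
  /-- run two programs on the same argument and pair the results -/
  | pair : Prog → Prog → Prog
  /-- `comp g f` runs `f` and then `g` -/
  | comp : Prog → Prog → Prog
  /-- arithmetic on a pair of numbers (truncated subtraction, integer quotient and remainder) -/
  | add : Prog
  | sub : Prog
  | mul : Prog
  | div : Prog
  | mod : Prog
  /-- is the argument a number? -/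
  | isNum : Prog
  /-- the bit size of the argument -/
  | size : Prog
  /-- `ite c f g` runs `f` if `c` does not return the number `0`, and `g` if it does -/
  | ite : Prog → Prog → Prog → Prog
  /-- `loop f`, on a pair `(a, x)`, applies `f` to `x` repeatedly, `a` times -/
  | loop : Prog → Prog
  /-- a fair coin -/
  | flip : Prog

namespace Prog

/-- Repeated execution, adding up the costs. -/
def iter (φ : Data → PMF (Data × ℕ)) : ℕ → Data → PMF (Data × ℕ)
  | 0, x => PMF.pure (x, 0)
  | k + 1, x => (φ x).bind fun a => (iter φ k a.1).map fun b => (b.1, a.2 + b.2)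

/-- An arithmetic instruction. -/
def arith (f : ℕ → ℕ → ℕ) (d : Data) : Data := Data.num (f d.left.toNat d.right.toNat)

/-- The joint law of the result and of the cost of a program on a given argument. -/
def run : Prog → Data → PMF (Data × ℕ)
  | skip, d => PMF.pure (d, 1 + d.size)
  | const a, d => PMF.pure (a, 1 + d.size + a.size)
  | fst, d => PMF.pure (d.left, 1 + d.size)
  | snd, d => PMF.pure (d.right, 1 + d.size)
  | pair f g, d => (run f d).bind fun a => (run g d).map fun b =>
      (Data.pair a.1 b.1, a.2 + b.2 + (1 + d.size))
  | comp g f, d => (run f d).bind fun a => (run g a.1).map fun b =>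
      (b.1, a.2 + b.2 + (1 + d.size))
  | add, d => PMF.pure (arith (· + ·) d, 1 + d.size)
  | sub, d => PMF.pure (arith (· - ·) d, 1 + d.size)
  | mul, d => PMF.pure (arith (· * ·) d, 1 + d.size)
  | div, d => PMF.pure (arith (· / ·) d, 1 + d.size)
  | mod, d => PMF.pure (arith (· % ·) d, 1 + d.size)
  | isNum, d => PMF.pure
      (match d with
        | Data.num _ => Data.num 1
        | Data.pair _ _ => Data.num 0, 1 + d.size)
  | size, d => PMF.pure (Data.num d.size, 1 + d.size)
  | ite c f g, d => (run c d).bind fun a =>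
      (match a.1 with
        | Data.num 0 => run g d
        | _ => run f d : PMF (Data × ℕ)).map fun b => (b.1, a.2 + b.2 + (1 + d.size))
  | loop f, d => (iter (run f) d.left.toNat d.right).map fun b => (b.1, b.2 + (1 + d.size))
  | flip, d => (PMF.uniformOfFintype Bool).map fun b => (Data.num b.toNat, 1 + d.size)

/-- The law of the result. -/
def eval (A : Prog) (d : Data) : PMF Data := (A.run d).map Prod.fst

/-- Polynomial time: on every argument and for all outcomes of the coins, the cost is bounded by
a polynomial in the size of the argument. -/
def PolyTime (A : Prog) : Prop :=
  ∃ q : Polynomial ℕ, ∀ d : Data, ∀ a ∈ (A.run d).support, a.2 ≤ q.eval d.size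

/-- The program tosses no coins. -/
def CoinFree : Prog → Prop
  | pair f g => CoinFree f ∧ CoinFree g
  | comp g f => CoinFree g ∧ CoinFree f
  | ite c f g => CoinFree c ∧ CoinFree f ∧ CoinFree g
  | loop f => CoinFree f
  | flip => False
  | _ => True

end Prog

/-! ## Computational indistinguishability -/

/-- Eventually smaller than the reciprocal of any given positive polynomial. -/
def Negligible (f : ℕ → ℝ) : Prop :=
  ∀ q : Polynomial ℕ, (∀ k : ℕ, 0 < q.eval k) → ∀ᶠ κ in atTop, |f κ| < 1 / ((q.eval κ : ℕ) : ℝ)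

/-- The probability that `D`, given the security parameter and a sample of `X κ`, returns `1`. -/
def acceptProb (D : Prog) (X : ℕ → PMF Data) (κ : ℕ) : ℝ :=
  (((X κ).bind fun d => D.eval (Data.pair (Data.security κ) d)) (Data.num 1)).toReal

/-- Computational indistinguishability of ensembles. -/
def CompIndist (X Y : ℕ → PMF Data) : Prop :=
  ∀ D : Prog, D.PolyTime → Negligible fun κ => acceptProb D X κ - acceptProb D Y κ

/-- The ensemble is the output of a probabilistic polynomial-time algorithm on `1^κ`. -/
def Samplable (X : ℕ → PMF Data) : Prop :=
  ∃ A : Prog, A.PolyTime ∧ ∀ κ, A.eval (Data.security κ) = X κ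

/-! ## The Paillier cryptosystem -/

/-- The uniform law on a finite set (a point mass at `a` if the set is empty). -/
def uniformOr {α : Type} (s : Finset α) (a : α) : PMF α :=
  open Classical in if h : s.Nonempty then PMF.uniformOfFinset s h else PMF.pure a

/-- Representatives of the units modulo `M`. -/
def unitResidues (M : ℕ) : Finset ℕ := (Finset.range M).filter fun r => Nat.Coprime r M

/-- Independent uniform units modulo `M`, one for each index. -/
def uniformUnits (ι : Type) [Fintype ι] [DecidableEq ι] (M : ℕ) : PMF (ι → ℕ) :=
  uniformOr (Fintype.piFinset fun _ => unitResidues M) fun _ => 1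

/-- Two distinct primes of `κ` bits each. -/
def ValidPrimes (κ P Q : ℕ) : Prop :=
  P.Prime ∧ Q.Prime ∧ P ≠ Q ∧ P.size = κ ∧ Q.size = κ

/-- A polynomial-time key generator: from `1^κ` and a uniform string of polynomially many coins it
computes two numbers, which are distinct `κ`-bit primes except with negligible probability. -/
structure KeyGenerator where
  prog : Prog
  polyTime : prog.PolyTime
  coinFree : prog.CoinFree
  coinLength : Polynomial ℕ
  valid : Negligible fun κ =>
    (((PMF.uniformOfFinset (Finset.range (2 ^ coinLength.eval κ)) (by simp)).bind fun w =>
      prog.eval (Data.pair (Data.security κ) (Data.num w))).toOuterMeasure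
        {d | ¬ ValidPrimes κ d.left.toNat d.right.toNat}).toReal

/-- What key generation produces: its coins and the two primes. -/
structure Keys where
  coins : ℕ
  P : ℕ
  Q : ℕ

/-- The public key. -/
def Keys.N (k : Keys) : ℕ := k.P * k.Q

/-- The law of the keys. -/
def KeyGenerator.keys (G : KeyGenerator) (κ : ℕ) : PMF Keys :=
  (PMF.uniformOfFinset (Finset.range (2 ^ G.coinLength.eval κ)) (by simp)).bind fun w =>
    (G.prog.eval (Data.pair (Data.security κ) (Data.num w))).map fun d =>
      ⟨w, d.left.toNat, d.right.toNat⟩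

/-- Encryption of the integer `a` (taken modulo `N`) with the random unit `r` modulo `N`. -/
def encrypt (N : ℕ) (a : ℤ) (r : ℕ) : ZMod (N ^ 2) :=
  (1 + (N : ZMod (N ^ 2))) ^ ((a : ZMod N).val) * (r : ZMod (N ^ 2)) ^ N

/-- Sum of encrypted values. -/
def encAdd {N : ℕ} (c d : ZMod (N ^ 2)) : ZMod (N ^ 2) := c * d

/-- Product of a plaintext integer and an encrypted value. -/
def encScale {N : ℕ} (a : ℤ) (c : ZMod (N ^ 2)) : ZMod (N ^ 2) := c ^ ((a : ZMod N).val)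

/-- Difference of encrypted values. -/
def encSub {N : ℕ} (c d : ZMod (N ^ 2)) : ZMod (N ^ 2) := encAdd c (encScale (-1) d)

/-- Product of a plaintext integer matrix and an encrypted vector. -/
def encMulVec {N : ℕ} {ι ι' : Type} [Fintype ι'] (A : Matrix ι ι' ℤ) (c : ι' → ZMod (N ^ 2)) :
    ι → ZMod (N ^ 2) :=
  fun i => ∏ j, encScale (A i j) (c j)

/-- The function `u ↦ (u - 1) / N` of Paillier decryption. -/
def paillierL (N : ℕ) (u : ZMod (N ^ 2)) : ℕ := (u.val - 1) / N

/-- Decryption with the private key; the result is the representative of least absolute value. -/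
def decrypt (k : Keys) (c : ZMod (k.N ^ 2)) : ℤ :=
  let l := Nat.lcm (k.P - 1) (k.Q - 1)
  ((paillierL k.N (c ^ l) : ZMod k.N) *
    (paillierL k.N ((1 + (k.N : ZMod (k.N ^ 2))) ^ l) : ZMod k.N)⁻¹).valMinAbs

/-- The decisional composite residuosity assumption: for a random modulus `N`, random `N`-th
residues modulo `N ^ 2` and random units modulo `N ^ 2` are computationally indistinguishable. -/
def DCRA (G : KeyGenerator) : Prop :=
  CompIndist
    (fun κ => (G.keys κ).bind fun k => (uniformOr (unitResidues k.N) 1).map fun r =>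
      Data.pair (Data.num k.N) (Data.num ((r : ZMod (k.N ^ 2)) ^ k.N).val))
    (fun κ => (G.keys κ).bind fun k => (uniformOr (unitResidues (k.N ^ 2)) 1).map fun u =>
      Data.pair (Data.num k.N) (Data.num u))

/-! ## End-to-end encrypted channels -/

/-- A private-key encryption scheme, used for the communication channels. -/
structure ChannelScheme where
  gen : Prog
  enc : Prog
  dec : Prog
  gen_polyTime : gen.PolyTime
  enc_polyTime : enc.PolyTime
  dec_polyTime : dec.PolyTime
  correct : ∀ κ, ∀ k ∈ (gen.eval (Data.security κ)).support, ∀ a : Data,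
    ∀ c ∈ (enc.eval (Data.pair k a)).support, dec.eval (Data.pair k c) = PMF.pure a

namespace ChannelScheme

/-- Encryption of several messages under one key. -/
def encList (C : ChannelScheme) (k : Data) : List Data → PMF (List Data)
  | [] => PMF.pure []
  | a :: l => (C.enc.eval (Data.pair k a)).bind fun c => (encList C k l).map fun cs => c :: cs

/-- The encrypted traffic of a channel with a fresh key. -/
def link (C : ChannelScheme) (κ : ℕ) (l : List Data) : PMF Data :=
  (C.gen.eval (Data.security κ)).bind fun k => (C.encList k l).map Data.list

/-- The encrypted traffic of several channels with independent keys. -/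
def links (C : ChannelScheme) (κ : ℕ) : List (List Data) → PMF (List Data)
  | [] => PMF.pure []
  | l :: ls => (C.link κ l).bind fun c => (links C κ ls).map fun cs => c :: cs

/-- Indistinguishability of encryptions (for several messages): two efficiently generated lists
of messages, equally many and of the same sizes, cannot be told apart from their encryptions under
a random key, even given whatever their generator discloses. -/
def Secure (C : ChannelScheme) : Prop :=
  ∀ T : ℕ → PMF (Data × List Data × List Data),
    (Samplable fun κ => (T κ).map fun τ =>
      Data.pair τ.1 (Data.pair (Data.list τ.2.1) (Data.list τ.2.2))) →
    (∀ κ, ∀ τ ∈ (T κ).support, τ.2.1.map Data.size = τ.2.2.map Data.size) →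
    CompIndist
      (fun κ => (T κ).bind fun τ => (C.link κ τ.2.1).map fun c => Data.pair τ.1 c)
      (fun κ => (T κ).bind fun τ => (C.link κ τ.2.2).map fun c => Data.pair τ.1 c)

end ChannelScheme

/-! ## The Kalman filter -/

/-- `B` is the Moore–Penrose pseudoinverse of `A`. -/
def IsPseudoinverse {ι : Type} [Fintype ι] (A B : Matrix ι ι ℝ) : Prop :=
  A * B * A = A ∧ B * A * B = B ∧ (A * B).transpose = A * B ∧ (B * A).transpose = B * A

/-- The Moore–Penrose pseudoinverse. -/
def pinv {ι : Type} [Fintype ι] (A : Matrix ι ι ℝ) : Matrix ι ι ℝ :=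
  open Classical in if h : ∃ B, IsPseudoinverse A B then h.choose else 0

/-- A linear time-invariant plant with state size `n`, observed by `m` sensors with measurements
of size `p`, together with the initial error covariance: process matrix, measurement matrices,
covariance `Q k` of the modeling noise, covariance `R k i` of the noise of sensor `i`. -/
structure Plant (n p m : ℕ) where
  F : Matrix (Fin n) (Fin n) ℝ
  H : Fin m → Matrix (Fin p) (Fin n) ℝ
  Q : ℕ → Matrix (Fin n) (Fin n) ℝ
  R : ℕ → Fin m → Matrix (Fin p) (Fin p) ℝ
  P₀ : Matrix (Fin n) (Fin n) ℝ
  posSemidef_Q : ∀ k, (Q k).PosSemidef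
  posSemidef_R : ∀ k i, (R k i).PosSemidef
  posSemidef_P₀ : P₀.PosSemidef

namespace Plant

variable {n p m : ℕ} (θ : Plant n p m)

/-- The stacked measurement matrix; the index `(j, i)` is component `j` of sensor `i`. -/
def stackH : Matrix (Fin p × Fin m) (Fin n) ℝ := Matrix.of fun ji b => θ.H ji.2 ji.1 b

/-- The block-diagonal covariance of the stacked measurement noise. -/
def stackR (k : ℕ) : Matrix (Fin p × Fin m) (Fin p × Fin m) ℝ := Matrix.blockDiagonal (θ.R k)

/-- The error covariance `P_k` of the estimate at time `k`. -/
def cov : ℕ → Matrix (Fin n) (Fin n) ℝ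
  | 0 => θ.P₀
  | k + 1 => ((θ.F * cov k * θ.F.transpose + θ.Q (k + 1))⁻¹ +
      θ.stackH.transpose * pinv (θ.stackR (k + 1)) * θ.stackH)⁻¹

/-- The covariance of the prediction at time `t + 1`. -/
def predCov (t : ℕ) : Matrix (Fin n) (Fin n) ℝ :=
  θ.F * θ.cov t * θ.F.transpose + θ.Q (t + 1)

/-- The gain matrix at time `t + 1`. -/
def gain (t : ℕ) : Matrix (Fin n) (Fin p × Fin m) ℝ :=
  θ.cov (t + 1) * θ.stackH.transpose * pinv (θ.stackR (t + 1))

/-- The Kalman estimates at the times `0, 1, 2, …`, where `y t` are the measurements at time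
`t + 1`. -/
def estimate (x : Fin n → ℝ) (y : ℕ → Fin p × Fin m → ℝ) : ℕ → Fin n → ℝ
  | 0 => x
  | t + 1 =>
    let xp := θ.F.mulVec (estimate x y t)
    xp + (θ.gain t).mulVec (y t - θ.stackH.mulVec xp)

end Plant

/-! ## Fixed-point encoding and the filter on encoded numbers

A number `a` is represented by the integer nearest to `a * β ^ e`, with public base `β` and
exponent `e`.  Products add exponents, and summands are brought to the same exponent, so that the
encoded estimate at time `k` has exponent `(3 * k + 1) * e`. -/

/-- Encoding of a number. -/
def encode (β e : ℕ) (a : ℝ) : ℤ := round (a * (β : ℝ) ^ e)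

/-- Encoding of a matrix. -/
def encodeMat {ι ι' : Type} (β e : ℕ) (A : Matrix ι ι' ℝ) : Matrix ι ι' ℤ := A.map (encode β e)

/-- The private data, encoded: the initial state of the query node, and the measurements
`y t i` of sensor `i` at time `t + 1`. -/
structure Inputs (n p m K : ℕ) where
  x : Fin n → ℤ
  y : Fin K → Fin m → Fin p → ℤ

/-- Extension of a finite sequence by zero. -/
def extend {α : Type} [Zero α] {K : ℕ} (f : Fin K → α) (t : ℕ) : α :=
  if h : t < K then f ⟨t, h⟩ else 0

/-- Stacking of the vectors of all the sensors. -/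
def stack {α : Type} {p m : ℕ} (f : Fin m → Fin p → α) : Fin p × Fin m → α := fun ji => f ji.2 ji.1

/-- The Kalman estimates computed on encoded numbers. -/
def fixedEstimate {n p m K : ℕ} (θ : Plant n p m) (β e : ℕ) (u : Inputs n p m K) :
    ℕ → Fin n → ℤ
  | 0 => u.x
  | t + 1 =>
    let xp := (encodeMat β e θ.F).mulVec (fixedEstimate θ β e u t)
    let yt := extend (fun s => stack (u.y s)) t
    let innovation := ((β : ℤ) ^ e) ^ (3 * t + 2) • yt - (encodeMat β e θ.stackH).mulVec xp
    ((β : ℤ) ^ e) ^ 2 • xp + (encodeMat β e (θ.gain t)).mulVec innovation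

/-- The aggregator computes on encrypted numbers: from the encrypted initial state and the
encrypted measurements to the encrypted estimates. -/
def encEstimate {n p m K N : ℕ} (θ : Plant n p m) (β e : ℕ) (cx : Fin n → ZMod (N ^ 2))
    (cy : Fin K → Fin m → Fin p → ZMod (N ^ 2)) : ℕ → Fin n → ZMod (N ^ 2)
  | 0 => cx
  | t + 1 =>
    let cp := encMulVec (encodeMat β e θ.F) (encEstimate θ β e cx cy t)
    let ct := extend (fun s => stack (cy s)) t
    let ch := encMulVec (encodeMat β e θ.stackH) cp
    let innovation := fun ji => encSub (encScale (((β : ℤ) ^ e) ^ (3 * t + 2)) (ct ji)) (ch ji)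
    let correction := encMulVec (encodeMat β e (θ.gain t)) innovation
    fun a => encAdd (encScale (((β : ℤ) ^ e) ^ 2) (cp a)) (correction a)

/-! ## The protocol -/

/-- All that the protocol fixes: the public model, the number system, the key generator, the
channel encryption.  The protocol runs for `K` time steps. -/
structure Protocol (n p m K : ℕ) where
  plant : Plant n p m
  base : ℕ
  two_le_base : 2 ≤ base
  prec : ℕ
  keygen : KeyGenerator
  channel : ChannelScheme

/-- Which party joins the sensors of a coalition: no other, the aggregator, or the query node. -/
inductive Partner : Type where
  | nobody : Partner
  | aggregator : Partner
  | query : Partner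

/-- A coalition: some of the sensors and possibly one further party. -/
structure Coalition (m : ℕ) where
  partner : Partner
  sensors : Finset (Fin m)

/-- Name of a coalition. -/
def Coalition.data {m : ℕ} (c : Coalition m) : Data :=
  Data.pair
    (Data.num (match c.partner with
      | Partner.nobody => 0
      | Partner.aggregator => 1
      | Partner.query => 2))
    (Data.vec fun i => Data.num (if i ∈ c.sensors then 1 else 0))

/-- Ciphertexts are transmitted as bit strings of fixed width (with a leading `1`). -/
def cipherData {N : ℕ} (c : ZMod (N ^ 2)) : Data := Data.num (2 ^ Nat.size (N ^ 2) + c.val)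

/-- All the private data. -/
def Inputs.data {n p m K : ℕ} (u : Inputs n p m K) : Data :=
  Data.pair (Data.vec fun a => Data.int (u.x a))
    (Data.vec fun t => Data.vec fun i => Data.vec fun j => Data.int (u.y t i j))

/-- One execution: the keys, and the encryption coins of the query node and of the sensors. -/
structure Execution (n p m K : ℕ) where
  keys : Keys
  rx : Fin n → ℕ
  ry : Fin K × Fin m × Fin p → ℕ

namespace Protocol

variable {n p m K : ℕ} (π : Protocol n p m K)

/-- The random choices of an execution. -/
def execution (κ : ℕ) : PMF (Execution n p m K) :=
  (π.keygen.keys κ).bind fun k =>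
    (uniformUnits (Fin n) k.N).bind fun rx =>
      (uniformUnits (Fin K × Fin m × Fin p) k.N).map fun ry => ⟨k, rx, ry⟩

/-- The encrypted initial state. -/
def cipherX (E : Execution n p m K) (u : Inputs n p m K) (a : Fin n) : ZMod (E.keys.N ^ 2) :=
  encrypt E.keys.N (u.x a) (E.rx a)

/-- The encrypted measurements. -/
def cipherY (E : Execution n p m K) (u : Inputs n p m K) (t : Fin K) (i : Fin m) (j : Fin p) :
    ZMod (E.keys.N ^ 2) :=
  encrypt E.keys.N (u.y t i j) (E.ry (t, i, j))

/-- The encrypted estimates of the aggregator at time `k`. -/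
def cipherEst (E : Execution n p m K) (u : Inputs n p m K) (k : ℕ) :
    Fin n → ZMod (E.keys.N ^ 2) :=
  encEstimate π.plant π.base π.prec (cipherX E u) (cipherY E u) k

/-- The estimates that the query node decrypts, at the times `1, …, K`. -/
def decrypted (E : Execution n p m K) (u : Inputs n p m K) (t : Fin K) (a : Fin n) : ℤ :=
  decrypt E.keys (π.cipherEst E u (t + 1) a)

/-- The function that the protocol computes: the query node obtains the estimates at the times
`1, …, K`, the other parties obtain nothing. -/
def target (u : Inputs n p m K) (t : Fin K) : Fin n → ℤ :=
  fixedEstimate π.plant π.base π.prec u (t + 1)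

/-- Public matrices. -/
def matData {a b : ℕ} (A : Matrix (Fin a) (Fin b) ℝ) : Data :=
  Data.vec fun i => Data.vec fun j => Data.int (encode π.base π.prec (A i j))

/-- The public parameters: `F`, the `H i`, `Q k`, `R k i`, `P k` and the gains. -/
def publicData : Data :=
  Data.list
    [π.matData π.plant.F,
     Data.vec fun i : Fin m => π.matData (π.plant.H i),
     Data.vec fun t : Fin K => π.matData (π.plant.Q (t + 1)),
     Data.vec fun t : Fin K => Data.vec fun i : Fin m => π.matData (π.plant.R (t + 1) i),
     Data.vec fun k : Fin (K + 1) => π.matData (π.plant.cov k),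
     Data.vec fun t : Fin K => Data.vec fun i : Fin m =>
       π.matData (Matrix.of fun a j => π.plant.gain t a (j, i))]

/-- The message of the query node to the aggregator. -/
def msgX (E : Execution n p m K) (u : Inputs n p m K) : Data :=
  Data.pair (Data.vec fun a => cipherData (cipherX E u a)) (π.matData π.plant.P₀)

/-- The message of sensor `i` to the aggregator at time `t + 1`. -/
def msgY (E : Execution n p m K) (u : Inputs n p m K) (i : Fin m) (t : Fin K) : Data :=
  Data.pair (Data.vec fun j => cipherData (cipherY E u t i j))
    (π.matData (π.plant.R (t + 1) i))

/-- The message of the aggregator to the query node at time `t + 1`. -/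
def msgEst (E : Execution n p m K) (u : Inputs n p m K) (t : Fin K) : Data :=
  Data.pair (Data.vec fun a => cipherData (π.cipherEst E u (t + 1) a))
    (π.matData (π.plant.cov (t + 1)))

/-- The inputs of a coalition. -/
def ownInputs (c : Coalition m) (u : Inputs n p m K) : Data :=
  Data.pair
    (match c.partner with
      | Partner.query => Data.vec fun a => Data.int (u.x a)
      | _ => Data.num 0)
    (Data.vec fun i => if i ∈ c.sensors
      then Data.vec fun t => Data.vec fun j => Data.int (u.y t i j) else Data.num 0)

/-- The outputs of a coalition. -/
def ownOutputs (c : Coalition m) (u : Inputs n p m K) : Data :=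
  match c.partner with
    | Partner.query => Data.vec fun t => Data.vec fun a => Data.int (π.target u t a)
    | _ => Data.num 0

/-- The coins of a coalition (the computations of the aggregator are deterministic). -/
def ownCoins (c : Coalition m) (E : Execution n p m K) : Data :=
  Data.pair
    (match c.partner with
      | Partner.query =>
        Data.pair (Data.num E.keys.coins) (Data.vec fun a => Data.num (E.rx a))
      | _ => Data.num 0)
    (Data.vec fun i => if i ∈ c.sensors
      then Data.vec fun t => Data.vec fun j => Data.num (E.ry (t, i, j)) else Data.num 0)

/-- The messages that a coalition receives, other than the public key, and what the aggregator
resp. the query node computes from them: the encrypted estimates of the aggregator; the private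
key and the decrypted estimates of the query node. -/
def received (c : Coalition m) (E : Execution n p m K) (u : Inputs n p m K) : Data :=
  match c.partner with
    | Partner.nobody => Data.num 0
    | Partner.aggregator => Data.list
        [π.msgX E u, Data.vec fun i => Data.vec fun t => π.msgY E u i t,
         Data.vec fun t => π.msgEst E u t]
    | Partner.query => Data.list
        [Data.pair (Data.num E.keys.P) (Data.num E.keys.Q), Data.vec fun t => π.msgEst E u t,
         Data.vec fun t => Data.vec fun a => Data.int (π.decrypted E u t a)]

/-- The traffic between parties outside a coalition, one list for each channel. -/
def hiddenTraffic (c : Coalition m) (E : Execution n p m K) (u : Inputs n p m K) :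
    List (List Data) :=
  let fromSensors := ((List.finRange m).filter fun i => i ∉ c.sensors).map fun i =>
    List.ofFn fun t => π.msgY E u i t
  match c.partner with
    | Partner.nobody => fromSensors ++ [[π.msgX E u], List.ofFn fun t => π.msgEst E u t]
    | Partner.aggregator => []
    | Partner.query => fromSensors

/-- The view of a coalition in an execution of the protocol: public parameters, inputs, coins,
public key, received messages, and the traffic between the other parties as it appears on the
encrypted channels. -/
def view (κ : ℕ) (c : Coalition m) (u : Inputs n p m K) : PMF Data :=
  (π.execution κ).bind fun E =>
    (π.channel.links κ (π.hiddenTraffic c E u)).map fun Γ =>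
      Data.list [π.publicData, ownInputs c u, ownCoins c E, Data.num E.keys.N,
        π.received c E u, Data.list Γ]

/-- The simulator `S` reproduces the view of the coalition from the inputs and outputs of the
coalition alone, for all efficiently generated private data, even in the eyes of a distinguisher
who knows all the private data. -/
def Simulates (S : Prog) (c : Coalition m) : Prop :=
  ∀ U : ℕ → PMF (Inputs n p m K), (Samplable fun κ => (U κ).map Inputs.data) →
    CompIndist
      (fun κ => (U κ).bind fun u =>
        (S.eval (Data.list [Data.security κ, c.data, ownInputs c u, π.ownOutputs c u])).map
          fun v => Data.pair u.data v)
      (fun κ => (U κ).bind fun u => (π.view κ c u).map fun v => Data.pair u.data v)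

/-- The private data that agree with the inputs and outputs of a coalition. -/
def compatible (c : Coalition m) (u : Inputs n p m K) : Set (Inputs n p m K) :=
  {w | ownInputs c w = ownInputs c u ∧ π.ownOutputs c w = π.ownOutputs c u}

/-- The inputs and outputs of a coalition do not determine the measurements of the sensors outside
the coalition at any time, nor the initial state if the query node is outside the coalition: there
remain infinitely many possibilities. -/
def NoInference (c : Coalition m) : Prop :=
  ∀ u : Inputs n p m K,
    (∀ t : Fin K,
      ((fun w : Inputs n p m K => fun i : {i // i ∉ c.sensors} => w.y t i) ''
        π.compatible c u).Infinite) ∧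
    (match c.partner with
      | Partner.query => True
      | _ => ((fun w : Inputs n p m K => w.x) '' π.compatible c u).Infinite)

/-- Privacy against a coalition, with the simulator `S`. -/
def PrivateAgainst (S : Prog) (c : Coalition m) : Prop :=
  π.Simulates S c ∧ π.NoInference c

/-- The protocol computes the estimates: for given private data, the query node decrypts the
estimates on encoded numbers except with negligible probability, and, as the precision grows, these
tend to the Kalman estimates for the given real initial state and measurements. -/
def ComputesEstimates : Prop :=
  (∀ u : Inputs n p m K, Negligible fun κ =>
    ((π.execution κ).toOuterMeasure {E | π.decrypted E u ≠ π.target u}).toReal) ∧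
  ∀ (x : Fin n → ℝ) (y : Fin K → Fin m → Fin p → ℝ), ∀ k ≤ K, ∀ a : Fin n,
    Tendsto
      (fun e : ℕ =>
        (fixedEstimate π.plant π.base e
          (⟨fun b => encode π.base e (x b), fun t i j => encode π.base e (y t i j)⟩ :
            Inputs n p m K) k a : ℝ) / ((π.base : ℝ) ^ e) ^ (3 * k + 1))
      atTop (𝓝 (π.plant.estimate x (extend fun t => stack (y t)) k a))

end Protocol

namespace Plant

variable {n p m : ℕ} (θ : Plant n p m)

/-- The blocks of the gain matrix at time `t + 1` that belong to the sensors outside `s`. -/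
def restGain (s : Finset (Fin m)) (t : ℕ) : Matrix (Fin n) (Fin p × {i // i ∉ s}) ℝ :=
  Matrix.of fun a ji => θ.gain t a (ji.1, ji.2)

/-- What the query node and the sensors in `s` can compute from two consecutive estimates and
their own measurements `y` at time `t + 1`. -/
def knownPart (s : Finset (Fin m)) (t : ℕ) (old new : Fin n → ℝ) (y : s → Fin p → ℝ) :
    Fin n → ℝ :=
  let xp := θ.F.mulVec old
  new - xp + (θ.gain t).mulVec (θ.stackH.mulVec xp) -
    fun a => ∑ i : s, ∑ j : Fin p, θ.gain t a (j, i) * y i j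

/-- The linear system that the query node and the sensors in `s` obtain for the other measurements
holds for these measurements and has infinitely many solutions, at all times `1, …, K`. -/
def Underdetermined (K : ℕ) (s : Finset (Fin m)) : Prop :=
  ∀ (x : Fin n → ℝ) (y : Fin K → Fin m → Fin p → ℝ) (t : Fin K),
    let est := θ.estimate x (extend fun r => stack (y r))
    let z := θ.knownPart s t (est t) (est (t + 1)) fun i => y t i
    (θ.restGain s t).mulVec (fun ji => y t ji.2 ji.1) = z ∧
    {Y : Fin p × {i // i ∉ s} → ℝ | (θ.restGain s t).mulVec Y = z}.Infinite

end Plant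

end

end PrivateKalman

namespace PrivateKalman
noncomputable section

/-! ## Polynomial-time programs -/

/-! Correctness. Since `N ^ 2 = 0` in `ZMod (N ^ 2)`, the powers of `1 + N` are `1 + k * N`, so
`genPow` turns sums of plaintexts into products. Hence the ciphertext of an estimate is `genPow` of
the estimate times the value of the same circuit on encryptions of zero with the same coins
(`cipherEst_eq`). The second factor is killed by `lcm (P - 1) (Q - 1)`, so decryption yields the
estimate modulo `N`, as least absolute residue (`decrypted_eq`). For fixed data and large `κ` the
modulus exceeds twice the estimate. Convergence in the precision is an induction along the
recursion, each rounding error being at most half a unit.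

Simulation. The simulator sets all unknown private numbers to zero, runs the protocol itself and,
for the query node, multiplies the ciphertexts of the zero run by `genPow` of the given estimates.
Programs have only fair coins, so its encryption coins are nearly uniform residues instead of
uniform units; the statistical error is of order `2 ^ (-κ)` (`statClose_approxUnit`). With valid
keys and the true data in place of the zeros, this is the view up to that error (`statClose_view`).
It remains to replace the true data by zeros.

Without the aggregator, the ciphertexts of the hidden numbers occur only in the traffic on encrypted
channels. The messages have sizes that do not depend on the plaintexts, so channel security applies,
one channel at a time (`links_indist`, `simView_indist_of_secure`). This covers the query node,
against whom Paillier encryption hides nothing.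

With the aggregator, a hybrid argument runs over the hidden numbers (`aggRun_indist_update`). By the
residuosity assumption the mask `r ^ N` of one ciphertext may be replaced by a uniform unit modulo
`N ^ 2`; such a mask absorbs the factor `genPow` of the plaintext, which may therefore be changed to
zero, and the mask is then changed back.

Indeterminacy. Without the query node a coalition has no outputs, and nothing constrains the data of
the others. With the query node, the encoded gain block of the remaining sensors has more columns
than its `n` rows, hence a nonzero integral kernel vector; adding its multiples to the measurements
at one time changes no estimate. The real linear system is treated in the same way, by rank and
nullity.

All of this rests on a calculus of polynomial-time random functions (`Poly`, `PPT`), in which the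
reductions are written as compositions instead of explicit programs. -/

theorem polynomial_eval_mono (q : Polynomial ℕ) {a b : ℕ} (h : a ≤ b) : q.eval a ≤ q.eval b := by
  rw [Polynomial.eval_eq_sum_range, Polynomial.eval_eq_sum_range]
  exact Finset.sum_le_sum fun i _ => Nat.mul_le_mul_left _ (Nat.pow_le_pow_left h i)

namespace Data

theorem size_pos (d : Data) : 0 < d.size := by
  cases d <;> simp [size]

theorem size_left_le (d : Data) : d.left.size ≤ d.size := by
  cases d <;> simp [size, left]
  omega

theorem size_right_le (d : Data) : d.right.size ≤ d.size := by
  cases d <;> simp [size, right]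
  omega

theorem natSize_toNat_lt (d : Data) : Nat.size d.toNat < d.size := by
  cases d <;> simp [size, toNat]

theorem natSize_le_self (a : ℕ) : Nat.size a ≤ a := Nat.size_le.2 Nat.lt_two_pow_self

theorem size_num_le (a : ℕ) : (num a).size ≤ a + 1 := by
  simpa [size] using natSize_le_self a

theorem natSize_add_le (a b : ℕ) : Nat.size (a + b) ≤ Nat.size a + Nat.size b + 1 := by
  rw [Nat.size_le]
  have ha := Nat.lt_size_self a
  have hb := Nat.lt_size_self b
  have h1 : 2 ^ Nat.size a ≤ 2 ^ (Nat.size a + Nat.size b) := Nat.pow_le_pow_right (by norm_num) (by omega)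
  have h2 : 2 ^ Nat.size b ≤ 2 ^ (Nat.size a + Nat.size b) := Nat.pow_le_pow_right (by norm_num) (by omega)
  rw [pow_succ]
  omega

theorem natSize_mul_le (a b : ℕ) : Nat.size (a * b) ≤ Nat.size a + Nat.size b := by
  rw [Nat.size_le, pow_add]
  exact Nat.mul_lt_mul'' (Nat.lt_size_self a) (Nat.lt_size_self b)

end Data

/-! ### Sizes, costs and closure properties of polynomial time. -/

namespace Prog

/-- The summand `x.size` is needed for zero iterations, which return `x` at no cost. -/
theorem iter_size_le {φ : Data → PMF (Data × ℕ)}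
    (hφ : ∀ d, ∀ a ∈ (φ d).support, a.1.size ≤ a.2) (k : ℕ) :
    ∀ x, ∀ a ∈ (iter φ k x).support, a.1.size ≤ x.size + a.2 := by
  induction k with
  | zero => intro x a ha; simp [iter] at ha; simp [ha]
  | succ k ih =>
    intro x a ha
    simp only [iter, PMF.mem_support_bind_iff, PMF.mem_support_map_iff] at ha
    obtain ⟨y, hy, z, hz, rfl⟩ := ha
    have h1 := hφ x y hy
    have h2 := ih y.1 z hz
    simp only
    omega

theorem arith_size_le {f : ℕ → ℕ → ℕ} (hf : ∀ a b, Nat.size (f a b) ≤ Nat.size a + Nat.size b + 1)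
    (d : Data) : (arith f d).size ≤ 1 + d.size := by
  cases d with
  | num a =>
    -- Both components of a number default to `num 0`.
    have h := hf 0 0
    simp only [Nat.size_zero] at h
    simp only [arith, Data.left, Data.right, Data.toNat, Data.size]
    omega
  | pair a b =>
    have h := hf a.toNat b.toNat
    have ha := a.natSize_toNat_lt
    have hb := b.natSize_toNat_lt
    simp only [arith, Data.left, Data.right, Data.size]
    omega

/-- The cost of a program bounds the size of its result. -/
theorem size_le_cost (A : Prog) : ∀ d, ∀ a ∈ (A.run d).support, a.1.size ≤ a.2 := by
  induction A with
  | skip => intro d a ha; simp [run] at ha; simp [ha]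
  | const c => intro d a ha; simp [run] at ha; simp [ha]
  | fst => intro d a ha; simp [run] at ha; have := d.size_left_le; simp [ha]; omega
  | snd => intro d a ha; simp [run] at ha; have := d.size_right_le; simp [ha]; omega
  | pair f g hf hg =>
    intro d a ha
    simp only [run, PMF.mem_support_bind_iff, PMF.mem_support_map_iff] at ha
    obtain ⟨y, hy, z, hz, rfl⟩ := ha
    have h1 := hf d y hy
    have h2 := hg d z hz
    simp only [Data.size]
    omega
  | comp g f hg hf =>
    intro d a ha
    simp only [run, PMF.mem_support_bind_iff, PMF.mem_support_map_iff] at ha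
    obtain ⟨y, hy, z, hz, rfl⟩ := ha
    have h2 := hg _ z hz
    simp only
    omega
  | add =>
    intro d a ha; simp [run] at ha; subst ha
    exact arith_size_le Data.natSize_add_le d
  | sub =>
    intro d a ha; simp [run] at ha; subst ha
    exact arith_size_le (fun a b => (Nat.size_le_size (Nat.sub_le a b)).trans (by omega)) d
  | mul =>
    intro d a ha; simp [run] at ha; subst ha
    exact arith_size_le (fun a b => (Data.natSize_mul_le a b).trans (by omega)) d
  | div =>
    intro d a ha; simp [run] at ha; subst ha
    exact arith_size_le (fun a b => (Nat.size_le_size (Nat.div_le_self a b)).trans (by omega)) d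
  | mod =>
    intro d a ha; simp [run] at ha; subst ha
    exact arith_size_le (fun a b => (Nat.size_le_size (Nat.mod_le a b)).trans (by omega)) d
  | isNum =>
    intro d a ha
    have := d.size_pos
    cases d <;> simp only [run, PMF.mem_support_pure_iff] at ha <;> subst ha <;>
      simp only [Data.size, Nat.size_one, Nat.size_zero] at this ⊢ <;> omega
  | size =>
    intro d a ha; simp [run] at ha
    have := Data.size_num_le d.size
    simp [ha]; omega
  | ite c f g hc hf hg =>
    intro d a ha
    simp only [run, PMF.mem_support_bind_iff, PMF.mem_support_map_iff] at ha
    obtain ⟨y, hy, z, hz, rfl⟩ := ha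
    have : z.1.size ≤ z.2 := by
      split at hz
      · exact hg _ z hz
      · exact hf _ z hz
    simp only
    omega
  | loop f hf =>
    intro d a ha
    simp only [run, PMF.mem_support_map_iff] at ha
    obtain ⟨z, hz, rfl⟩ := ha
    have h := iter_size_le hf _ _ z hz
    have := d.size_right_le
    simp only
    omega
  | flip =>
    intro d a ha
    simp only [run, PMF.mem_support_map_iff] at ha
    obtain ⟨b, -, rfl⟩ := ha
    have := d.size_pos
    cases b <;> simp [Data.size] <;> omega

theorem mem_support_eval {A : Prog} {d b : Data} :
    b ∈ (A.eval d).support ↔ ∃ a ∈ (A.run d).support, a.1 = b := by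
  rw [eval, PMF.mem_support_map_iff]

theorem polyTime_of_le {A : Prog} (q : Polynomial ℕ)
    (h : ∀ d : Data, ∀ a ∈ (A.run d).support, a.2 ≤ q.eval d.size) : A.PolyTime := ⟨q, h⟩

theorem polyTime_skip : skip.PolyTime :=
  polyTime_of_le (1 + Polynomial.X) fun d a ha => by simp [run] at ha; simp [ha]

theorem polyTime_const (c : Data) : (const c).PolyTime :=
  polyTime_of_le (1 + Polynomial.X + Polynomial.C c.size) fun d a ha => by
    simp [run] at ha; simp [ha]

theorem polyTime_fst : fst.PolyTime :=
  polyTime_of_le (1 + Polynomial.X) fun d a ha => by simp [run] at ha; simp [ha]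

theorem polyTime_snd : snd.PolyTime :=
  polyTime_of_le (1 + Polynomial.X) fun d a ha => by simp [run] at ha; simp [ha]

theorem polyTime_add : add.PolyTime :=
  polyTime_of_le (1 + Polynomial.X) fun d a ha => by simp [run] at ha; simp [ha]

theorem polyTime_sub : sub.PolyTime :=
  polyTime_of_le (1 + Polynomial.X) fun d a ha => by simp [run] at ha; simp [ha]

theorem polyTime_mul : mul.PolyTime :=
  polyTime_of_le (1 + Polynomial.X) fun d a ha => by simp [run] at ha; simp [ha]

theorem polyTime_div : div.PolyTime :=
  polyTime_of_le (1 + Polynomial.X) fun d a ha => by simp [run] at ha; simp [ha]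

theorem polyTime_mod : mod.PolyTime :=
  polyTime_of_le (1 + Polynomial.X) fun d a ha => by simp [run] at ha; simp [ha]

theorem polyTime_size : size.PolyTime :=
  polyTime_of_le (1 + Polynomial.X) fun d a ha => by simp [run] at ha; simp [ha]

theorem polyTime_isNum : isNum.PolyTime :=
  polyTime_of_le (1 + Polynomial.X) fun d a ha => by
    simp only [run, PMF.mem_support_pure_iff] at ha; simp [ha]

theorem polyTime_flip : flip.PolyTime :=
  polyTime_of_le (1 + Polynomial.X) fun d a ha => by
    simp only [run, PMF.mem_support_map_iff] at ha
    obtain ⟨b, -, rfl⟩ := ha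
    simp

theorem PolyTime.pair {f g : Prog} (hf : f.PolyTime) (hg : g.PolyTime) :
    (Prog.pair f g).PolyTime := by
  obtain ⟨q, hq⟩ := hf
  obtain ⟨r, hr⟩ := hg
  refine polyTime_of_le (q + r + (1 + Polynomial.X)) fun d a ha => ?_
  simp only [run, PMF.mem_support_bind_iff, PMF.mem_support_map_iff] at ha
  obtain ⟨y, hy, z, hz, rfl⟩ := ha
  have h1 := hq d y hy
  have h2 := hr d z hz
  simp
  omega

/-- The second program runs on an intermediate result whose size is at most the cost of producing it
(`size_le_cost`); hence the composed polynomial. -/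
theorem PolyTime.comp {g f : Prog} (hg : g.PolyTime) (hf : f.PolyTime) :
    (Prog.comp g f).PolyTime := by
  obtain ⟨r, hr⟩ := hg
  obtain ⟨q, hq⟩ := hf
  refine polyTime_of_le (q + r.comp q + (1 + Polynomial.X)) fun d a ha => ?_
  simp only [run, PMF.mem_support_bind_iff, PMF.mem_support_map_iff] at ha
  obtain ⟨y, hy, z, hz, rfl⟩ := ha
  have h1 := hq d y hy
  have h2 := hr _ z hz
  have h3 := polynomial_eval_mono r ((size_le_cost f d y hy).trans h1)
  simp
  omega

theorem PolyTime.ite {c f g : Prog} (hc : c.PolyTime) (hf : f.PolyTime) (hg : g.PolyTime) :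
    (Prog.ite c f g).PolyTime := by
  obtain ⟨s, hs⟩ := hc
  obtain ⟨q, hq⟩ := hf
  obtain ⟨r, hr⟩ := hg
  refine polyTime_of_le (s + (q + r) + (1 + Polynomial.X)) fun d a ha => ?_
  simp only [run, PMF.mem_support_bind_iff, PMF.mem_support_map_iff] at ha
  obtain ⟨y, hy, z, hz, rfl⟩ := ha
  have h1 := hs d y hy
  have : z.2 ≤ q.eval d.size + r.eval d.size := by
    split at hz
    · exact (hr _ z hz).trans (by omega)
    · exact (hq _ z hz).trans (by omega)
  simp
  omega

/-! ### Laws of the results of the instructions. -/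

theorem eval_skip (d : Data) : skip.eval d = PMF.pure d := by simp [eval, run, PMF.pure_map]
theorem eval_const (c d : Data) : (const c).eval d = PMF.pure c := by
  simp [eval, run, PMF.pure_map]
theorem eval_fst (d : Data) : fst.eval d = PMF.pure d.left := by simp [eval, run, PMF.pure_map]
theorem eval_snd (d : Data) : snd.eval d = PMF.pure d.right := by simp [eval, run, PMF.pure_map]
theorem eval_add (d : Data) : add.eval d = PMF.pure (arith (· + ·) d) := by
  simp [eval, run, PMF.pure_map]
theorem eval_sub (d : Data) : sub.eval d = PMF.pure (arith (· - ·) d) := by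
  simp [eval, run, PMF.pure_map]
theorem eval_mul (d : Data) : mul.eval d = PMF.pure (arith (· * ·) d) := by
  simp [eval, run, PMF.pure_map]
theorem eval_div (d : Data) : div.eval d = PMF.pure (arith (· / ·) d) := by
  simp [eval, run, PMF.pure_map]
theorem eval_mod (d : Data) : mod.eval d = PMF.pure (arith (· % ·) d) := by
  simp [eval, run, PMF.pure_map]
theorem eval_size (d : Data) : size.eval d = PMF.pure (Data.num d.size) := by
  simp [eval, run, PMF.pure_map]

theorem eval_flip (d : Data) :
    flip.eval d = (PMF.uniformOfFintype Bool).map fun b => Data.num b.toNat := by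
  simp only [eval, run, PMF.map_comp]
  rfl

theorem eval_pair (f g : Prog) (d : Data) : (pair f g).eval d =
    (f.eval d).bind fun a => (g.eval d).map fun b => Data.pair a b := by
  simp only [eval, run, PMF.map_bind, PMF.bind_map, PMF.map_comp]
  rfl

theorem eval_comp (f g : Prog) (d : Data) : (comp g f).eval d = (f.eval d).bind g.eval := by
  simp only [eval, run, PMF.map_bind, PMF.bind_map, PMF.map_comp]
  rfl

theorem eval_ite (c f g : Prog) (d : Data) : (ite c f g).eval d =
    (c.eval d).bind fun a => open Classical in if a = Data.num 0 then g.eval d else f.eval d := by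
  simp only [eval, run, PMF.map_bind, PMF.bind_map, PMF.map_comp]
  congr 1
  funext a
  simp only [Function.comp_apply]
  split
  · rename_i h; simp only [h, if_true]; rfl
  · rename_i h; rw [if_neg (fun h' => h h')]; rfl

end Prog

/-- The `k`-fold iteration of a random step. -/
def iterate {α : Type} (F : α → PMF α) : ℕ → α → PMF α
  | 0, x => PMF.pure x
  | k + 1, x => (F x).bind (iterate F k)

namespace Prog

theorem map_fst_iter (φ : Data → PMF (Data × ℕ)) (k : ℕ) : ∀ x,
    (iter φ k x).map Prod.fst = iterate (fun d => (φ d).map Prod.fst) k x := by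
  induction k with
  | zero => intro x; simp [iter, iterate, PMF.pure_map]
  | succ k ih =>
    intro x
    simp only [iter, iterate, PMF.map_bind, PMF.bind_map, PMF.map_comp]
    congr 1
    funext a
    exact ih a.1

theorem eval_loop (f : Prog) (d : Data) :
    (loop f).eval d = iterate f.eval d.left.toNat d.right := by
  simp only [eval, run, PMF.map_comp]
  exact map_fst_iter _ _ _

/-- Polynomial cost of a single step does not bound a loop, because the state may grow from round to
round. The uniform bound `B` on all states that can be reached before a round excludes this. -/
theorem iter_cost_le {f : Prog} {q : Polynomial ℕ}
    (hq : ∀ d : Data, ∀ a ∈ (f.run d).support, a.2 ≤ q.eval d.size) {B : ℕ} (k : ℕ) :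
    ∀ x, (∀ j < k, ∀ y ∈ (iterate f.eval j x).support, y.size ≤ B) →
      ∀ a ∈ (iter f.run k x).support, a.2 ≤ k * q.eval B := by
  induction k with
  | zero => intro x _ a ha; simp [iter] at ha; simp [ha]
  | succ k ih =>
    intro x hx a ha
    simp only [iter, PMF.mem_support_bind_iff, PMF.mem_support_map_iff] at ha
    obtain ⟨y, hy, z, hz, rfl⟩ := ha
    have h1 : y.2 ≤ q.eval B :=
      (hq x y hy).trans (polynomial_eval_mono q (hx 0 (by omega) x (by simp [iterate])))
    -- What is reachable from `y.1` in `j` rounds is reachable from `x` in `j + 1` rounds.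
    have h2 := ih y.1 (fun j hj w hw => hx (j + 1) (by omega) w (by
      simp only [iterate, PMF.mem_support_bind_iff]
      exact ⟨y.1, mem_support_eval.2 ⟨y, hy, rfl⟩, hw⟩)) z hz
    simp only
    linarith

end Prog

/-! ## Random functions computable in polynomial time -/

/-- Types whose elements are represented by data. -/
class ToData (α : Type) where
  toData : α → Data

open ToData

/-- The security parameter as a type of its own, since it is represented in unary. -/
structure Sec where
  k : ℕ

instance : ToData Data := ⟨id⟩
instance : ToData ℕ := ⟨Data.num⟩
instance : ToData ℤ := ⟨Data.int⟩
instance : ToData Sec := ⟨fun s => Data.security s.k⟩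
instance {α β : Type} [ToData α] [ToData β] : ToData (α × β) :=
  ⟨fun x => Data.pair (toData x.1) (toData x.2)⟩
instance {α : Type} [ToData α] {k : ℕ} : ToData (Fin k → α) :=
  ⟨fun v => Data.vec fun i => toData (v i)⟩
instance {α : Type} [ToData α] : ToData (List α) := ⟨fun l => Data.list (l.map toData)⟩

variable {Γ α β γ : Type} [ToData Γ] [ToData α] [ToData β] [ToData γ]

/-- Random functions computed by a polynomial-time program. -/
def PPT (F : Γ → PMF α) : Prop :=
  ∃ A : Prog, A.PolyTime ∧ ∀ x, A.eval (toData x) = (F x).map toData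

/-- Functions computed by a polynomial-time program. -/
def Poly (f : Γ → α) : Prop := PPT fun x => PMF.pure (f x)

theorem Poly.of_prog {f : Γ → α} (A : Prog) (hA : A.PolyTime)
    (h : ∀ x, A.eval (toData x) = PMF.pure (toData (f x))) : Poly f :=
  ⟨A, hA, fun x => by rw [h, PMF.pure_map]⟩

theorem Poly.exists_prog {f : Γ → α} (hf : Poly f) :
    ∃ A : Prog, A.PolyTime ∧ ∀ x, A.eval (toData x) = PMF.pure (toData (f x)) := by
  obtain ⟨A, hA, h⟩ := hf
  exact ⟨A, hA, fun x => by rw [h, PMF.pure_map]⟩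

theorem Prog.PolyTime.ppt {A : Prog} (hA : A.PolyTime) : PPT fun d : Data => A.eval d :=
  ⟨A, hA, fun _ => (PMF.map_id _).symm⟩

theorem PPT.exists_eval_eq {F : Data → PMF Data} (hF : PPT F) :
    ∃ A : Prog, A.PolyTime ∧ ∀ d, A.eval d = F d := by
  obtain ⟨A, hA, h⟩ := hF
  exact ⟨A, hA, fun d => (h d).trans (PMF.map_id _)⟩

theorem Poly.id : Poly fun x : Γ => x :=
  .of_prog _ Prog.polyTime_skip fun _ => Prog.eval_skip _

theorem Poly.const (a : α) : Poly fun _ : Γ => a :=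
  .of_prog _ (Prog.polyTime_const _) fun _ => Prog.eval_const _ _

theorem PPT.comp {G : α → PMF β} {f : Γ → α} (hG : PPT G) (hf : Poly f) :
    PPT fun x => G (f x) := by
  obtain ⟨A, hA, h⟩ := hG
  obtain ⟨B, hB, h'⟩ := hf.exists_prog
  exact ⟨_, hA.comp hB, fun x => by rw [Prog.eval_comp, h', PMF.pure_bind, h]⟩

theorem Poly.comp {g : α → β} {f : Γ → α} (hg : Poly g) (hf : Poly f) :
    Poly fun x => g (f x) := PPT.comp (G := fun a => PMF.pure (g a)) hg hf

/-- The argument is kept next to the sample, by pairing with `skip`, so that `G` can use both. In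
this way the context `Γ` is carried through all later constructions. -/
theorem PPT.bind {F : Γ → PMF α} {G : Γ → α → PMF β} (hF : PPT F)
    (hG : PPT fun x : Γ × α => G x.1 x.2) : PPT fun x => (F x).bind (G x) := by
  obtain ⟨A, hA, h⟩ := hF
  obtain ⟨B, hB, h'⟩ := hG
  refine ⟨_, hB.comp (Prog.polyTime_skip.pair hA), fun x => ?_⟩
  rw [Prog.eval_comp, Prog.eval_pair, Prog.eval_skip, PMF.pure_bind, h, PMF.map_comp,
    PMF.bind_map, PMF.map_bind]
  congr 1
  funext a
  exact h' (x, a)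

theorem PPT.map {F : Γ → PMF α} {g : Γ → α → β} (hF : PPT F)
    (hg : Poly fun x : Γ × α => g x.1 x.2) : PPT fun x => (F x).map (g x) :=
  hF.bind (G := fun x a => PMF.pure (g x a)) hg

theorem Poly.fst {f : Γ → α × β} (hf : Poly f) : Poly fun x => (f x).1 :=
  Poly.comp (g := fun z : α × β => z.1) (.of_prog _ Prog.polyTime_fst fun _ => Prog.eval_fst _) hf

theorem Poly.snd {f : Γ → α × β} (hf : Poly f) : Poly fun x => (f x).2 :=
  Poly.comp (g := fun z : α × β => z.2) (.of_prog _ Prog.polyTime_snd fun _ => Prog.eval_snd _) hf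

theorem Poly.pair {f : Γ → α} {g : Γ → β} (hf : Poly f) (hg : Poly g) :
    Poly fun x => (f x, g x) := by
  obtain ⟨A, hA, h⟩ := hf.exists_prog
  obtain ⟨B, hB, h'⟩ := hg.exists_prog
  refine .of_prog _ (hA.pair hB) fun x => ?_
  rw [Prog.eval_pair, h, h', PMF.pure_bind, PMF.pure_map]
  rfl

theorem Poly.toData {f : Γ → α} (hf : Poly f) : Poly fun x => toData (f x) := by
  obtain ⟨A, hA, h⟩ := hf.exists_prog
  exact .of_prog A hA h

theorem Poly.of_toData {f : Γ → α} (hf : Poly fun x => ToData.toData (f x)) : Poly f := by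
  obtain ⟨A, hA, h⟩ := hf.exists_prog
  exact .of_prog A hA h

/-- A function on represented objects, given by a function on their representations. -/
theorem Poly.of_data {f : Γ → α} {g : Data → Data} (hg : Poly g)
    (h : ∀ x, g (ToData.toData x) = ToData.toData (f x)) : Poly f := by
  obtain ⟨A, hA, h'⟩ := hg.exists_prog
  exact .of_prog A hA fun x => (h' _).trans (by rw [← h]; rfl)

theorem Poly.dataPair {f g : Γ → Data} (hf : Poly f) (hg : Poly g) :
    Poly fun x => Data.pair (f x) (g x) := (hf.pair hg).toData

theorem Poly.dataLeft {f : Γ → Data} (hf : Poly f) : Poly fun x => (f x).left :=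
  Poly.comp (g := Data.left) (.of_prog _ Prog.polyTime_fst fun _ => Prog.eval_fst _) hf

theorem Poly.dataRight {f : Γ → Data} (hf : Poly f) : Poly fun x => (f x).right :=
  Poly.comp (g := Data.right) (.of_prog _ Prog.polyTime_snd fun _ => Prog.eval_snd _) hf

theorem Poly.dataSize {f : Γ → Data} (hf : Poly f) : Poly fun x => (f x).size :=
  Poly.comp (g := Data.size) (.of_prog _ Prog.polyTime_size fun _ => Prog.eval_size _) hf

theorem Poly.num {f : Γ → ℕ} (hf : Poly f) : Poly fun x => Data.num (f x) := hf.toData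

theorem Poly.arith {f g : Γ → ℕ} {A : Prog} {op : ℕ → ℕ → ℕ} (hA : A.PolyTime)
    (h : ∀ d, A.eval d = PMF.pure (Prog.arith op d)) (hf : Poly f) (hg : Poly g) :
    Poly fun x => op (f x) (g x) :=
  Poly.comp (g := fun z : ℕ × ℕ => op z.1 z.2) (.of_prog A hA fun _ => h _) (hf.pair hg)

theorem Poly.add {f g : Γ → ℕ} (hf : Poly f) (hg : Poly g) : Poly fun x => f x + g x :=
  .arith Prog.polyTime_add Prog.eval_add hf hg

theorem Poly.sub {f g : Γ → ℕ} (hf : Poly f) (hg : Poly g) : Poly fun x => f x - g x :=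
  .arith Prog.polyTime_sub Prog.eval_sub hf hg

theorem Poly.mul {f g : Γ → ℕ} (hf : Poly f) (hg : Poly g) : Poly fun x => f x * g x :=
  .arith Prog.polyTime_mul Prog.eval_mul hf hg

theorem Poly.div {f g : Γ → ℕ} (hf : Poly f) (hg : Poly g) : Poly fun x => f x / g x :=
  .arith Prog.polyTime_div Prog.eval_div hf hg

theorem Poly.mod {f g : Γ → ℕ} (hf : Poly f) (hg : Poly g) : Poly fun x => f x % g x :=
  .arith Prog.polyTime_mod Prog.eval_mod hf hg

theorem PPT.ite {c : Γ → ℕ} {F G : Γ → PMF α} (hc : Poly c) (hF : PPT F) (hG : PPT G) :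
    PPT fun x => if c x = 0 then F x else G x := by
  obtain ⟨C, hC, h⟩ := hc.exists_prog
  obtain ⟨A, hA, h'⟩ := hF
  obtain ⟨B, hB, h''⟩ := hG
  refine ⟨_, hC.ite hB hA, fun x => ?_⟩
  rw [Prog.eval_ite, h, PMF.pure_bind, h', h'']
  by_cases hx : c x = 0
  · rw [if_pos (by rw [hx]; rfl)]
    exact congrArg (PMF.map toData) (if_pos hx).symm
  · rw [if_neg (fun h => hx (by injection h))]
    exact congrArg (PMF.map toData) (if_neg hx).symm

theorem Poly.ite {c : Γ → ℕ} {f g : Γ → α} (hc : Poly c) (hf : Poly f) (hg : Poly g) :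
    Poly fun x => if c x = 0 then f x else g x := by
  have := PPT.ite (F := fun x => PMF.pure (f x)) (G := fun x => PMF.pure (g x)) hc hf hg
  unfold Poly
  convert this using 2
  exact apply_ite PMF.pure _ _ _

theorem Poly.ite_le {a b : Γ → ℕ} {f g : Γ → α} (ha : Poly a) (hb : Poly b) (hf : Poly f)
    (hg : Poly g) : Poly fun x => if a x ≤ b x then f x else g x := by
  convert Poly.ite (ha.sub hb) hf hg using 3
  rw [Nat.sub_eq_zero_iff_le]

theorem Poly.toNat {f : Γ → Data} (hf : Poly f) : Poly fun x => (f x).toNat := by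
  have : Poly fun d : Data => (Data.num d.toNat) := by
    -- Arithmetic instructions read a pair as `0`, so adding `0` computes `toNat`.
    refine .of_prog (Prog.comp Prog.add (Prog.pair Prog.skip (Prog.const (Data.num 0))))
      (Prog.polyTime_add.comp (Prog.polyTime_skip.pair (Prog.polyTime_const _))) fun d => ?_
    rw [Prog.eval_comp, Prog.eval_pair, Prog.eval_skip, Prog.eval_const, PMF.pure_bind,
      PMF.pure_map, PMF.pure_bind, Prog.eval_add]
    simp [Prog.arith, Data.left, Data.right, Data.toNat, ToData.toData]
  exact Poly.comp (g := Data.toNat) this.of_toData hf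

/-- Is the data a number? -/
def isNum : Data → ℕ
  | Data.num _ => 1
  | Data.pair _ _ => 0

theorem Poly.isNum {f : Γ → Data} (hf : Poly f) : Poly fun x => isNum (f x) := by
  refine Poly.comp (g := PrivateKalman.isNum) (.of_prog _ Prog.polyTime_isNum fun d => ?_) hf
  cases d <;> simp [Prog.eval, Prog.run, PMF.pure_map, PrivateKalman.isNum, ToData.toData]

/-- Equality with given data, as a number. -/
theorem Poly.ite_eq (c : Data) :
    Poly (α := ℕ) fun d : Data => open Classical in if d = c then 1 else 0 := by
  induction c with
  | num a =>
    -- With truncated subtraction, the sum of the two differences vanishes exactly for equal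
    -- numbers.
    have h : Poly fun d : Data => if PrivateKalman.isNum d = 0 then 0 else
        if (d.toNat - a) + (a - d.toNat) = 0 then 1 else 0 :=
      .ite (.isNum .id) (.const 0) (.ite (((Poly.toNat .id).sub (.const a)).add
        ((Poly.const a).sub (.toNat .id))) (.const 1) (.const 0))
    convert h using 2 with d
    cases d with
    | num b =>
      have : b - a + (a - b) = 0 ↔ b = a := by omega
      simp only [PrivateKalman.isNum, Data.toNat, this, Data.num.injEq]
      simp
    | pair b c => simp [PrivateKalman.isNum]
  | pair a b ha hb =>
    have h : Poly fun d : Data => if PrivateKalman.isNum d = 0 then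
        (open Classical in if d.left = a then 1 else 0) *
        (open Classical in if d.right = b then 1 else 0) else 0 :=
      .ite (.isNum .id) ((ha.comp (.dataLeft .id)).mul (hb.comp (.dataRight .id))) (.const 0)
    convert h using 2 with d
    cases d with
    | num b => simp [PrivateKalman.isNum]
    | pair c d =>
      by_cases h1 : c = a <;> by_cases h2 : d = b <;>
        simp [PrivateKalman.isNum, Data.left, Data.right, h1, h2]

theorem Data.vec_succ {k : ℕ} (f : Fin (k + 1) → Data) :
    Data.vec f = Data.pair (f 0) (Data.vec fun i => f i.succ) := by
  simp [Data.vec, List.ofFn_succ, Data.list]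

theorem Poly.dataVec {k : ℕ} {f : Fin k → Γ → Data} (hf : ∀ i, Poly (f i)) :
    Poly fun x => Data.vec fun i => f i x := by
  induction k with
  | zero => simpa [Data.vec] using Poly.const (Γ := Γ) (Data.list [])
  | succ k ih => simpa only [Data.vec_succ] using (hf 0).dataPair (ih fun i => hf i.succ)

theorem Poly.vec {k : ℕ} {f : Fin k → Γ → α} (hf : ∀ i, Poly (f i)) :
    Poly fun x => fun i => f i x :=
  .of_toData (.dataVec fun i => (hf i).toData)

/-- The `i`-th component of a vector. -/
def nth (i : ℕ) (d : Data) : Data := (Data.right^[i] d).left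

theorem nth_vec {k : ℕ} (f : Fin k → Data) (i : Fin k) : nth i (Data.vec f) = f i := by
  induction k with
  | zero => exact i.elim0
  | succ k ih =>
    rw [Data.vec_succ]
    refine Fin.cases ?_ (fun j => ?_) i
    · simp [nth, Data.left]
    · simp only [nth, Fin.val_succ, Function.iterate_succ, Function.comp_apply, Data.right]
      exact ih (fun i => f i.succ) j

theorem Poly.nth {f : Γ → Data} (hf : Poly f) (i : ℕ) : Poly fun x => nth i (f x) := by
  refine Poly.dataLeft ?_
  induction i with
  | zero => exact hf
  | succ i ih => simpa only [Function.iterate_succ', Function.comp_apply] using ih.dataRight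

theorem Poly.apply {k : ℕ} {f : Γ → Fin k → α} (hf : Poly f) (i : Fin k) :
    Poly fun x => f x i :=
  Poly.comp (g := fun v : Fin k → α => v i)
    (.of_data (.nth .id i) fun v => nth_vec (fun i => ToData.toData (v i)) i) hf

theorem Poly.dataList {l : List (Γ → Data)} (hl : ∀ f ∈ l, Poly f) :
    Poly fun x => Data.list (l.map fun f => f x) := by
  induction l with
  | nil => exact .const _
  | cons a l ih =>
    exact (hl a (by simp)).dataPair (ih fun f hf => hl f (by simp [hf]))

theorem Poly.natSum {ι : Type} (s : Finset ι) {f : ι → Γ → ℕ} (hf : ∀ i, Poly (f i)) :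
    Poly fun x => ∑ i ∈ s, f i x := by
  classical
  induction s using Finset.induction_on with
  | empty => simpa using Poly.const (Γ := Γ) 0
  | insert a s ha ih => simpa only [Finset.sum_insert ha] using (hf a).add ih

theorem Poly.polynomial_eval (q : Polynomial ℕ) {f : Γ → ℕ} (hf : Poly f) :
    Poly fun x => q.eval (f x) := by
  simp only [Polynomial.eval_eq_sum_range]
  refine .natSum _ fun i => (Poly.const _).mul ?_
  induction i with
  | zero => simpa using Poly.const (Γ := Γ) 1
  | succ i ih => simpa only [pow_succ] using ih.mul hf

/-! ### Integers -/

theorem Poly.natAbs {f : Γ → ℤ} (hf : Poly f) : Poly fun x => (f x).natAbs :=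
  Poly.comp (g := Int.natAbs) (.of_data (.dataRight .id) fun _ => rfl) hf

theorem Poly.negToNat {f : Γ → ℤ} (hf : Poly f) : Poly fun x => (-f x).toNat := by
  refine Poly.comp (g := fun z : ℤ => (-z).toNat) ?_ hf
  refine .of_data (g := fun d => Data.num (if d.left.toNat = 0 then 0 else d.right.toNat))
    (Poly.num (.ite (.toNat (.dataLeft .id)) (.const 0) (.toNat (.dataRight .id)))) fun z => ?_
  simp only [ToData.toData, Data.int, Data.left, Data.right, Data.toNat]
  split_ifs <;> simp_all <;> omega

theorem Poly.intToNat {f : Γ → ℤ} (hf : Poly f) : Poly fun x => (f x).toNat := by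
  convert hf.natAbs.sub hf.negToNat using 2
  omega

theorem Poly.natSub {f g : Γ → ℕ} (hf : Poly f) (hg : Poly g) :
    Poly fun x => (f x : ℤ) - (g x : ℤ) := by
  refine .of_toData ?_
  -- One of the two truncated differences is zero and the other is the absolute value.
  have := Poly.dataPair (f := fun x => Data.num (if g x ≤ f x then 0 else 1))
    (.num (.ite_le hg hf (.const 0) (.const 1))) ((hf.sub hg).add (hg.sub hf)).num
  convert this using 2 with x
  simp only [ToData.toData, Data.int]
  congr 2
  · split_ifs <;> omega
  · omega

/-- Integer arithmetic is done on positive and negative parts, which are natural numbers;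
`Poly.natSub` recombines them. -/
theorem Poly.intAdd {f g : Γ → ℤ} (hf : Poly f) (hg : Poly g) : Poly fun x => f x + g x := by
  convert (hf.intToNat.add hg.intToNat).natSub (hf.negToNat.add hg.negToNat) using 2
  push_cast
  omega

theorem Poly.intNeg {f : Γ → ℤ} (hf : Poly f) : Poly fun x => -f x := by
  convert hf.negToNat.natSub hf.intToNat using 2
  omega

theorem Poly.intSub {f g : Γ → ℤ} (hf : Poly f) (hg : Poly g) : Poly fun x => f x - g x := by
  simpa only [sub_eq_add_neg] using hf.intAdd hg.intNeg

theorem Poly.intMul {f g : Γ → ℤ} (hf : Poly f) (hg : Poly g) : Poly fun x => f x * g x := by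
  convert ((hf.intToNat.mul hg.intToNat).add (hf.negToNat.mul hg.negToNat)).natSub
    ((hf.intToNat.mul hg.negToNat).add (hf.negToNat.mul hg.intToNat)) using 2 with x
  have h1 : f x = ((f x).toNat : ℤ) - ((-f x).toNat : ℤ) := by omega
  have h2 : g x = ((g x).toNat : ℤ) - ((-g x).toNat : ℤ) := by omega
  conv_lhs => rw [h1, h2]
  push_cast
  ring

theorem Poly.intSum {ι : Type} (s : Finset ι) {f : ι → Γ → ℤ} (hf : ∀ i, Poly (f i)) :
    Poly fun x => ∑ i ∈ s, f i x := by
  classical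
  induction s using Finset.induction_on with
  | empty => simpa using Poly.const (Γ := Γ) (0 : ℤ)
  | insert a s ha ih => simpa only [Finset.sum_insert ha] using (hf a).intAdd ih

/-! ### Loops -/

/-- A loop is polynomial as soon as the number of rounds and the sizes of all reachable states are;
`p` and `q` are these two bounds. -/
theorem PPT.iterate {F : Data → PMF Data} {cnt : Data → ℕ} {init : Data → Data} (hF : PPT F)
    (hcnt : Poly cnt) (hinit : Poly init) (p q : Polynomial ℕ)
    (hp : ∀ d, cnt d ≤ p.eval d.size)
    (hq : ∀ d, ∀ j < cnt d, ∀ y ∈ (iterate F j (init d)).support, y.size ≤ q.eval d.size) :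
    PPT fun d => iterate F (cnt d) (init d) := by
  obtain ⟨A, ⟨r, hr⟩, h⟩ := hF
  obtain ⟨C, hC, h'⟩ := hcnt.exists_prog
  obtain ⟨I, hI, h''⟩ := hinit.exists_prog
  have hA : A.eval = F := funext fun d => (h d).trans (PMF.map_id _)
  obtain ⟨s, hs⟩ := hC.pair hI
  have hrun : ∀ d, (C.pair I).eval d = PMF.pure (Data.pair (Data.num (cnt d)) (init d)) := by
    intro d
    have h1 : C.eval d = _ := h' d
    have h2 : I.eval d = _ := h'' d
    rw [Prog.eval_pair, h1, h2, PMF.pure_bind, PMF.pure_map]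
    rfl
  refine ⟨Prog.comp (Prog.loop A) (C.pair I), ?_, fun d => ?_⟩
  -- The summands are the cost of computing the counter and the initial state, the rounds, the
  -- charge of the loop instruction for its argument (of size at most `s`), and the charge of the
  -- composition.
  · refine Prog.polyTime_of_le (s + (p * r.comp q + (1 + s)) + (1 + Polynomial.X))
      fun d a ha => ?_
    obtain ⟨y, hy, ha⟩ := (PMF.mem_support_bind_iff ((C.pair I).run d) _ a).1 ha
    simp only [Prog.run, PMF.mem_support_map_iff] at ha
    obtain ⟨z, ⟨w, hw, rfl⟩, rfl⟩ := ha
    have hy1 : y.1 = Data.pair (Data.num (cnt d)) (init d) := by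
      have := Prog.mem_support_eval.2 ⟨y, hy, rfl⟩
      rw [hrun] at this
      simpa using this
    have h1 := hs d y hy
    have h2 := Prog.size_le_cost _ _ y hy
    rw [hy1] at hw
    simp only [Data.left, Data.right, Data.toNat] at hw
    have h3 := Prog.iter_cost_le hr (B := q.eval d.size) (cnt d) (init d)
      (by rw [hA]; exact hq d) w hw
    have h4 : cnt d * r.eval (q.eval d.size) ≤ p.eval d.size * r.eval (q.eval d.size) :=
      Nat.mul_le_mul_right _ (hp d)
    simp
    omega
  · show (Prog.comp (Prog.loop A) (C.pair I)).eval d = _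
    rw [Prog.eval_comp, hrun, PMF.pure_bind, Prog.eval_loop, hA]
    exact (PMF.map_id _).symm

theorem iterate_pure {α : Type} (f : α → α) (k : ℕ) : ∀ x,
    iterate (fun x => PMF.pure (f x)) k x = PMF.pure (f^[k] x) := by
  induction k with
  | zero => intro x; rfl
  | succ k ih => intro x; simp [iterate, PMF.pure_bind, ih]

theorem Poly.iterate {f : Data → Data} {cnt : Data → ℕ} {init : Data → Data} (hf : Poly f)
    (hcnt : Poly cnt) (hinit : Poly init) (p q : Polynomial ℕ)
    (hp : ∀ d, cnt d ≤ p.eval d.size)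
    (hq : ∀ d, ∀ j < cnt d, (f^[j] (init d)).size ≤ q.eval d.size) :
    Poly fun d => f^[cnt d] (init d) := by
  have := PPT.iterate (F := fun d => PMF.pure (f d)) hf hcnt hinit p q hp (fun d j hj y hy => by
    rw [iterate_pure] at hy
    simp only [PMF.mem_support_pure_iff] at hy
    rw [hy]
    exact hq d j hj)
  simp only [iterate_pure] at this
  exact this

end
end PrivateKalman

namespace PrivateKalman
noncomputable section
open ToData
variable {Γ α β γ : Type} [ToData Γ] [ToData α] [ToData β] [ToData γ]

/-! ### Modular powers -/

/-- The state of the square-and-multiply algorithm modulo `m + 1`. -/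
def powState (m e b a : ℕ) : Data :=
  Data.pair (Data.num m) (Data.pair (Data.num e) (Data.pair (Data.num b) (Data.num a)))

/-- One step of the square-and-multiply algorithm. -/
def powStep (d : Data) : Data :=
  let m := d.left.toNat
  let e := d.right.left.toNat
  let b := d.right.right.left.toNat
  let a := d.right.right.right.toNat
  powState m (e / 2) (b * b % (m + 1)) (if e % 2 = 0 then a else a * b % (m + 1))

theorem poly_powState {m e b a : Γ → ℕ} (hm : Poly m) (he : Poly e) (hb : Poly b) (ha : Poly a) :
    Poly fun x => powState (m x) (e x) (b x) (a x) :=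
  hm.num.dataPair (he.num.dataPair (hb.num.dataPair ha.num))

theorem poly_powStep : Poly powStep := by
  have hm : Poly fun d : Data => d.left.toNat := .toNat (.dataLeft .id)
  have he : Poly fun d : Data => d.right.left.toNat := .toNat (.dataLeft (.dataRight .id))
  have hb : Poly fun d : Data => d.right.right.left.toNat :=
    .toNat (.dataLeft (.dataRight (.dataRight .id)))
  have ha : Poly fun d : Data => d.right.right.right.toNat :=
    .toNat (.dataRight (.dataRight (.dataRight .id)))
  exact poly_powState hm (he.div (.const 2)) ((hb.mul hb).mod (hm.add (.const 1)))
    (.ite (he.mod (.const 2)) ha ((ha.mul hb).mod (hm.add (.const 1))))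

theorem powStep_powState (m e b a : ℕ) : powStep (powState m e b a) =
    powState m (e / 2) (b * b % (m + 1)) (if e % 2 = 0 then a else a * b % (m + 1)) := rfl

/-- Supplies the bound on the states that a polynomial loop needs. The base is reduced only from the
first round on, hence `max b m`. -/
theorem iterate_powStep_bound (m k : ℕ) : ∀ e b a, a ≤ m → ∃ e' b' a',
    powStep^[k] (powState m e b a) = powState m e' b' a' ∧ e' ≤ e ∧ b' ≤ max b m ∧ a' ≤ m := by
  induction k with
  | zero => intro e b a ha; exact ⟨e, b, a, rfl, le_rfl, le_max_left _ _, ha⟩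
  | succ k ih =>
    intro e b a ha
    have hlt : ∀ x, x % (m + 1) ≤ m := fun x => Nat.lt_succ_iff.1 (Nat.mod_lt _ (Nat.succ_pos m))
    obtain ⟨e', b', a', h, h1, h2, h3⟩ := ih (e / 2) (b * b % (m + 1))
      (if e % 2 = 0 then a else a * b % (m + 1)) (by split_ifs; exacts [ha, hlt _])
    refine ⟨e', b', a', by rw [Function.iterate_succ_apply, powStep_powState, h],
      h1.trans (Nat.div_le_self _ _), h2.trans ?_, h3⟩
    have := hlt (b * b)
    omega

/-- The quantity `a * b ^ e` modulo `m + 1` is invariant under a step, and `k` halvings exhaust an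
exponent below `2 ^ k`. -/
theorem iterate_powStep (m k : ℕ) : ∀ e b a, e < 2 ^ k → a ≤ m → ∃ e' b',
    powStep^[k] (powState m e b a) = powState m e' b' (a * b ^ e % (m + 1)) := by
  induction k with
  | zero =>
    intro e b a he ha
    have : e = 0 := by simpa using he
    subst this
    exact ⟨0, b, by simp [Nat.mod_eq_of_lt (Nat.lt_succ_of_le ha)]⟩
  | succ k ih =>
    intro e b a he ha
    have hlt : ∀ x, x % (m + 1) ≤ m := fun x => Nat.lt_succ_iff.1 (Nat.mod_lt _ (Nat.succ_pos m))
    obtain ⟨e', b', h⟩ := ih (e / 2) (b * b % (m + 1))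
      (if e % 2 = 0 then a else a * b % (m + 1)) (by rw [pow_succ] at he; omega)
      (by split_ifs; exacts [ha, hlt _])
    refine ⟨e', b', ?_⟩
    rw [Function.iterate_succ_apply, powStep_powState, h]
    congr 1
    have h2 : (b * b % (m + 1)) ^ (e / 2) ≡ (b * b) ^ (e / 2) [MOD m + 1] :=
      (Nat.mod_modEq _ _).pow _
    have h3 : (b * b) ^ (e / 2) = b ^ (2 * (e / 2)) := by rw [← sq, ← pow_mul]
    rw [h3] at h2
    split_ifs with h0
    · have : 2 * (e / 2) = e := by omega
      rw [this] at h2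
      exact h2.mul_left a
    · have h4 := (Nat.mod_modEq (a * b) (m + 1)).mul h2
      have : a * b * b ^ (2 * (e / 2)) = a * b ^ e := by
        conv_rhs => rw [show e = 2 * (e / 2) + 1 by omega, pow_succ]
        ring
      rw [this] at h4
      exact h4

theorem Poly.powMod {m e b : Γ → ℕ} (hm : Poly m) (he : Poly e) (hb : Poly b) :
    Poly fun x => b x ^ e x % (m x + 1) := by
  -- The bit size of the represented exponent exceeds its number of binary digits, so this many
  -- rounds suffice. The accumulator starts with `1 % (m + 1)` so as to be reduced for the modulus
  -- one as well.
  have h : Poly fun d : Data => powStep^[d.right.left.size] (powState d.left.toNat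
      d.right.left.toNat d.right.right.toNat (1 % (d.left.toNat + 1))) := by
    have hm : Poly fun d : Data => d.left.toNat := .toNat (.dataLeft .id)
    refine Poly.iterate poly_powStep (.dataSize (.dataLeft (.dataRight .id)))
      (poly_powState hm (.toNat (.dataLeft (.dataRight .id)))
      (.toNat (.dataRight (.dataRight .id))) ((Poly.const 1).mod (hm.add (.const 1))))
      Polynomial.X (Polynomial.C 4 * Polynomial.X + Polynomial.C 4) (fun d => ?_) fun d j _ => ?_
    · simpa using d.right.size_left_le.trans d.size_right_le
    · obtain ⟨e', b', a', h, h1, h2, h3⟩ := iterate_powStep_bound d.left.toNat j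
        d.right.left.toNat d.right.right.toNat (1 % (d.left.toNat + 1))
        (Nat.lt_succ_iff.1 (Nat.mod_lt _ (Nat.succ_pos _)))
      rw [h]
      have s1 := d.left.natSize_toNat_lt.trans_le d.size_left_le
      have s2 := d.right.left.natSize_toNat_lt.trans_le
        (d.right.size_left_le.trans d.size_right_le)
      have s3 := d.right.right.natSize_toNat_lt.trans_le
        (d.right.size_right_le.trans d.size_right_le)
      have h1 := Nat.size_le_size h1
      have h3 := Nat.size_le_size h3
      have h2 : Nat.size b' < d.size := by
        rcases le_max_iff.1 h2 with h | h
        · exact (Nat.size_le_size h).trans_lt s3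
        · exact (Nat.size_le_size h).trans_lt s1
      simp only [powState, Data.size]
      simp
      omega
  have h' : Poly fun z : ℕ × ℕ × ℕ => z.2.2 ^ z.2.1 % (z.1 + 1) := by
    refine .of_data ((h.dataRight.dataRight.dataRight.toNat).num) fun z => ?_
    obtain ⟨e', b', h⟩ := iterate_powStep z.1 (Data.num z.2.1).size z.2.1 z.2.2 (1 % (z.1 + 1))
      ((Nat.lt_size_self _).trans_le (Nat.pow_le_pow_right (by norm_num) (by simp [Data.size])))
      (Nat.lt_succ_iff.1 (Nat.mod_lt _ (Nat.succ_pos _)))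
    have h2 : 1 % (z.1 + 1) * z.2.2 ^ z.2.1 % (z.1 + 1) = z.2.2 ^ z.2.1 % (z.1 + 1) := by
      conv_rhs => rw [← one_mul (z.2.2 ^ z.2.1)]
      rw [Nat.mod_mul_mod]
    rw [h2] at h
    exact congrArg (fun d : Data => Data.num d.right.right.right.toNat) h
  exact h'.comp (hm.pair (he.pair hb))

theorem Poly.two_pow_size {f : Γ → ℕ} (hf : Poly f) : Poly fun x => 2 ^ Nat.size (f x) := by
  have h : Poly fun x => Nat.size (f x) := by
    simpa [Data.size] using hf.num.dataSize.sub (.const 1)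
  -- The power is less than `2 * f x + 2`, so that reduction modulo this number does not change it,
  -- and a modular power can be used.
  convert Poly.powMod (((Poly.const 2).mul hf).add (.const 1)) h (.const 2) using 2 with x
  rw [Nat.mod_eq_of_lt]
  rcases Nat.eq_zero_or_pos (f x) with h0 | h0
  · simp [h0]
  · have : 2 ^ (Nat.size (f x) - 1) ≤ f x := by
      rw [← Nat.lt_size]
      have := Nat.size_pos.2 h0
      omega
    have h2 : 2 ^ Nat.size (f x) = 2 * 2 ^ (Nat.size (f x) - 1) := by
      rw [← pow_succ', Nat.sub_add_cancel (Nat.size_pos.2 h0)]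
    omega

/-! ### Random bit strings -/

/-- A uniform string of `k` bits, as a number. -/
def bits (k : ℕ) : PMF ℕ := PMF.uniformOfFinset (Finset.range (2 ^ k)) (by simp)

theorem bits_apply (k z : ℕ) : bits k z = if z < 2 ^ k then (2 ^ k : ENNReal)⁻¹ else 0 := by
  rw [bits, PMF.uniformOfFinset_apply]
  simp

/-- The first coin is the leading bit, in accordance with `bitStep`, which appends later bits at the
low end. -/
theorem bits_succ (k : ℕ) : bits (k + 1) = (PMF.uniformOfFintype Bool).bind fun c =>
    (bits k).map fun y => c.toNat * 2 ^ k + y := by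
  ext z
  rw [PMF.bind_apply, tsum_bool]
  simp only [PMF.uniformOfFintype_apply, Fintype.card_bool, Bool.toNat_false,
    Bool.toNat_true, zero_mul, zero_add, one_mul]
  have h0 : ((bits k).map fun y => y) z = bits k z := congrFun (congrArg _ (PMF.map_id _)) z
  have h1 : ((bits k).map fun y => 2 ^ k + y) z =
      if 2 ^ k ≤ z then bits k (z - 2 ^ k) else 0 := by
    rw [PMF.map_apply]
    split_ifs with h
    · exact (tsum_eq_single (z - 2 ^ k) fun b hb => if_neg (by omega)).trans (if_pos (by omega))
    · rw [ENNReal.tsum_eq_zero]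
      exact fun i => if_neg (by omega)
  rw [h0, h1, bits_apply, bits_apply, bits_apply]
  have hp : (2 ^ (k + 1) : ENNReal)⁻¹ = ((2 : ℕ) : ENNReal)⁻¹ * (2 ^ k)⁻¹ := by
    rw [pow_succ', ENNReal.mul_inv (by simp) (by simp)]
    norm_cast
  have hk : 2 ^ (k + 1) = 2 * 2 ^ k := pow_succ' 2 k
  rw [hp]
  by_cases c1 : z < 2 ^ k
  · rw [if_pos (by omega), if_pos c1, if_neg (by omega)]
    simp
  · by_cases c2 : z < 2 ^ (k + 1)
    · rw [if_pos c2, if_neg c1, if_pos (by omega), if_pos (by omega)]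
      simp
    · rw [if_neg c2, if_neg c1, if_pos (by omega), if_neg (by omega)]
      simp

/-- Appending a random bit. -/
def bitStep (d : Data) : PMF Data :=
  (PMF.uniformOfFintype Bool).map fun c => Data.num (2 * d.toNat + c.toNat)

theorem ppt_bitStep : PPT bitStep := by
  have h : PPT fun _ : Data => (PMF.uniformOfFintype Bool).map Bool.toNat :=
    ⟨Prog.flip, Prog.polyTime_flip, fun d => by rw [Prog.eval_flip, PMF.map_comp]; rfl⟩
  have := h.map (g := fun (d : Data) (c : ℕ) => Data.num (2 * d.toNat + c))
    (((Poly.const 2).mul (.toNat (.fst .id))).add (.snd .id)).num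
  simp only [PMF.map_comp] at this
  exact this

theorem iterate_bitStep (k : ℕ) : ∀ x : ℕ, iterate bitStep k (Data.num x) =
    (bits k).map fun y => Data.num (x * 2 ^ k + y) := by
  induction k with
  | zero =>
    intro x
    have : bits 0 = PMF.pure 0 := by
      ext z
      rw [bits_apply, PMF.pure_apply]
      simp
    simp [iterate, this, PMF.pure_map]
  | succ k ih =>
    intro x
    rw [iterate, bits_succ, bitStep, PMF.bind_map, PMF.map_bind]
    congr 1
    funext c
    simp only [Function.comp_apply, Data.toNat]
    rw [ih, PMF.map_comp]
    congr 1
    funext y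
    simp only [Function.comp_apply]
    congr 1
    rw [pow_succ]
    ring

theorem ppt_bits {cnt : Data → ℕ} (hcnt : Poly cnt) (p : Polynomial ℕ)
    (hp : ∀ d, cnt d ≤ p.eval d.size) : PPT fun d => bits (cnt d) := by
  have h := PPT.iterate (init := fun _ => Data.num 0) ppt_bitStep hcnt (.const _) p
    (1 + p) hp (fun d j hj y hy => by
      rw [iterate_bitStep] at hy
      obtain ⟨z, hz, rfl⟩ := (PMF.mem_support_map_iff _ _ _).1 hy
      have hz' : z < 2 ^ j := by
        by_contra hz'
        exact ((PMF.mem_support_iff _ _).1 hz) (by rw [bits_apply, if_neg hz'])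
      have := hp d
      have h3 := Nat.size_le.2 hz'
      simp [Data.size]
      omega)
  have := h.map (g := fun (_ : Data) (d : Data) => d.toNat) (.toNat (.snd .id))
  simp only [iterate_bitStep, PMF.map_comp] at this
  convert this using 2 with d
  simp only [Function.comp_def, Data.toNat, zero_mul, zero_add]
  exact (PMF.map_id _).symm

theorem Sec.size_toData (s : Sec) : (toData s).size = s.k + 2 := by
  simp [toData, Data.security, Data.size, Nat.size_pow]

theorem ppt_bits_sec (q : Polynomial ℕ) : PPT fun s : Sec => bits (q.eval s.k) := by
  -- The representation of `1^κ` has size `κ + 2`.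
  obtain ⟨A, hA, h⟩ := ppt_bits (cnt := fun d => q.eval (d.size - 2))
    (.polynomial_eval q (.sub (.dataSize .id) (.const 2))) q
    fun d => polynomial_eval_mono q (Nat.sub_le _ _)
  refine ⟨A, hA, fun s => ?_⟩
  have := h (toData s)
  refine this.trans ?_
  simp only [show (toData s).size = s.k + 2 from s.size_toData]
  rfl

/-- A nearly uniform residue modulo `N`. -/
def approxUnit (N : ℕ) : PMF ℕ := (bits (2 * (Nat.size N + 1))).map (· % N)

/-- Finitely many fair coins give only dyadic probabilities, so uniform units are in general out of
reach for a simulator with a time bound that holds for all coins. This law is the substitute,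
compared with the uniform one in `statClose_approxUnit`. -/
theorem ppt_approxUnit : PPT approxUnit := by
  obtain ⟨A, hA, h⟩ := ppt_bits (cnt := fun d => 2 * d.size) ((Poly.const 2).mul (.dataSize .id))
    (2 * Polynomial.X) (fun d => by simp)
  have h' : PPT fun N : ℕ => bits (2 * (Nat.size N + 1)) := ⟨A, hA, fun N => h (toData N)⟩
  exact h'.map (g := fun N x => x % N) ((Poly.snd .id).mod (.fst .id))

/-- Independent samples. -/
def iid {α : Type} (q : PMF α) : (k : ℕ) → PMF (Fin k → α)
  | 0 => PMF.pure Fin.elim0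
  | k + 1 => q.bind fun a => (iid q k).map fun v => Fin.cons a v

theorem PPT.iid {F : Γ → PMF α} (hF : PPT F) (k : ℕ) : PPT fun x => iid (F x) k := by
  induction k with
  | zero => exact Poly.const _
  | succ k ih =>
    refine hF.bind (G := fun x a => (PrivateKalman.iid (F x) k).map fun v => Fin.cons a v) ?_
    refine PPT.map (g := fun (z : Γ × α) v => (Fin.cons z.2 v : Fin (k + 1) → α))
      (ih.comp (.fst .id)) ?_
    have h : ∀ i : Fin (k + 1), Poly fun z : (Γ × α) × (Fin k → α) =>
        (Fin.cons z.1.2 z.2 : Fin (k + 1) → α) i := fun i =>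
      Fin.cases (by simpa using Poly.snd (.fst .id))
        (fun j => by simpa using Poly.apply (.snd .id) j) i
    exact Poly.vec h

/-- Independent samples, one for each index. -/
def iidFamily {α : Type} (q : PMF α) (ι : Type) [Fintype ι] : PMF (ι → α) :=
  (iid q (Fintype.card ι)).map fun v i => v (Fintype.equivFin ι i)

end
end PrivateKalman

namespace PrivateKalman
noncomputable section
open ToData
variable {Γ : Type} [ToData Γ]

/-! ## Statistical distance -/

section StatClose
open scoped ENNReal
variable {α β γ : Type}

theorem tsum_bind_mul (X : PMF α) (F : α → PMF β) (f : β → ℝ≥0∞) :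
    ∑' b, X.bind F b * f b = ∑' a, X a * ∑' b, F a b * f b := by
  simp only [PMF.bind_apply, ← ENNReal.tsum_mul_right, ← ENNReal.tsum_mul_left]
  rw [ENNReal.tsum_comm]
  simp only [mul_assoc]

theorem tsum_mul_le_one (X : PMF α) {f : α → ℝ≥0∞} (hf : ∀ a, f a ≤ 1) :
    ∑' a, X a * f a ≤ 1 := by
  rw [← X.tsum_coe]
  exact ENNReal.tsum_le_tsum fun a => mul_le_of_le_one_right' (hf a)

/-- The statistical distance is at most `ε`. -/
def StatClose (ε : ℝ≥0∞) (X Y : PMF α) : Prop :=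
  ∀ f : α → ℝ≥0∞, (∀ a, f a ≤ 1) → ∑' a, X a * f a ≤ ∑' a, Y a * f a + ε

variable {ε δ : ℝ≥0∞} {X Y Z : PMF α}

theorem StatClose.refl (ε : ℝ≥0∞) (X : PMF α) : StatClose ε X X := fun _ _ => le_self_add

theorem StatClose.mono (h : StatClose ε X Y) (hε : ε ≤ δ) : StatClose δ X Y :=
  fun f hf => (h f hf).trans (by gcongr)

theorem StatClose.trans (h : StatClose ε X Y) (h' : StatClose δ Y Z) : StatClose (ε + δ) X Z :=
  fun f hf => (h f hf).trans (by rw [add_comm ε, ← add_assoc]; gcongr; exact h' f hf)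

/-- The defining inequality is one-sided; applied to `1 - f` it gives the opposite one, since both
laws have total mass one. -/
theorem StatClose.symm (h : StatClose ε X Y) : StatClose ε Y X := by
  intro f hf
  have hsum : ∀ W : PMF α, ∑' a, W a * f a + ∑' a, W a * (1 - f a) = 1 := by
    intro W
    rw [← ENNReal.tsum_add]
    refine (tsum_congr fun a => ?_).trans W.tsum_coe
    rw [← mul_add, add_tsub_cancel_of_le (hf a), mul_one]
  have h1 := h (fun a => 1 - f a) fun a => tsub_le_self
  have hfin : ∑' a, Y a * (1 - f a) ≠ ∞ :=
    ((tsum_mul_le_one Y fun a => tsub_le_self).trans_lt ENNReal.one_lt_top).ne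
  refine (ENNReal.add_le_add_iff_right hfin).1 ?_
  calc _ = ∑' a, X a * f a + ∑' a, X a * (1 - f a) := by rw [hsum, hsum]
    _ ≤ ∑' a, X a * f a + (∑' a, Y a * (1 - f a) + ε) := by gcongr
    _ = _ := by ring

theorem StatClose.bind (h : StatClose ε X Y) (F : α → PMF β) :
    StatClose ε (X.bind F) (Y.bind F) := by
  intro f hf
  rw [tsum_bind_mul, tsum_bind_mul]
  exact h _ fun a => tsum_mul_le_one _ hf

theorem StatClose.map (h : StatClose ε X Y) (g : α → β) : StatClose ε (X.map g) (Y.map g) :=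
  h.bind _

/-- Kernels that are close outside an exceptional set. -/
theorem StatClose.bind_of_notMem {F G : α → PMF β} (B : Set α) (hB : X.toOuterMeasure B ≤ δ)
    (h : ∀ a ∈ X.support, a ∉ B → StatClose ε (F a) (G a)) :
    StatClose (δ + ε) (X.bind F) (X.bind G) := by
  intro f hf
  rw [tsum_bind_mul, tsum_bind_mul]
  calc _ ≤ ∑' a, (X a * ∑' b, G a b * f b + (B.indicator X a + X a * ε)) := by
        refine ENNReal.tsum_le_tsum fun a => ?_
        by_cases hs : a ∈ X.support
        · by_cases ha : a ∈ B
          · rw [Set.indicator_of_mem ha]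
            refine (mul_le_of_le_one_right' (tsum_mul_le_one _ hf)).trans ?_
            exact le_add_left le_self_add
          · rw [Set.indicator_of_notMem ha, zero_add, ← mul_add]
            gcongr
            exact h a hs ha f hf
        · rw [(PMF.apply_eq_zero_iff X a).2 hs, zero_mul]
          exact zero_le
    _ = ∑' a, X a * ∑' b, G a b * f b + (X.toOuterMeasure B + ε) := by
        rw [ENNReal.tsum_add, ENNReal.tsum_add, ENNReal.tsum_mul_right, X.tsum_coe, one_mul,
          PMF.toOuterMeasure_apply]
    _ ≤ _ := by gcongr

theorem StatClose.bind_right {F G : α → PMF β} (h : ∀ a, StatClose ε (F a) (G a)) :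
    StatClose ε (X.bind F) (X.bind G) := by
  have := StatClose.bind_of_notMem (X := X) (δ := 0) ∅ (by simp) fun a _ _ => h a
  simpa using this

theorem StatClose.bind_bind {F G : α → PMF β} (h : StatClose ε X Y)
    (h' : ∀ a, StatClose δ (F a) (G a)) : StatClose (ε + δ) (X.bind F) (Y.bind G) :=
  (h.bind F).trans (.bind_right h')

/-- A pointwise relative error `ε` sums to `ε`, because `X` has mass one. Only a lower bound for `Y`
on the support of `X` is needed. -/
theorem StatClose.of_le_add (h : ∀ a, X a ≤ Y a + ε * X a) : StatClose ε X Y := by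
  intro f hf
  calc _ ≤ ∑' a, (Y a * f a + ε * X a) := by
        refine ENNReal.tsum_le_tsum fun a => ?_
        calc X a * f a ≤ (Y a + ε * X a) * f a := by gcongr; exact h a
          _ = Y a * f a + ε * X a * f a := add_mul _ _ _
          _ ≤ _ := add_le_add le_rfl (mul_le_of_le_one_right' (hf a))
    _ = _ := by rw [ENNReal.tsum_add, ENNReal.tsum_mul_left, X.tsum_coe, mul_one]

theorem StatClose.iid (h : StatClose ε X Y) (k : ℕ) : StatClose (k * ε) (iid X k) (iid Y k) := by
  induction k with
  | zero => exact .refl _ _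
  | succ k ih =>
    have := h.bind_bind (F := fun a => (PrivateKalman.iid X k).map fun v => (Fin.cons a v : Fin (k + 1) → α))
      (G := fun a => (PrivateKalman.iid Y k).map fun v => Fin.cons a v) fun a => ih.map _
    refine this.mono ?_
    push_cast
    rw [add_mul, one_mul, add_comm]

theorem StatClose.iidFamily (h : StatClose ε X Y) (ι : Type) [Fintype ι] :
    StatClose (Fintype.card ι * ε) (iidFamily X ι) (iidFamily Y ι) := (h.iid _).map _

/-! ## Products -/

theorem iid_apply (q : PMF α) (k : ℕ) (x : Fin k → α) : iid q k x = ∏ i, q (x i) := by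
  induction k with
  | zero => simp [iid, PMF.pure_apply, Subsingleton.elim x Fin.elim0]
  | succ k ih =>
    rw [iid, PMF.bind_apply, Fin.prod_univ_succ, tsum_eq_single (x 0)]
    · congr 1
      rw [PMF.map_apply, tsum_eq_single (Fin.tail x), if_pos (Fin.cons_self_tail x).symm, ih]
      · rfl
      · intro v hv
        refine if_neg fun h => hv ?_
        rw [h, Fin.tail_cons]
    · intro a ha
      rw [PMF.map_apply, ENNReal.tsum_eq_zero.2, mul_zero]
      intro v
      refine if_neg fun h => ha ?_
      rw [h, Fin.cons_zero]

theorem iidFamily_apply (q : PMF α) {ι : Type} [Fintype ι] (x : ι → α) :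
    iidFamily q ι x = ∏ i, q (x i) := by
  rw [iidFamily, PMF.map_apply, tsum_eq_single fun j => x ((Fintype.equivFin ι).symm j)]
  · rw [if_pos (by simp), iid_apply]
    exact ((Fintype.equivFin ι).symm.prod_comp fun i => q (x i))
  · intro v hv
    refine if_neg fun h => hv ?_
    funext j
    rw [h]
    simp

/-- Replacing one component by a fresh sample does not change the law. -/
theorem iidFamily_resample (q : PMF α) {ι : Type} [Fintype ι] [DecidableEq ι] (σ : ι) :
    (q.bind fun a => (iidFamily q ι).map fun r => Function.update r σ a) = iidFamily q ι := by
  ext x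
  rw [PMF.bind_apply, tsum_eq_single (x σ), PMF.map_apply, iidFamily_apply]
  -- Only those families contribute that agree with `x` off `σ`. They are parametrised by their
  -- value `b` at `σ`, and the weights `q b` sum to one.
  · have hinj : Function.Injective fun b => Function.update x σ b := fun b c h => by
      simpa using congrFun h σ
    rw [← hinj.tsum_eq]
    · have h1 : ∀ b, @ite _ (x = Function.update (Function.update x σ b) σ (x σ))
          (Classical.propDecidable _) (iidFamily q ι (Function.update x σ b)) 0 =
          q b * ∏ i ∈ Finset.univ \ {σ}, q (x i) := by
        intro b
        rw [if_pos (by simp), iidFamily_apply]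
        rw [← Finset.prod_update_of_mem (Finset.mem_univ σ)]
        refine Finset.prod_congr rfl fun i _ => ?_
        by_cases hi : i = σ
        · subst hi; simp
        · simp [hi]
      refine (congrArg (q (x σ) * ·) ((tsum_congr h1).trans ENNReal.tsum_mul_right)).trans ?_
      rw [q.tsum_coe, one_mul]
      rw [← Finset.prod_update_of_mem (Finset.mem_univ σ) (fun i => q (x i))]
      simp
    · intro r hr
      have h : x = Function.update r σ (x σ) := by
        by_contra h
        exact hr (if_neg h)
      refine ⟨r σ, ?_⟩
      rw [h]
      simp
  · intro a ha
    rw [PMF.map_apply, ENNReal.tsum_eq_zero.2, mul_zero]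
    intro r
    refine if_neg fun h => ha ?_
    rw [h]
    simp

/-! ### Uniform units and their approximation. -/

open Classical in
theorem uniformOr_apply (s : Finset α) (a x : α) : uniformOr s a x =
    if s.Nonempty then (if x ∈ s then (s.card : ℝ≥0∞)⁻¹ else 0) else if x = a then 1 else 0 := by
  unfold uniformOr
  split_ifs with h <;> simp_all [PMF.uniformOfFinset_apply]

/-- The uniform law on a finite product is the product of the uniform laws; in this form single
coins can be resampled or approximated. If there are no residues, both sides are the point mass at
the constant family `1`. -/
theorem uniformUnits_eq (ι : Type) [Fintype ι] [DecidableEq ι] (M : ℕ) :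
    uniformUnits ι M = iidFamily (uniformOr (unitResidues M) 1) ι := by
  classical
  ext x
  rw [iidFamily_apply, uniformUnits, uniformOr_apply]
  simp only [uniformOr_apply, Fintype.piFinset_nonempty]
  by_cases hs : (unitResidues M).Nonempty
  · simp only [hs, implies_true, if_true, Fintype.mem_piFinset, Fintype.card_piFinset,
      Finset.prod_const, Finset.card_univ]
    split_ifs with h
    · simp only [h, if_true, Finset.prod_const, Finset.card_univ, Nat.cast_pow]
      rw [ENNReal.inv_pow]
    · push Not at h
      obtain ⟨i, hi⟩ := h
      exact (Finset.prod_eq_zero (Finset.mem_univ i) (if_neg hi)).symm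
  · rcases isEmpty_or_nonempty ι with hι | hι
    · simp [eq_iff_true_of_subsingleton]
    · simp only [hs, forall_const, if_false]
      split_ifs with h
      · simp [h]
      · have : ∃ i, x i ≠ 1 := by
          by_contra hc
          push Not at hc
          exact h (funext hc)
        obtain ⟨i, hi⟩ := this
        exact (Finset.prod_eq_zero (Finset.mem_univ i) (if_neg hi)).symm

theorem mem_of_mem_support_uniformUnits {ι : Type} [Fintype ι] [DecidableEq ι] {M : ℕ}
    (hM : M ≠ 0) {r : ι → ℕ} (hr : r ∈ (uniformUnits ι M).support) (i : ι) :
    Nat.Coprime (r i) M := by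
  classical
  have hne : (unitResidues M).Nonempty := by
    -- The reduction matters for `M = 1`, where the only residue is `0`.
    refine ⟨1 % M, ?_⟩
    simp only [unitResidues, Finset.mem_filter, Finset.mem_range]
    refine ⟨Nat.mod_lt _ (Nat.pos_of_ne_zero hM), ?_⟩
    rw [Nat.coprime_iff_gcd_eq_one, ← Nat.gcd_rec, Nat.gcd_one_right]
  rw [uniformUnits_eq, PMF.mem_support_iff, iidFamily_apply, Finset.prod_ne_zero_iff] at hr
  have h := hr i (Finset.mem_univ i)
  rw [uniformOr_apply, if_pos hne] at h
  have : r i ∈ unitResidues M := by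
    by_contra hc
    exact h (if_neg hc)
  exact (Finset.mem_filter.1 this).2

/-- The numbers `a + j * N` with `j < 2 ^ L / N` are distinct bit strings of length `L` with residue
`a`. -/
theorem le_approxUnit {N a : ℕ} (ha : a < N) :
    ((2 ^ (2 * (Nat.size N + 1)) / N : ℕ) : ℝ≥0∞) * (2 ^ (2 * (Nat.size N + 1)))⁻¹ ≤
      approxUnit N a := by
  set L := 2 * (Nat.size N + 1)
  rw [approxUnit, PMF.map_apply]
  refine le_trans ?_ (ENNReal.sum_le_tsum ((Finset.range (2 ^ L / N)).image fun j => a + j * N))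
  rw [Finset.sum_image]
  · refine le_of_eq ?_
    rw [← nsmul_eq_mul]
    conv_lhs => rw [← Finset.card_range (2 ^ L / N)]
    rw [← Finset.sum_const]
    refine Finset.sum_congr rfl fun j hj => ?_
    rw [if_pos (by rw [Nat.add_mul_mod_self_right, Nat.mod_eq_of_lt ha]), bits_apply, if_pos]
    have h1 : j + 1 ≤ 2 ^ L / N := Finset.mem_range.1 hj
    have h2 := (Nat.mul_le_mul_right N h1).trans (Nat.div_mul_le_self _ _)
    rw [add_mul] at h2
    change a + j * N < 2 ^ L
    omega
  · intro j _ j' _ h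
    have : j * N = j' * N := by simpa using h
    exact Nat.eq_of_mul_eq_mul_right (by omega) this

/-- A residue has approximate probability at least `1 / N - 1 / 2 ^ L`, hence at least `1 / N - 1 /
N ^ 2`. Multiplied by the number `φ = (P - 1) * (Q - 1)` of units, this is at least `1 - 1 / P - 1 /
Q`, and both primes are at least `2 ^ (κ - 1)`. The numerator `6` leaves room. -/
theorem statClose_approxUnit {κ P Q : ℕ} (h : ValidPrimes κ P Q) :
    StatClose (ENNReal.ofReal (6 / 2 ^ κ)) (uniformOr (unitResidues (P * Q)) 1)
      (approxUnit (P * Q)) := by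
  classical
  obtain ⟨hP, hQ, hne, hPs, hQs⟩ := h
  set N := P * Q with hN
  have hP2 := hP.two_le
  have hQ2 := hQ.two_le
  have hκ : 0 < κ := hPs ▸ Nat.size_pos.2 hP.pos
  have hPκ : 2 ^ (κ - 1) ≤ P := by rw [← Nat.lt_size]; omega
  have hQκ : 2 ^ (κ - 1) ≤ Q := by rw [← Nat.lt_size]; omega
  have hN4 : 0 < N := Nat.mul_pos hP.pos hQ.pos
  have hcard : (unitResidues N).card = (P - 1) * (Q - 1) := by
    rw [← Nat.totient_prime hP, ← Nat.totient_prime hQ,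
      ← Nat.totient_mul ((Nat.coprime_primes hP hQ).2 hne), Nat.totient]
    congr 1
    exact Finset.filter_congr fun x _ => Nat.coprime_comm
  have hφ : 0 < (P - 1) * (Q - 1) := Nat.mul_pos (by omega) (by omega)
  refine .of_le_add fun a => ?_
  have hne' : (unitResidues N).Nonempty := Finset.card_pos.1 (by omega)
  rw [uniformOr_apply, if_pos hne']
  split_ifs with ha
  swap
  · exact zero_le
  have haN : a < N := Finset.mem_range.1 (Finset.mem_filter.1 ha).1
  refine le_trans ?_ (add_le_add_left (le_approxUnit haN) _)
  rw [hcard]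
  set L := 2 * (Nat.size N + 1)
  set q := 2 ^ L / N
  have e1 : (((P - 1) * (Q - 1) : ℕ) : ℝ≥0∞)⁻¹ =
      ENNReal.ofReal ((((P - 1) * (Q - 1) : ℕ) : ℝ)⁻¹) := by
    rw [ENNReal.ofReal_inv_of_pos (by exact_mod_cast hφ), ENNReal.ofReal_natCast]
  have e2 : (q : ℝ≥0∞) * (2 ^ L)⁻¹ = ENNReal.ofReal (q * (2 ^ L)⁻¹) := by
    rw [ENNReal.ofReal_mul (by positivity), ENNReal.ofReal_natCast,
      ENNReal.ofReal_inv_of_pos (by positivity), ENNReal.ofReal_pow (by norm_num)]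
    simp
  rw [e1, e2, ← ENNReal.ofReal_mul (by positivity), ← ENNReal.ofReal_add (by positivity)
    (by positivity)]
  refine ENNReal.ofReal_le_ofReal ?_
  have hq : (2 : ℝ) ^ L ≤ q * N + N := by
    have := Nat.lt_div_mul_add hN4 (a := 2 ^ L)
    exact_mod_cast this.le
  have hLN : (N : ℝ) * N ≤ 2 ^ L := by
    have h1 := (Nat.lt_size_self N).le
    have : N * N ≤ 2 ^ L := by
      calc N * N ≤ 2 ^ Nat.size N * 2 ^ Nat.size N := Nat.mul_le_mul h1 h1
        _ ≤ 2 ^ L := by rw [← pow_add]; exact Nat.pow_le_pow_right (by norm_num) (by omega)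
    exact_mod_cast this
  have hφ' : (((P - 1) * (Q - 1) : ℕ) : ℝ) = ((P : ℝ) - 1) * (Q - 1) := by
    push_cast [Nat.cast_sub hP.one_le, Nat.cast_sub hQ.one_le]
    ring
  have hNr : (N : ℝ) = P * Q := by rw [hN]; push_cast; ring
  have h2κ : (2 : ℝ) ^ κ = 2 * 2 ^ (κ - 1) := by
    rw [← pow_succ', Nat.sub_add_cancel hκ]
  have hPr : (2 : ℝ) ^ (κ - 1) ≤ P := by exact_mod_cast hPκ
  have hQr : (2 : ℝ) ^ (κ - 1) ≤ Q := by exact_mod_cast hQκ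
  have hP1 : (2 : ℝ) ≤ P := by exact_mod_cast hP2
  have hQ1 : (2 : ℝ) ≤ Q := by exact_mod_cast hQ2
  have hφp : (0 : ℝ) < ((P : ℝ) - 1) * (Q - 1) := mul_pos (by linarith) (by linarith)
  rw [hφ']
  set φ := ((P : ℝ) - 1) * (Q - 1) with hφd
  have hNp : (0 : ℝ) < N := by exact_mod_cast hN4
  have key : 1 ≤ φ * (q * (2 ^ L)⁻¹) + 6 / 2 ^ κ := by
    have a1 : 1 / (N : ℝ) - 1 / 2 ^ L ≤ q * (2 ^ L)⁻¹ := by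
      rw [div_sub_div _ _ hNp.ne' (by positivity), ← div_eq_mul_inv, div_le_div_iff₀ (by positivity)
        (by positivity)]
      nlinarith [hq, pow_pos (show (0 : ℝ) < 2 by norm_num) L]
    have a2 : 1 / (2 : ℝ) ^ L ≤ 1 / (N * N) := one_div_le_one_div_of_le (by positivity) hLN
    have a3 : φ * (1 / (N : ℝ) - 1 / (N * N)) ≤ φ * (q * (2 ^ L)⁻¹) := by
      gcongr
      linarith
    have a4 : 1 / (P : ℝ) ≤ 1 / 2 ^ (κ - 1) := one_div_le_one_div_of_le (by positivity) hPr
    have a5 : 1 / (Q : ℝ) ≤ 1 / 2 ^ (κ - 1) := one_div_le_one_div_of_le (by positivity) hQr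
    have a6 : 6 / (2 : ℝ) ^ κ = 3 * (1 / 2 ^ (κ - 1)) := by rw [h2κ]; field_simp; norm_num
    have a7 : φ * (1 / (N : ℝ) - 1 / (N * N)) = φ / N - φ / N / N := by field_simp
    have a8 : φ / N = 1 - 1 / P - 1 / Q + 1 / N := by
      rw [hφd, hNr]; field_simp; ring
    have a9 : φ / N / N ≤ 1 / N := by
      gcongr
      rw [div_le_one hNp, hφd, hNr]
      nlinarith
    have a10 : 0 ≤ 1 / (2 : ℝ) ^ (κ - 1) := by positivity
    linarith
  calc φ⁻¹ = φ⁻¹ * 1 := (mul_one _).symm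
    _ ≤ φ⁻¹ * (φ * (q * (2 ^ L)⁻¹) + 6 / 2 ^ κ) := by gcongr
    _ = _ := by field_simp

end StatClose

/-! ## Negligible functions -/

theorem Negligible.mono {f g : ℕ → ℝ} (hg : Negligible g) (h : ∀ᶠ κ in atTop, |f κ| ≤ |g κ|) :
    Negligible f := by
  intro q hq
  filter_upwards [hg q hq, h] with κ h1 h2 using h2.trans_lt h1

theorem Negligible.add {f g : ℕ → ℝ} (hf : Negligible f) (hg : Negligible g) :
    Negligible fun κ => f κ + g κ := by
  intro q hq
  have h2 : ∀ k : ℕ, 0 < (Polynomial.C 2 * q).eval k := fun k => by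
    simpa using hq k
  filter_upwards [hf _ h2, hg _ h2] with κ h3 h4
  have hpos : (0 : ℝ) < (q.eval κ : ℕ) := by exact_mod_cast hq κ
  simp only [Polynomial.eval_mul, Polynomial.eval_C, Nat.cast_mul, Nat.cast_ofNat] at h3 h4
  have : 1 / ((q.eval κ : ℕ) : ℝ) = 1 / (2 * (q.eval κ : ℕ)) + 1 / (2 * (q.eval κ : ℕ)) := by
    field_simp; norm_num
  rw [this]
  exact (abs_add_le _ _).trans_lt (add_lt_add h3 h4)

theorem Negligible.neg {f : ℕ → ℝ} (hf : Negligible f) : Negligible fun κ => -f κ := by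
  simpa only [Negligible, abs_neg] using hf

theorem negligible_zero : Negligible fun _ => 0 := by
  intro q hq
  refine .of_forall fun κ => ?_
  have : (0 : ℝ) < (q.eval κ : ℕ) := by exact_mod_cast hq κ
  simpa using this

theorem Negligible.const_mul {f : ℕ → ℝ} (hf : Negligible f) (c : ℝ) :
    Negligible fun κ => c * f κ := by
  obtain ⟨n, hn⟩ := exists_nat_ge |c|
  have h : Negligible fun κ => n * f κ := by
    clear hn
    induction n with
    | zero => simpa using negligible_zero
    | succ n ih => simpa only [Nat.cast_succ, add_mul, one_mul] using ih.add hf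
  refine h.mono (.of_forall fun κ => ?_)
  rw [abs_mul, abs_mul, Nat.abs_cast]
  gcongr

theorem negligible_two_pow : Negligible fun κ => 1 / 2 ^ κ := by
  intro q hq
  have h := (q.map (Nat.castRingHom ℝ)).tendsto_div_exp_atTop
  have h2 : Tendsto (fun κ : ℕ => ((q.eval κ : ℕ) : ℝ) / 2 ^ κ) atTop (𝓝 0) := by
    simp only [Polynomial.eval_eq_sum_range, Nat.cast_sum, Finset.sum_div]
    rw [show (0 : ℝ) = ∑ i ∈ Finset.range (q.natDegree + 1), 0 by simp]
    refine tendsto_finsetSum _ fun i _ => ?_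
    have := (tendsto_pow_const_div_const_pow_of_one_lt i (r := (2 : ℝ)) (by norm_num)).const_mul
      (q.coeff i : ℝ)
    simpa [mul_div_assoc] using this
  filter_upwards [h2.eventually (gt_mem_nhds one_pos)] with κ hκ
  have hpos : (0 : ℝ) < (q.eval κ : ℕ) := by exact_mod_cast hq κ
  rw [abs_of_pos (by positivity), div_lt_div_iff₀ (by positivity) hpos]
  rw [div_lt_one (by positivity)] at hκ
  linarith

/-! ## Indistinguishability -/

section Indist
variable {α β : Type} [ToData α] [ToData β]

/-- Indistinguishability of random elements of represented types. -/
def Indist (X Y : ℕ → PMF α) : Prop :=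
  CompIndist (fun κ => (X κ).map toData) fun κ => (Y κ).map toData

variable {X Y Z : ℕ → PMF α}

theorem Indist.refl (X : ℕ → PMF α) : Indist X X := fun D _ => by
  simpa using negligible_zero

theorem Indist.trans (h : Indist X Y) (h' : Indist Y Z) : Indist X Z := fun D hD => by
  simpa using (h D hD).add (h' D hD)

theorem Indist.symm (h : Indist X Y) : Indist Y X := fun D hD => by
  simpa using (h D hD).neg

/-- The distinguisher is part of the processing, and the remaining test is the indicator of the
answer `1`. -/
theorem Indist.of_statClose {δ : ℕ → ℝ} (hδ : Negligible δ)
    (h : ∀ᶠ κ in atTop, StatClose (ENNReal.ofReal (δ κ)) (X κ) (Y κ)) : Indist X Y := by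
  intro D _
  have hle : ∀ U V : PMF Data, ∀ ε : ℝ, StatClose (ENNReal.ofReal ε) U V →
      (U (Data.num 1)).toReal ≤ (V (Data.num 1)).toReal + |ε| := by
    intro U V ε hUV
    have h1 := hUV (fun a => open Classical in if a = Data.num 1 then 1 else 0)
      (fun a => by split_ifs <;> simp)
    simp only [mul_ite, mul_one, mul_zero, tsum_ite_eq] at h1
    have h2 : U (Data.num 1) ≤ V (Data.num 1) + ENNReal.ofReal |ε| :=
      h1.trans (by gcongr; exact le_abs_self ε)
    have := ENNReal.toReal_mono (by simp [PMF.apply_ne_top]) h2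
    rwa [ENNReal.toReal_add (PMF.apply_ne_top _ _) (by simp),
      ENNReal.toReal_ofReal (abs_nonneg _)] at this
  refine hδ.mono ?_
  filter_upwards [h] with κ hκ
  have h1 := (hκ.map toData).bind fun d => D.eval (Data.pair (Data.security κ) d)
  have h2 := hle _ _ _ h1
  have h3 := hle _ _ _ h1.symm
  rw [abs_le]
  unfold acceptProb
  constructor <;> linarith

/-- Efficient processing preserves indistinguishability. -/
theorem Indist.bind {G : ℕ → α → PMF β} (hG : PPT fun z : Sec × α => G z.1.k z.2)
    (h : Indist X Y) : Indist (fun κ => (X κ).bind (G κ)) fun κ => (Y κ).bind (G κ) := by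
  intro D hD
  obtain ⟨A, hA, hA'⟩ := hG
  -- The reduction processes its sample by the program of `G` and hands the result to `D`, together
  -- with the security parameter.
  have h1 := h (Prog.comp D (Prog.pair Prog.fst A))
    (hD.comp (Prog.polyTime_fst.pair hA))
  have key : ∀ W : ℕ → PMF α, acceptProb (Prog.comp D (Prog.pair Prog.fst A))
      (fun κ => (W κ).map toData) = acceptProb D fun κ => ((W κ).bind (G κ)).map toData := by
    intro W
    funext κ
    unfold acceptProb
    congr 2
    rw [PMF.bind_map, PMF.bind_map, PMF.bind_bind]
    congr 1
    funext a
    have h2 : A.eval (Data.pair (Data.security κ) (toData a)) = _ := hA' (⟨κ⟩, a)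
    simp only [Function.comp_apply]
    rw [Prog.eval_comp, Prog.eval_pair, Prog.eval_fst, PMF.pure_bind, h2, PMF.bind_map]
    exact PMF.bind_map (G κ a) _ _
  rwa [key, key] at h1

theorem Indist.map {g : ℕ → α → β} (hg : Poly fun z : Sec × α => g z.1.k z.2)
    (h : Indist X Y) : Indist (fun κ => (X κ).map (g κ)) fun κ => (Y κ).map (g κ) :=
  h.bind (G := fun κ a => PMF.pure (g κ a)) hg

end Indist

end
end PrivateKalman

namespace PrivateKalman
noncomputable section

/-! ## Homomorphic evaluation and decryption -/

/-- The factor of a ciphertext that carries the plaintext. -/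
def genPow (N : ℕ) (z : ℤ) : ZMod (N ^ 2) := (1 + (N : ZMod (N ^ 2))) ^ (z : ZMod N).val

/-- The binomial expansion stops after the linear term, since the square of `N` vanishes in this
ring. -/
theorem one_add_pow_eq (N k : ℕ) : (1 + (N : ZMod (N ^ 2))) ^ k = 1 + k * N := by
  have h : (N : ZMod (N ^ 2)) * N = 0 := by
    rw [← sq, ← Nat.cast_pow, ZMod.natCast_self]
  induction k with
  | zero => simp
  | succ k ih =>
    rw [pow_succ (1 + (N : ZMod (N ^ 2))), ih]
    push_cast
    linear_combination (k : ZMod (N ^ 2)) * h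

theorem genPow_zero (N : ℕ) : genPow N 0 = 1 := by simp [genPow]

theorem encrypt_eq (N : ℕ) (a : ℤ) (r : ℕ) : encrypt N a r = genPow N a * encrypt N 0 r := by
  simp [encrypt, genPow]

section Homomorphic
variable {N : ℕ} [NeZero N]

/-- The exponent enters as `a * N` modulo `N ^ 2`, thus only modulo `N`. This allows computing with
integers where encryption uses residues. -/
theorem one_add_pow_eq_genPow {a : ℕ} {z : ℤ} (h : (a : ZMod N) = z) :
    (1 + (N : ZMod (N ^ 2))) ^ a = genPow N z := by
  have h2 : a ≡ (z : ZMod N).val [MOD N] := by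
    rw [← ZMod.natCast_eq_natCast_iff, h, ZMod.natCast_zmod_val]
  have h3 := (ZMod.natCast_eq_natCast_iff _ _ (N * N)).2 (h2.mul_right' N)
  rw [← sq] at h3
  rw [genPow, one_add_pow_eq, one_add_pow_eq]
  push_cast at h3
  rw [h3]

theorem genPow_add (z w : ℤ) : genPow N (z + w) = genPow N z * genPow N w := by
  rw [← one_add_pow_eq_genPow (a := (z : ZMod N).val + (w : ZMod N).val) (by simp), pow_add]
  rfl

theorem genPow_sum {ι : Type} (s : Finset ι) (f : ι → ℤ) :
    genPow N (∑ i ∈ s, f i) = ∏ i ∈ s, genPow N (f i) := by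
  classical
  induction s using Finset.induction_on with
  | empty => simp [genPow_zero]
  | insert a s ha ih => rw [Finset.sum_insert ha, Finset.prod_insert ha, genPow_add, ih]

theorem encScale_genPow_mul (k z : ℤ) (c : ZMod (N ^ 2)) :
    encScale k (genPow N z * c) = genPow N (k * z) * encScale k c := by
  rw [encScale, encScale, mul_pow, genPow, ← pow_mul, one_add_pow_eq_genPow (z := k * z)]
  simp [mul_comm]

theorem encAdd_genPow_mul (z w : ℤ) (c d : ZMod (N ^ 2)) :
    encAdd (genPow N z * c) (genPow N w * d) = genPow N (z + w) * encAdd c d := by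
  rw [encAdd, encAdd, genPow_add]
  ring

theorem encSub_genPow_mul (z w : ℤ) (c d : ZMod (N ^ 2)) :
    encSub (genPow N z * c) (genPow N w * d) = genPow N (z - w) * encSub c d := by
  rw [encSub, encSub, encScale_genPow_mul, encAdd_genPow_mul]
  congr 2
  ring

theorem encMulVec_genPow_mul {ι ι' : Type} [Fintype ι'] (A : Matrix ι ι' ℤ) (z : ι' → ℤ)
    (c : ι' → ZMod (N ^ 2)) : encMulVec A (fun j => genPow N (z j) * c j) =
      fun i => genPow N (A.mulVec z i) * encMulVec A c i := by
  funext i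
  simp only [encMulVec, encScale_genPow_mul, Finset.prod_mul_distrib, Matrix.mulVec, dotProduct,
    genPow_sum]

/-- The aggregator computes the estimates under the encryption. -/
theorem encEstimate_genPow_mul {n p m K : ℕ} (θ : Plant n p m) (β e : ℕ) (u : Inputs n p m K)
    (cx : Fin n → ZMod (N ^ 2)) (cy : Fin K → Fin m → Fin p → ZMod (N ^ 2)) :
    ∀ t ≤ K, encEstimate θ β e (fun a => genPow N (u.x a) * cx a)
        (fun t i j => genPow N (u.y t i j) * cy t i j) t =
      fun a => genPow N (fixedEstimate θ β e u t a) * encEstimate θ β e cx cy t a := by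
  intro t
  induction t with
  | zero => intro _; rfl
  | succ t ih =>
    intro ht
    -- The default value `0` of `extend` is no encryption of zero in general; it does not occur
    -- because `t < K`.
    have h1 : ∀ c : Fin K → Fin m → Fin p → ZMod (N ^ 2),
        extend (fun s => stack (c s)) t = stack (c ⟨t, ht⟩) := fun c => dif_pos ht
    have h2 : extend (fun s => stack (u.y s)) t = stack (u.y ⟨t, ht⟩) := dif_pos ht
    simp only [encEstimate, fixedEstimate, h1, h2, ih (by omega), encMulVec_genPow_mul]
    have h3 : ∀ ji, stack (fun i j => genPow N (u.y ⟨t, ht⟩ i j) * cy ⟨t, ht⟩ i j) ji =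
        genPow N (stack (u.y ⟨t, ht⟩) ji) * stack (cy ⟨t, ht⟩) ji := fun _ => rfl
    simp only [h3, encScale_genPow_mul, encSub_genPow_mul, encMulVec_genPow_mul,
      encAdd_genPow_mul]
    rfl

end Homomorphic

theorem encScale_pow_eq_one {N l : ℕ} (k : ℤ) {c : ZMod (N ^ 2)} (hc : c ^ l = 1) :
    encScale k c ^ l = 1 := by
  rw [encScale, pow_right_comm, hc, one_pow]

theorem encMulVec_pow_eq_one {N l : ℕ} {ι ι' : Type} [Fintype ι'] (A : Matrix ι ι' ℤ)
    {c : ι' → ZMod (N ^ 2)} (hc : ∀ j, c j ^ l = 1) (i : ι) : encMulVec A c i ^ l = 1 := by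
  rw [encMulVec, ← Finset.prod_pow]
  exact Finset.prod_eq_one fun j _ => encScale_pow_eq_one _ (hc j)

/-- The aggregator only multiplies and takes powers, and elements killed by `l` are closed under
both. Applied to encryptions of zero, this removes the randomness in decryption. -/
theorem encEstimate_pow_eq_one {n p m K N l : ℕ} (θ : Plant n p m) (β e : ℕ)
    {cx : Fin n → ZMod (N ^ 2)} {cy : Fin K → Fin m → Fin p → ZMod (N ^ 2)}
    (hx : ∀ a, cx a ^ l = 1) (hy : ∀ t i j, cy t i j ^ l = 1) :
    ∀ t ≤ K, ∀ a, encEstimate θ β e cx cy t a ^ l = 1 := by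
  intro t
  induction t with
  | zero => intro _ a; exact hx a
  | succ t ih =>
    intro ht a
    have h1 : extend (fun s => stack (cy s)) t = stack (cy ⟨t, ht⟩) := dif_pos ht
    have h2 := encMulVec_pow_eq_one (encodeMat β e θ.F) (ih (by omega))
    have h3 := encMulVec_pow_eq_one (encodeMat β e θ.stackH) h2
    simp only [encEstimate, h1, encAdd, mul_pow]
    rw [encScale_pow_eq_one _ (h2 a), encMulVec_pow_eq_one, mul_one]
    intro ji
    rw [encSub, encAdd, mul_pow, encScale_pow_eq_one _ (h3 ji), encScale_pow_eq_one, mul_one]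
    exact hy _ _ _

/-- The power is represented by `1 + (k % N) * N`, which is below `N ^ 2`, so the division by `N` is
exact. -/
theorem natCast_paillierL {N : ℕ} (hN : 1 < N) (k : ℕ) :
    ((paillierL N ((1 + (N : ZMod (N ^ 2))) ^ k) : ℕ) : ZMod N) = k := by
  have h0 : (1 + (N : ZMod (N ^ 2))) ^ k = ((1 + k % N * N : ℕ) : ZMod (N ^ 2)) := by
    rw [one_add_pow_eq]
    have h2 : k ≡ k % N [MOD N] := (Nat.mod_modEq k N).symm
    have h3 := (ZMod.natCast_eq_natCast_iff _ _ (N * N)).2 (h2.mul_right' N)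
    rw [← sq] at h3
    push_cast at h3 ⊢
    rw [h3]
  have hlt : 1 + k % N * N < N ^ 2 := by
    have := Nat.mod_lt k (by omega : 0 < N)
    have h4 : (k % N + 1) * N ≤ N * N := Nat.mul_le_mul_right N this
    rw [sq]
    nlinarith
  rw [paillierL, h0, ZMod.val_natCast_of_lt hlt, Nat.add_sub_cancel_left,
    Nat.mul_div_cancel _ (by omega), ZMod.natCast_mod]

/-! ### Correctness of Paillier decryption. -/

section Decryption
variable {κ P Q : ℕ}

theorem ValidPrimes.one_lt_mul (h : ValidPrimes κ P Q) : 1 < P * Q :=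
  Nat.one_lt_mul_iff.2 ⟨h.1.pos, h.2.1.pos, Or.inl h.1.one_lt⟩

/-- Primes of equal length satisfy `Q < 2 * P`, so the quotient could only be `0` or `1`. The latter
means `Q = P + 1`, impossible for odd primes; `3 ≤ κ` excludes the prime `2`. -/
theorem ValidPrimes.not_dvd_pred (h : ValidPrimes κ P Q) (hκ : 3 ≤ κ) : ¬ P ∣ Q - 1 := by
  obtain ⟨hP, hQ, hne, hPs, hQs⟩ := h
  have hP4 : 2 ^ (κ - 1) ≤ P := by rw [← Nat.lt_size]; omega
  have hQ4 : 2 ^ (κ - 1) ≤ Q := by rw [← Nat.lt_size]; omega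
  have hQlt : Q < 2 ^ κ := by rw [← Nat.size_le]; omega
  have h4 : 2 ^ 2 ≤ 2 ^ (κ - 1) := Nat.pow_le_pow_right (by norm_num) (by omega)
  have h2 : 2 ^ κ = 2 * 2 ^ (κ - 1) := by rw [← pow_succ', Nat.sub_add_cancel (by omega)]
  rintro ⟨k, hk⟩
  have hk2 : k < 2 := by
    by_contra hc
    have : P * 2 ≤ P * k := Nat.mul_le_mul_left P (by omega)
    omega
  have hPo := hP.eq_two_or_odd
  have hQo := hQ.eq_two_or_odd
  interval_cases k <;> omega

theorem ValidPrimes.symm (h : ValidPrimes κ P Q) : ValidPrimes κ Q P :=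
  ⟨h.2.1, h.1, h.2.2.1.symm, h.2.2.2.2, h.2.2.2.1⟩

/-- Makes the decryption exponent invertible modulo `N`, so that decryption can divide by it. -/
theorem ValidPrimes.coprime_lcm (h : ValidPrimes κ P Q) (hκ : 3 ≤ κ) :
    Nat.Coprime (Nat.lcm (P - 1) (Q - 1)) (P * Q) := by
  have key : ∀ {P Q : ℕ}, ValidPrimes κ P Q → Nat.Coprime (Nat.lcm (P - 1) (Q - 1)) P := by
    intro P Q h
    refine ((Nat.Prime.coprime_iff_not_dvd h.1).2 fun hd => ?_).symm
    have h2 := hd.trans (Nat.lcm_dvd_mul (P - 1) (Q - 1))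
    rcases h.1.dvd_mul.1 h2 with h3 | h3
    · have := Nat.le_of_dvd (by have := h.1.two_le; omega) h3
      have := h.1.pos
      omega
    · exact h.not_dvd_pred hκ h3
  refine Nat.Coprime.mul_right (key h) ?_
  rw [Nat.lcm_comm]
  exact key h.symm

/-- By Fermat for both primes `r ^ l` is one modulo `N`, and raising a congruence modulo `N` to the
power `N` lifts it to `N ^ 2`. No primality of `N` is needed for the lift. -/
theorem ValidPrimes.pow_eq_one (h : ValidPrimes κ P Q) {r : ℕ} (hr : Nat.Coprime r (P * Q)) :
    ((r : ZMod ((P * Q) ^ 2)) ^ (P * Q)) ^ Nat.lcm (P - 1) (Q - 1) = 1 := by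
  obtain ⟨hP, hQ, hne, -, -⟩ := h
  set l := Nat.lcm (P - 1) (Q - 1)
  have key : ∀ {P : ℕ}, P.Prime → Nat.Coprime r P → P - 1 ∣ l → r ^ l ≡ 1 [MOD P] := by
    rintro P hP hrP ⟨k, hk⟩
    have := (Nat.ModEq.pow_totient hrP).pow k
    rwa [Nat.totient_prime hP, ← pow_mul, one_pow, ← hk] at this
  have h1 : r ^ l ≡ 1 [MOD P * Q] :=
    (Nat.modEq_and_modEq_iff_modEq_mul ((Nat.coprime_primes hP hQ).2 hne)).1
      ⟨key hP (hr.coprime_dvd_right (dvd_mul_right _ _)) (Nat.dvd_lcm_left _ _),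
        key hQ (hr.coprime_dvd_right (dvd_mul_left _ _)) (Nat.dvd_lcm_right _ _)⟩
  have h2 : ((P * Q : ℕ) : ℤ) ∣ (r : ℤ) ^ l - 1 := by
    have := (Nat.modEq_iff_dvd.1 h1.symm)
    push_cast at this ⊢
    exact this
  have h3 := dvd_sub_pow_of_dvd_sub (R := ℤ) (p := P * Q) h2 1
  rw [pow_one, one_pow] at h3
  have h4 := (ZMod.intCast_zmod_eq_zero_iff_dvd _ ((P * Q) ^ 2)).2 (by exact_mod_cast h3)
  push_cast at h4
  rw [sub_eq_zero] at h4
  rw [pow_right_comm]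
  exact h4

/-- Decryption of a ciphertext with a given plaintext. -/
theorem decrypt_genPow_mul {k : Keys} (h : ValidPrimes κ k.P k.Q) (hκ : 3 ≤ κ) (z : ℤ)
    {ρ : ZMod (k.N ^ 2)} (hρ : ρ ^ Nat.lcm (k.P - 1) (k.Q - 1) = 1) :
    decrypt k (genPow k.N z * ρ) = (z : ZMod k.N).valMinAbs := by
  have hN : 1 < k.N := h.one_lt_mul
  have : NeZero k.N := ⟨by omega⟩
  have hu : IsUnit ((Nat.lcm (k.P - 1) (k.Q - 1) : ℕ) : ZMod k.N) :=
    (ZMod.isUnit_iff_coprime _ _).2 (h.coprime_lcm hκ)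
  simp only [decrypt]
  rw [mul_pow, hρ, mul_one, genPow, ← pow_mul, natCast_paillierL hN, natCast_paillierL hN]
  congr 1
  rw [Nat.cast_mul, mul_assoc, ZMod.mul_inv_of_unit _ hu, mul_one, ZMod.natCast_zmod_val]

end Decryption

/-! ## The protocol computes the estimates -/

/-- All private data zero. -/
def Inputs.zero (n p m K : ℕ) : Inputs n p m K := ⟨0, 0⟩

namespace Protocol
variable {n p m K : ℕ} (π : Protocol n p m K)

/-- Given the keys and the coins, the inputs enter the message to the query node only through the
estimate. Both decryption and the simulation for the query node rest on this. -/
theorem cipherEst_eq (E : Execution n p m K) (hN : E.keys.N ≠ 0) (u : Inputs n p m K) {t : ℕ}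
    (ht : t ≤ K) (a : Fin n) : π.cipherEst E u t a =
      genPow E.keys.N (fixedEstimate π.plant π.base π.prec u t a) *
        π.cipherEst E (Inputs.zero n p m K) t a := by
  have : NeZero E.keys.N := ⟨hN⟩
  have h := congrFun (encEstimate_genPow_mul π.plant π.base π.prec u
    (cipherX E (Inputs.zero n p m K)) (cipherY E (Inputs.zero n p m K)) t ht) a
  refine Eq.trans ?_ h
  have hx : cipherX E u = fun a => genPow E.keys.N (u.x a) * cipherX E (Inputs.zero n p m K) a :=
    funext fun a => encrypt_eq _ _ _
  have hy : cipherY E u = fun t i j =>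
      genPow E.keys.N (u.y t i j) * cipherY E (Inputs.zero n p m K) t i j :=
    funext fun t => funext fun i => funext fun j => encrypt_eq _ _ _
  rw [cipherEst, hx, hy]

/-- There is no assumption on the size of the data: efficiently generated data may grow with `κ`
beyond `N`, and the simulator reproduces exactly this residue. -/
theorem decrypted_eq {κ : ℕ} (hκ : 3 ≤ κ) {E : Execution n p m K}
    (hE : ValidPrimes κ E.keys.P E.keys.Q) (hx : ∀ a, Nat.Coprime (E.rx a) E.keys.N)
    (hy : ∀ s, Nat.Coprime (E.ry s) E.keys.N) (u : Inputs n p m K) (t : Fin K) (a : Fin n) :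
    π.decrypted E u t a = ((π.target u t a : ℤ) : ZMod E.keys.N).valMinAbs := by
  have hN : E.keys.N ≠ 0 := (zero_lt_one.trans hE.one_lt_mul).ne'
  rw [decrypted, π.cipherEst_eq E hN u (by omega), decrypt_genPow_mul hE hκ]
  · rfl
  · have key : ∀ r, Nat.Coprime r E.keys.N →
        encrypt E.keys.N 0 r ^ Nat.lcm (E.keys.P - 1) (E.keys.Q - 1) = 1 := by
      intro r hr
      simp only [encrypt, Int.cast_zero, ZMod.val_zero, pow_zero, one_mul]
      exact hE.pow_eq_one hr
    exact encEstimate_pow_eq_one _ _ _ (fun a => key _ (hx a)) (fun t i j => key _ (hy _)) _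
      (by omega) a

theorem mem_support_execution {κ : ℕ} {E : Execution n p m K} (h : E ∈ (π.execution κ).support)
    (hN : E.keys.N ≠ 0) : (∀ a, Nat.Coprime (E.rx a) E.keys.N) ∧
      ∀ s, Nat.Coprime (E.ry s) E.keys.N := by
  simp only [execution, PMF.mem_support_bind_iff, PMF.mem_support_map_iff] at h
  obtain ⟨k, -, rx, hx, ry, hy, rfl⟩ := h
  exact ⟨mem_of_mem_support_uniformUnits hN hx, mem_of_mem_support_uniformUnits hN hy⟩

theorem map_keys_execution (κ : ℕ) : (π.execution κ).map Execution.keys = π.keygen.keys κ := by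
  simp only [execution, PMF.map_bind, PMF.map_comp]
  conv_rhs => rw [← PMF.bind_pure (π.keygen.keys κ)]
  congr 1
  funext k
  have : ∀ rx, (uniformUnits (Fin K × Fin m × Fin p) k.N).map (Execution.keys ∘
      fun ry => (⟨k, rx, ry⟩ : Execution n p m K)) = PMF.pure k := fun rx => PMF.map_const _ k
  simp only [this, PMF.bind_const]

end Protocol

/-- The key generator errs with this probability. -/
def KeyGenerator.failure (G : KeyGenerator) (κ : ℕ) : ENNReal :=
  (G.keys κ).toOuterMeasure {k | ¬ ValidPrimes κ k.P k.Q}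

theorem KeyGenerator.failure_ne_top (G : KeyGenerator) (κ : ℕ) : G.failure κ ≠ ⊤ := by
  rw [failure, PMF.toOuterMeasure_apply]
  exact PMF.tsum_coe_indicator_ne_top _ _

theorem KeyGenerator.negligible_failure (G : KeyGenerator) :
    Negligible fun κ => (G.failure κ).toReal := by
  convert G.valid using 3 with κ
  rw [failure, keys, PMF.toOuterMeasure_bind_apply, PMF.toOuterMeasure_bind_apply]
  refine tsum_congr fun w => ?_
  rw [PMF.toOuterMeasure_map_apply]
  rfl

namespace Protocol
variable {n p m K : ℕ} (π : Protocol n p m K)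

theorem toOuterMeasure_execution (κ : ℕ) : (π.execution κ).toOuterMeasure
    {E | ¬ ValidPrimes κ E.keys.P E.keys.Q} = π.keygen.failure κ := by
  rw [KeyGenerator.failure, ← π.map_keys_execution, PMF.toOuterMeasure_map_apply]
  rfl

/-- For fixed data the estimates have a bound `B` that does not depend on `κ`. As soon as `N`
exceeds `2 * B`, only invalid keys cause errors. -/
theorem negligible_decrypted_ne (u : Inputs n p m K) : Negligible fun κ =>
    ((π.execution κ).toOuterMeasure {E | π.decrypted E u ≠ π.target u}).toReal := by
  refine π.keygen.negligible_failure.mono ?_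
  obtain ⟨B, hB⟩ : ∃ B : ℕ, ∀ t a, (π.target u t a).natAbs < B :=
    ⟨∑ t, ∑ a, (π.target u t a).natAbs + 1, fun t a => Nat.lt_succ_of_le
      ((Finset.single_le_sum (f := fun a => (π.target u t a).natAbs) (fun _ _ => Nat.zero_le _)
        (Finset.mem_univ a)).trans
      (Finset.single_le_sum (f := fun t => ∑ a, (π.target u t a).natAbs)
        (fun _ _ => Nat.zero_le _) (Finset.mem_univ t)))⟩
  filter_upwards [eventually_ge_atTop 3, eventually_ge_atTop (B + 1)] with κ h3 hκ
  rw [abs_of_nonneg ENNReal.toReal_nonneg, abs_of_nonneg ENNReal.toReal_nonneg]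
  refine ENNReal.toReal_mono (π.keygen.failure_ne_top κ) ?_
  rw [← π.toOuterMeasure_execution]
  refine PMF.toOuterMeasure_mono _ fun E hE hv => ?_
  obtain ⟨hne, hs⟩ := hE
  have hN : E.keys.N ≠ 0 := (zero_lt_one.trans hv.one_lt_mul).ne'
  obtain ⟨hx, hy⟩ := π.mem_support_execution hs hN
  refine hne (funext fun t => funext fun a => ?_)
  rw [π.decrypted_eq h3 hv hx hy]
  have : NeZero E.keys.N := ⟨hN⟩
  rw [ZMod.valMinAbs_spec]
  refine ⟨rfl, ?_⟩
  have h1 := hB t a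
  have h2 : B < 2 ^ (κ - 1) := Nat.lt_two_pow_self.trans_le
    (Nat.pow_le_pow_right (by norm_num) (by omega))
  have h4 : 2 ^ (κ - 1) ≤ E.keys.P := by rw [← Nat.lt_size]; have := hv.2.2.2.1; omega
  have h5 : 2 * E.keys.P ≤ E.keys.N := by
    rw [Keys.N, mul_comm]; exact Nat.mul_le_mul_left _ hv.2.1.two_le
  constructor <;> omega

end Protocol

/-! ### Convergence of the filter on encoded numbers. -/

theorem tendsto_encode {β : ℕ} (hβ : 2 ≤ β) (r : ℝ) :
    Tendsto (fun e : ℕ => (encode β e r : ℝ) / (β : ℝ) ^ e) atTop (𝓝 r) := by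
  have hβ1 : (1 : ℝ) < β := by exact_mod_cast (by omega : 1 < β)
  have h0 : Tendsto (fun e : ℕ => (1 / 2 : ℝ) * ((β : ℝ)⁻¹) ^ e) atTop (𝓝 0) := by
    simpa using (tendsto_pow_atTop_nhds_zero_of_lt_one (r := (β : ℝ)⁻¹) (by positivity)
      (inv_lt_one_of_one_lt₀ hβ1)).const_mul (1 / 2 : ℝ)
  rw [tendsto_iff_dist_tendsto_zero]
  refine squeeze_zero (fun _ => dist_nonneg) (fun e => ?_) h0
  have hpos : (0 : ℝ) < (β : ℝ) ^ e := by positivity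
  -- Rounding errs by at most `1 / 2`, which decoding divides by `β ^ e`.
  rw [Real.dist_eq, encode, div_sub' hpos.ne', abs_div, abs_of_pos hpos, div_le_iff₀ hpos,
    inv_pow, mul_assoc, inv_mul_cancel₀ hpos.ne', mul_one, abs_sub_comm, mul_comm]
  exact abs_sub_round _

/-- The recursion for the scaled estimates on encoded numbers. -/
theorem fixedEstimate_succ_div {n p m K : ℕ} (θ : Plant n p m) {β : ℕ} (hβ : 2 ≤ β) (e : ℕ)
    (u : Inputs n p m K) (t : ℕ) (a : Fin n) :
    (fixedEstimate θ β e u (t + 1) a : ℝ) / ((β : ℝ) ^ e) ^ (3 * (t + 1) + 1) =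
      ∑ b, (encode β e (θ.F a b) : ℝ) / (β : ℝ) ^ e *
        ((fixedEstimate θ β e u t b : ℝ) / ((β : ℝ) ^ e) ^ (3 * t + 1)) +
      ∑ ji, (encode β e (θ.gain t a ji) : ℝ) / (β : ℝ) ^ e *
        ((extend (fun s => stack (u.y s)) t ji : ℤ) / (β : ℝ) ^ e -
          ∑ c, (encode β e (θ.stackH ji c) : ℝ) / (β : ℝ) ^ e *
            ∑ b, (encode β e (θ.F c b) : ℝ) / (β : ℝ) ^ e *
              ((fixedEstimate θ β e u t b : ℝ) / ((β : ℝ) ^ e) ^ (3 * t + 1))) := by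
  have hB : (β : ℝ) ^ e ≠ 0 := by
    have : 0 < β := by omega
    positivity
  set B := (β : ℝ) ^ e with hBdef
  -- Every encoded matrix contributes one factor `B`: the exponents are `3 * t + 2` after `F`, `3 *
  -- t + 3` after `H`, and `3 * t + 4` after the gain.
  have e1 : ∀ c, ∑ b, (encode β e (θ.F c b) : ℝ) / B *
      ((fixedEstimate θ β e u t b : ℝ) / B ^ (3 * t + 1)) =
      (∑ b, (encode β e (θ.F c b) : ℝ) * fixedEstimate θ β e u t b) / B ^ (3 * t + 2) := by
    intro c
    rw [Finset.sum_div]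
    refine Finset.sum_congr rfl fun b _ => ?_
    rw [div_mul_div_comm, ← pow_succ']
  simp only [e1]
  have e2 : ∀ ji, ∑ c, (encode β e (θ.stackH ji c) : ℝ) / B *
      ((∑ b, (encode β e (θ.F c b) : ℝ) * fixedEstimate θ β e u t b) / B ^ (3 * t + 2)) =
      (∑ c, (encode β e (θ.stackH ji c) : ℝ) *
        ∑ b, (encode β e (θ.F c b) : ℝ) * fixedEstimate θ β e u t b) / B ^ (3 * t + 3) := by
    intro ji
    rw [Finset.sum_div]
    refine Finset.sum_congr rfl fun b _ => ?_
    rw [div_mul_div_comm, ← pow_succ']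
  simp only [e2]
  have e3 : ∀ x y : ℝ, x / B - y / B ^ (3 * t + 3) = (B ^ (3 * t + 2) * x - y) / B ^ (3 * t + 3) := by
    intro x y
    rw [pow_succ B (3 * t + 2)]
    field_simp
  simp only [e3, div_mul_div_comm, ← pow_succ', ← Finset.sum_div]
  have e4 : ∀ x y : ℝ, x / B ^ (3 * t + 2) + y / B ^ (3 * t + 3 + 1) =
      (B ^ 2 * x + y) / B ^ (3 * (t + 1) + 1) := by
    intro x y
    rw [show 3 * t + 3 + 1 = (3 * t + 2) + 2 by ring, show 3 * (t + 1) + 1 = (3 * t + 2) + 2 by ring,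
      pow_add B (3 * t + 2) 2]
    field_simp
  rw [e4]
  congr 1
  simp only [fixedEstimate, Pi.add_apply, Pi.smul_apply, Pi.sub_apply, Matrix.mulVec, dotProduct,
    encodeMat, Matrix.map_apply, smul_eq_mul]
  push_cast
  rfl

theorem Protocol.computesEstimates {n p m K : ℕ} (π : Protocol n p m K) :
    π.ComputesEstimates := by
  refine ⟨π.negligible_decrypted_ne, fun x y k _ => ?_⟩
  induction k with
  | zero =>
    intro a
    simpa [fixedEstimate, Plant.estimate] using tendsto_encode π.two_le_base (x a)
  | succ k ih =>
    intro a
    have ih := ih (by omega)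
    simp only [fixedEstimate_succ_div π.plant π.two_le_base]
    have hF : ∀ c, Tendsto (fun e : ℕ => ∑ b, (encode π.base e (π.plant.F c b) : ℝ) /
        (π.base : ℝ) ^ e * ((fixedEstimate π.plant π.base e
          (⟨fun b => encode π.base e (x b), fun t i j => encode π.base e (y t i j)⟩ :
            Inputs n p m K) k b : ℝ) / ((π.base : ℝ) ^ e) ^ (3 * k + 1))) atTop
        (𝓝 (π.plant.F.mulVec (π.plant.estimate x (extend fun t => stack (y t)) k) c)) :=
      fun c => tendsto_finsetSum _ fun b _ => (tendsto_encode π.two_le_base _).mul (ih b)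
    refine (hF a).add (tendsto_finsetSum _ fun ji _ =>
      (tendsto_encode π.two_le_base _).mul (Tendsto.sub ?_ (tendsto_finsetSum _ fun c _ =>
        (tendsto_encode π.two_le_base _).mul (hF c))))
    by_cases hk : k < K
    · simp only [extend, dif_pos hk]
      exact tendsto_encode π.two_le_base _
    · simp [extend, dif_neg hk]

end
end PrivateKalman

namespace PrivateKalman
noncomputable section

/-! ## What the outputs leave open -/

theorem sum_restrict {p m : ℕ} {R : Type} [AddCommMonoid R] (s : Finset (Fin m))
    (f : Fin p × Fin m → R) : ∑ ji, f ji =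
      (∑ i : s, ∑ j : Fin p, f (j, i)) + ∑ ji : Fin p × {i // i ∉ s}, f (ji.1, ji.2) := by
  rw [Fintype.sum_prod_type, Fintype.sum_prod_type, Finset.sum_comm, Finset.sum_comm (γ := Fin p)]
  convert (Fintype.sum_subtype_add_sum_subtype (fun i => i ∈ s) fun i => ∑ j, f (j, i)).symm using 2
  congr!

theorem card_rest {p m : ℕ} (s : Finset (Fin m)) :
    Fintype.card (Fin p × {i // i ∉ s}) = p * sᶜ.card := by
  rw [Fintype.card_prod, Fintype.card_fin, Fintype.card_subtype]
  congr 2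
  ext i
  simp

namespace Plant
variable {n p m : ℕ} (θ : Plant n p m)

/-- The actual measurements solve the system by the filter recursion. With more unknowns than
equations the gain block has a nonzero kernel vector, which gives a line of solutions. -/
theorem underdetermined (K : ℕ) {s : Finset (Fin m)} (hs : n < p * sᶜ.card) :
    θ.Underdetermined K s := by
  intro x y t est z
  have hsol : (θ.restGain s t).mulVec (fun ji => y t ji.2 ji.1) = z := by
    funext a
    have h1 : extend (fun r => stack (y r)) (t : ℕ) = stack (y t) := by
      simp [extend]
    have h2 : est (t + 1) = θ.F.mulVec (est t) + (θ.gain t).mulVec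
        (stack (y t) - θ.stackH.mulVec (θ.F.mulVec (est t))) := by
      rw [← h1]
      rfl
    have h3 := sum_restrict s fun ji => θ.gain t a ji * stack (y t) ji
    simp only [z, knownPart, h2, Matrix.mulVec_sub]
    simp only [Pi.add_apply, Pi.sub_apply]
    rw [show (θ.gain t).mulVec (stack (y t)) a = ∑ ji, θ.gain t a ji * stack (y t) ji from rfl, h3]
    simp only [Matrix.mulVec, dotProduct, restGain, Matrix.of_apply, stack]
    ring
  refine ⟨hsol, ?_⟩
  have hker : LinearMap.ker (θ.restGain s t).mulVecLin ≠ ⊥ := by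
    refine LinearMap.ker_ne_bot_of_finrank_lt ?_
    rw [Module.finrank_fintype_fun_eq_card, Module.finrank_fintype_fun_eq_card, card_rest,
      Fintype.card_fin]
    exact hs
  obtain ⟨v, hv, hv0⟩ := Submodule.exists_mem_ne_zero_of_ne_bot hker
  have hv' : (θ.restGain s t).mulVec v = 0 := hv
  refine Set.infinite_of_injective_forall_mem (α := ℝ)
    (f := fun c => (fun ji => y t ji.2 ji.1) + c • v) (fun c d h => ?_) fun c => ?_
  · exact smul_left_injective ℝ hv0 (add_left_cancel h)
  · simp only [Set.mem_ofPred_eq, Matrix.mulVec_add, Matrix.mulVec_smul, hv', smul_zero, add_zero]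
    exact hsol

end Plant

namespace Inputs
variable {n p m K : ℕ}

/-- Changing the measurements of the sensors outside `s` at one time. -/
def perturb (u : Inputs n p m K) (s : Finset (Fin m)) (t : Fin K)
    (v : Fin p × {i // i ∉ s} → ℤ) : Inputs n p m K where
  x := u.x
  y := fun r i j => u.y r i j + if h : i ∉ s then (if r = t then v (j, ⟨i, h⟩) else 0) else 0

end Inputs

namespace Protocol
variable {n p m K : ℕ} (π : Protocol n p m K)

theorem ownInputs_perturb (c : Coalition m) (u : Inputs n p m K) (t : Fin K)
    (v : Fin p × {i // i ∉ c.sensors} → ℤ) :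
    ownInputs c (u.perturb c.sensors t v) = ownInputs c u := by
  unfold ownInputs
  congr 2
  funext i
  split_ifs with h
  · simp [Inputs.perturb, h]
  · rfl

/-- Integer multiples of one nonzero perturbation already give infinitely many measurements, and the
own inputs of the coalition are untouched. Only the invariance of the outputs has to be supplied. -/
theorem infinite_measurements {c : Coalition m} (u : Inputs n p m K) (t : Fin K)
    {v : Fin p × {i // i ∉ c.sensors} → ℤ} (hv : v ≠ 0)
    (h : ∀ z : ℤ, π.ownOutputs c (u.perturb c.sensors t (z • v)) = π.ownOutputs c u) :
    ((fun w : Inputs n p m K => fun i : {i // i ∉ c.sensors} => w.y t i) ''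
      π.compatible c u).Infinite := by
  refine Set.infinite_of_injective_forall_mem (α := ℤ)
    (f := fun z i => (u.perturb c.sensors t (z • v)).y t i) (fun z z' hz => ?_)
    fun z => ⟨_, ⟨ownInputs_perturb c u t _, h z⟩, rfl⟩
  obtain ⟨⟨j, i⟩, hij⟩ := Function.ne_iff.1 hv
  have := congrFun (congrFun hz i) j
  simp only [Inputs.perturb, dif_pos i.2, if_true, Pi.smul_apply, smul_eq_mul, add_right_inj,
    Subtype.coe_eta] at this
  exact mul_right_cancel₀ hij this

theorem noInference_of_partner_ne (hn : 0 < n) (hp : 0 < p) {c : Coalition m}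
    (hc : c.partner ≠ Partner.query) (hs : c.sensors ≠ Finset.univ) : π.NoInference c := by
  have hout : ∀ u w : Inputs n p m K, π.ownOutputs c w = π.ownOutputs c u := by
    intro u w
    unfold ownOutputs
    split
    · rename_i h; exact absurd h hc
    · rfl
  intro u
  refine ⟨fun t => ?_, ?_⟩
  · obtain ⟨i, hi⟩ : ∃ i, i ∉ c.sensors := by
      by_contra h
      push Not at h
      exact hs (Finset.eq_univ_iff_forall.2 h)
    exact π.infinite_measurements u t (v := fun _ => 1)
      (fun h => one_ne_zero (congrFun h (⟨0, hp⟩, ⟨i, hi⟩))) fun z => hout _ _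
  · have hinf : ((fun w : Inputs n p m K => w.x) '' π.compatible c u).Infinite := by
      refine Set.infinite_of_injective_forall_mem (α := ℤ) (f := fun z _ => z)
        (fun z z' h => congrFun h ⟨0, hn⟩) fun z =>
          ⟨⟨fun _ => z, u.y⟩, ⟨?_, hout _ _⟩, rfl⟩
      unfold ownInputs
      congr 1
      split
      · rename_i h; exact absurd h hc
      · rfl
    split
    · trivial
    · exact hinf

/-- The changed measurements enter the recursion once, at time `t`, multiplied by a nonzero scalar
and the encoded gain block. A perturbation in the kernel of this block disappears there, so all
later estimates agree as well. -/
theorem fixedEstimate_perturb (θ : Plant n p m) (β e : ℕ) (u : Inputs n p m K)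
    (s : Finset (Fin m)) (t : Fin K) (v : Fin p × {i // i ∉ s} → ℤ)
    (hv : (Matrix.of fun a (ji : Fin p × {i // i ∉ s}) =>
      encode β e (θ.gain t a (ji.1, ji.2))).mulVec v = 0) (r : ℕ) :
    fixedEstimate θ β e (u.perturb s t v) r = fixedEstimate θ β e u r := by
  induction r with
  | zero => rfl
  | succ r ih =>
    simp only [fixedEstimate, ih]
    congr 1
    simp only [Matrix.mulVec_sub, Matrix.mulVec_smul]
    congr 2
    by_cases hr : r < K
    · simp only [extend, dif_pos hr]
      funext a
      simp only [Matrix.mulVec, dotProduct, encodeMat, Matrix.map_apply]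
      rw [sum_restrict s, sum_restrict s]
      congr 1
      · refine Finset.sum_congr rfl fun i _ => Finset.sum_congr rfl fun j _ => ?_
        simp [stack, Inputs.perturb]
      · by_cases hrt : (⟨r, hr⟩ : Fin K) = t
        · have h1 := congrFun hv a
          simp only [Matrix.mulVec, dotProduct, Matrix.of_apply, Pi.zero_apply] at h1
          subst hrt
          simp only [stack, Inputs.perturb, mul_add, Finset.sum_add_distrib]
          convert add_zero _ using 2
          refine Eq.trans ?_ h1
          refine Finset.sum_congr rfl fun ji _ => ?_
          rw [dif_pos ji.2.2, if_pos trivial]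
        · refine Finset.sum_congr rfl fun ji _ => ?_
          simp [stack, Inputs.perturb, hrt]
    · simp [extend, hr]

theorem noInference_query (hn : 0 < n) {s : Finset (Fin m)} (hs : n < p * sᶜ.card) :
    π.NoInference ⟨Partner.query, s⟩ := by
  intro u
  refine ⟨fun t => ?_, trivial⟩
  have : Nonempty (Fin n) := ⟨⟨0, hn⟩⟩
  -- Siegel's lemma provides an integral kernel vector of the rounded gain block; a real kernel
  -- vector of the exact gain would be of no use for encoded data. The norm bound is dropped.
  obtain ⟨v, hv0, hv, -⟩ := Int.Matrix.exists_ne_zero_int_vec_norm_le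
    (Matrix.of fun a (ji : Fin p × {i // i ∉ s}) =>
      encode π.base π.prec (π.plant.gain t a (ji.1, ji.2)))
    (by rw [card_rest, Fintype.card_fin]; exact hs) (by simpa using hn)
  refine π.infinite_measurements (c := ⟨Partner.query, s⟩) u t hv0 fun z => ?_
  simp only [ownOutputs, target]
  rw [show fixedEstimate π.plant π.base π.prec (u.perturb s t (z • v)) = _ from
    funext fun r => fixedEstimate_perturb π.plant π.base π.prec u s t _
      (by rw [Matrix.mulVec_smul, hv, smul_zero]) r]

end Protocol

end
end PrivateKalman

namespace PrivateKalman
noncomputable section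
open ToData
variable {Γ : Type} [ToData Γ]

/-! ## Polynomial-time evaluation of the protocol -/

section Residues
variable {N : Γ → ℕ}

theorem Poly.intMod (hN0 : ∀ x, N x ≠ 0) (hN : Poly N) {z : Γ → ℤ} (hz : Poly z) :
    Poly fun x => ((z x : ℤ) : ZMod (N x)).val := by
  convert ((hz.intToNat.mod hN).add (hN.sub (hz.negToNat.mod hN))).mod hN using 2 with x
  have : NeZero (N x) := ⟨hN0 x⟩
  rw [← ZMod.val_natCast]
  congr 1
  rw [Nat.cast_add, Nat.cast_sub (Nat.mod_lt _ (Nat.pos_of_ne_zero (hN0 x))).le,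
    ZMod.natCast_mod, ZMod.natCast_mod, ZMod.natCast_self, zero_sub, ← sub_eq_add_neg,
    ← Int.cast_natCast (R := ZMod (N x)), ← Int.cast_natCast (R := ZMod (N x)), ← Int.cast_sub]
  congr 1
  omega

theorem Poly.valMinAbs (hN0 : ∀ x, N x ≠ 0) (hN : Poly N) {z : Γ → ℤ} (hz : Poly z) :
    Poly fun x => ((z x : ℤ) : ZMod (N x)).valMinAbs := by
  have hv := Poly.intMod hN0 hN hz
  convert Poly.ite_le hv (hN.div (.const 2)) (hv.natSub (.const 0)) (hv.natSub hN) using 2 with x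
  have : NeZero (N x) := ⟨hN0 x⟩
  rw [ZMod.valMinAbs_def_pos]
  simp

/-- Families of residues modulo `N ^ 2` that can be computed in polynomial time. -/
def PolyRes (N : Γ → ℕ) (c : ∀ x, ZMod (N x ^ 2)) : Prop := Poly fun x => (c x).val

theorem PolyRes.natCast (hN : Poly N) {f : Γ → ℕ} (hf : Poly f) :
    PolyRes N fun x => (f x : ZMod (N x ^ 2)) := by
  unfold PolyRes
  simp only [ZMod.val_natCast, sq]
  exact hf.mod (hN.mul hN)

theorem PolyRes.mul (hN : Poly N) {c d : ∀ x, ZMod (N x ^ 2)} (hc : PolyRes N c)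
    (hd : PolyRes N d) : PolyRes N fun x => c x * d x := by
  unfold PolyRes
  simp only [ZMod.val_mul, sq]
  exact (Poly.mul hc hd).mod (hN.mul hN)

theorem PolyRes.pow (hN0 : ∀ x, N x ≠ 0) (hN : Poly N) {c : ∀ x, ZMod (N x ^ 2)}
    (hc : PolyRes N c) {k : Γ → ℕ} (hk : Poly k) : PolyRes N fun x => c x ^ k x := by
  -- `Poly.powMod` reduces modulo `m + 1`, so `m` is `N ^ 2 - 1`.
  refine Eq.mp (congrArg Poly (funext fun x => ?_))
    (Poly.powMod ((hN.mul hN).sub (.const 1)) hk hc)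
  have hpos : 0 < N x * N x := Nat.mul_pos (Nat.pos_of_ne_zero (hN0 x)) (Nat.pos_of_ne_zero (hN0 x))
  have : NeZero (N x ^ 2) := ⟨by rw [sq]; exact hpos.ne'⟩
  have h : c x ^ k x = ((c x).val : ZMod (N x ^ 2)) ^ k x := by rw [ZMod.natCast_zmod_val]
  simp only [h]
  rw [← Nat.cast_pow, ZMod.val_natCast, Nat.sub_add_cancel hpos]
  exact congrArg _ (sq _).symm

theorem PolyRes.prod (hN : Poly N) {ι : Type} (s : Finset ι) {c : ι → ∀ x, ZMod (N x ^ 2)}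
    (hc : ∀ i, PolyRes N (c i)) : PolyRes N fun x => ∏ i ∈ s, c i x := by
  classical
  induction s using Finset.induction_on with
  | empty => simpa using PolyRes.natCast hN (.const 1)
  | insert a s ha ih => simpa only [Finset.prod_insert ha] using (hc a).mul hN ih

theorem PolyRes.encScale (hN0 : ∀ x, N x ≠ 0) (hN : Poly N) (a : ℤ) {c : ∀ x, ZMod (N x ^ 2)}
    (hc : PolyRes N c) : PolyRes N fun x => encScale a (c x) :=
  hc.pow hN0 hN (.intMod hN0 hN (.const a))

theorem PolyRes.encMulVec (hN0 : ∀ x, N x ≠ 0) (hN : Poly N) {ι ι' : Type} [Fintype ι']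
    (A : Matrix ι ι' ℤ) {c : ∀ x, ι' → ZMod (N x ^ 2)} (hc : ∀ j, PolyRes N fun x => c x j)
    (i : ι) : PolyRes N fun x => encMulVec A (c x) i :=
  .prod hN _ fun j => (hc j).encScale hN0 hN _

theorem PolyRes.encEstimate (hN0 : ∀ x, N x ≠ 0) (hN : Poly N) {n p m K : ℕ} (θ : Plant n p m)
    (β e : ℕ) {cx : ∀ x, Fin n → ZMod (N x ^ 2)} {cy : ∀ x, Fin K → Fin m → Fin p → ZMod (N x ^ 2)}
    (hx : ∀ a, PolyRes N fun x => cx x a) (hy : ∀ t i j, PolyRes N fun x => cy x t i j) :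
    ∀ t ≤ K, ∀ a, PolyRes N fun x => encEstimate θ β e (cx x) (cy x) t a := by
  intro t
  induction t with
  | zero => intro _ a; exact hx a
  | succ t ih =>
    intro ht a
    have h1 : ∀ x, extend (fun s => stack (cy x s)) t = stack (cy x ⟨t, ht⟩) := fun x => dif_pos ht
    have h2 := PolyRes.encMulVec hN0 hN (encodeMat β e θ.F) (ih (by omega))
    have h3 := PolyRes.encMulVec hN0 hN (encodeMat β e θ.stackH) h2
    simp only [PrivateKalman.encEstimate, h1]
    refine ((h2 a).encScale hN0 hN _).mul hN (PolyRes.encMulVec hN0 hN _ (fun ji => ?_) a)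
    exact ((hy _ _ _).encScale hN0 hN _).mul hN ((h3 ji).encScale hN0 hN _)

theorem PolyRes.genPow (hN0 : ∀ x, N x ≠ 0) (hN : Poly N) {z : Γ → ℤ} (hz : Poly z) :
    PolyRes N fun x => genPow (N x) (z x) := by
  have h : PolyRes N fun x => (1 + (N x : ZMod (N x ^ 2))) := by
    simpa using PolyRes.natCast hN ((Poly.const 1).add hN)
  exact h.pow hN0 hN (.intMod hN0 hN hz)

theorem PolyRes.encrypt (hN0 : ∀ x, N x ≠ 0) (hN : Poly N) {z : Γ → ℤ} (hz : Poly z) {r : Γ → ℕ}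
    (hr : Poly r) : PolyRes N fun x => encrypt (N x) (z x) (r x) :=
  (PolyRes.genPow hN0 hN hz).mul hN ((PolyRes.natCast hN hr).pow hN0 hN hN)

theorem PolyRes.cipherData (hN : Poly N) {c : ∀ x, ZMod (N x ^ 2)} (hc : PolyRes N c) :
    Poly fun x => cipherData (c x) := by
  have : Poly fun x => N x ^ 2 := by simpa only [sq] using hN.mul hN
  exact ((Poly.two_pow_size this).add hc).num

end Residues

/-- The leading bit lies above all the digits of the residue. Hence the length discloses the modulus
size only, and channel security becomes applicable. -/
theorem size_cipherData {N : ℕ} (hN : N ≠ 0) (c : ZMod (N ^ 2)) :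
    (cipherData c).size = Nat.size (N ^ 2) + 2 := by
  have : NeZero (N ^ 2) := ⟨pow_ne_zero 2 hN⟩
  have h1 : c.val < 2 ^ Nat.size (N ^ 2) := (ZMod.val_lt c).trans (Nat.lt_size_self _)
  have h2 : Nat.size (2 ^ Nat.size (N ^ 2) + c.val) = Nat.size (N ^ 2) + 1 := by
    refine le_antisymm (Nat.size_le.2 ?_) (Nat.lt_size.2 (Nat.le_add_right _ _))
    rw [pow_succ 2 (Nat.size (N ^ 2))]
    omega
  rw [cipherData, Data.size, h2]

theorem size_vec_congr {k : ℕ} {f g : Fin k → Data} (h : ∀ i, (f i).size = (g i).size) :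
    (Data.vec f).size = (Data.vec g).size := by
  induction k with
  | zero => simp [Data.vec]
  | succ k ih =>
    rw [Data.vec_succ, Data.vec_succ, Data.size, Data.size, h 0, ih fun i => h i.succ]

/-! ### Representation of inputs and executions -/

section Representation
variable {n p m K : ℕ}

instance : ToData Keys :=
  ⟨fun k => Data.pair (Data.num k.coins) (Data.pair (Data.num k.P) (Data.num k.Q))⟩
instance : ToData (Inputs n p m K) := ⟨Inputs.data⟩
instance : ToData (Execution n p m K) :=
  ⟨fun E => toData (E.keys, E.rx, fun t i j => E.ry (t, i, j))⟩

theorem Poly.keys_coins {k : Γ → Keys} (hk : Poly k) : Poly fun x => (k x).coins :=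
  Poly.comp (g := Keys.coins) (.of_data (.dataLeft .id) fun _ => rfl) hk

theorem Poly.keys_P {k : Γ → Keys} (hk : Poly k) : Poly fun x => (k x).P :=
  Poly.comp (g := Keys.P) (.of_data (.dataLeft (.dataRight .id)) fun _ => rfl) hk

theorem Poly.keys_Q {k : Γ → Keys} (hk : Poly k) : Poly fun x => (k x).Q :=
  Poly.comp (g := Keys.Q) (.of_data (.dataRight (.dataRight .id)) fun _ => rfl) hk

theorem Poly.keys_N {k : Γ → Keys} (hk : Poly k) : Poly fun x => (k x).N := hk.keys_P.mul hk.keys_Q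

theorem Poly.keys_mk {c P Q : Γ → ℕ} (hc : Poly c) (hP : Poly P) (hQ : Poly Q) :
    Poly fun x => (⟨c x, P x, Q x⟩ : Keys) :=
  .of_toData (hc.num.dataPair (hP.num.dataPair hQ.num))

theorem Poly.inputs_x {u : Γ → Inputs n p m K} (hu : Poly u) : Poly fun x => (u x).x :=
  Poly.comp (g := Inputs.x) (.of_data (.dataLeft .id) fun _ => rfl) hu

theorem Poly.inputs_y {u : Γ → Inputs n p m K} (hu : Poly u) : Poly fun x => (u x).y :=
  Poly.comp (g := Inputs.y) (.of_data (.dataRight .id) fun _ => rfl) hu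

theorem Poly.inputs_mk {f : Γ → Fin n → ℤ} {g : Γ → Fin K → Fin m → Fin p → ℤ} (hf : Poly f)
    (hg : Poly g) : Poly fun x => (⟨f x, g x⟩ : Inputs n p m K) :=
  .of_toData (hf.toData.dataPair hg.toData)

theorem Poly.execution_keys {E : Γ → Execution n p m K} (hE : Poly E) :
    Poly fun x => (E x).keys :=
  Poly.comp (g := Execution.keys) (.of_data (.dataLeft .id) fun _ => rfl) hE

theorem Poly.execution_rx {E : Γ → Execution n p m K} (hE : Poly E) (a : Fin n) :
    Poly fun x => (E x).rx a :=
  (Poly.comp (g := Execution.rx) (.of_data (.dataLeft (.dataRight .id)) fun _ => rfl) hE).apply a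

theorem Poly.execution_ry {E : Γ → Execution n p m K} (hE : Poly E) (t : Fin K) (i : Fin m)
    (j : Fin p) : Poly fun x => (E x).ry (t, i, j) :=
  (((Poly.comp (g := fun E : Execution n p m K => fun t i j => E.ry (t, i, j))
    (.of_data (.dataRight (.dataRight .id)) fun _ => rfl) hE).apply t).apply i).apply j

theorem Poly.execution_mk {k : Γ → Keys} {rx : Γ → Fin n → ℕ}
    {ry : Γ → Fin K × Fin m × Fin p → ℕ} (hk : Poly k) (hx : Poly rx)
    (hy : ∀ s, Poly fun x => ry x s) : Poly fun x => (⟨k x, rx x, ry x⟩ : Execution n p m K) :=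
  .of_toData (hk.pair (hx.pair (.vec fun t => .vec fun i => .vec fun j => hy (t, i, j)))).toData

/-- Keys with a nonzero modulus. -/
def Keys.fix (k : Keys) : Keys := if k.N = 0 then ⟨k.coins, 1, 1⟩ else k

/-- A failing key generator may produce `N = 0`, for which `ZMod (N ^ 2)` is the ring of integers
and powers are no longer of polynomial size. Programs replace such keys; this matters only for
invalid keys. -/
theorem Keys.N_fix_ne_zero (k : Keys) : k.fix.N ≠ 0 := by
  unfold fix
  split_ifs with h
  · simp [N]
  · exact h

theorem Keys.fix_eq {k : Keys} (h : k.N ≠ 0) : k.fix = k := if_neg h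

/-- Executions with a nonzero modulus. -/
def Execution.fix (E : Execution n p m K) : Execution n p m K := ⟨E.keys.fix, E.rx, E.ry⟩

theorem Execution.fix_eq {E : Execution n p m K} (h : E.keys.N ≠ 0) : E.fix = E := by
  rw [fix, Keys.fix_eq h]

theorem Poly.execution_fix {E : Γ → Execution n p m K} (hE : Poly E) : Poly fun x => (E x).fix := by
  have h := (hE.execution_keys)
  refine .execution_mk ?_ (.vec hE.execution_rx) fun s => hE.execution_ry s.1 s.2.1 s.2.2
  exact .ite h.keys_N (.keys_mk h.keys_coins (.const 1) (.const 1)) h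

end Representation

theorem KeyGenerator.ppt_keys (G : KeyGenerator) : PPT fun s : Sec => G.keys s.k := by
  have h1 : PPT fun z : Sec × ℕ =>
      G.prog.eval (Data.pair (Data.security z.1.k) (Data.num z.2)) :=
    G.polyTime.ppt.comp (Poly.toData .id)
  have h2 : PPT fun z : Sec × ℕ =>
      (G.prog.eval (Data.pair (Data.security z.1.k) (Data.num z.2))).map fun d =>
        (⟨z.2, d.left.toNat, d.right.toNat⟩ : Keys) :=
    h1.map (.keys_mk (.snd (.fst .id)) (.toNat (.dataLeft (.snd .id)))
      (.toNat (.dataRight (.snd .id))))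
  exact (ppt_bits_sec G.coinLength).bind h2

namespace Protocol
variable {n p m K : ℕ} (π : Protocol n p m K)

section Messages
variable {E : Γ → Execution n p m K} {u : Γ → Inputs n p m K}

theorem polyRes_cipherX (hN0 : ∀ x, (E x).keys.N ≠ 0) (hE : Poly E) (hu : Poly u) (a : Fin n) :
    PolyRes (fun x => (E x).keys.N) fun x => cipherX (E x) (u x) a :=
  .encrypt hN0 hE.execution_keys.keys_N (hu.inputs_x.apply a) (hE.execution_rx a)

theorem polyRes_cipherY (hN0 : ∀ x, (E x).keys.N ≠ 0) (hE : Poly E) (hu : Poly u) (t : Fin K)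
    (i : Fin m) (j : Fin p) :
    PolyRes (fun x => (E x).keys.N) fun x => cipherY (E x) (u x) t i j :=
  .encrypt hN0 hE.execution_keys.keys_N (((hu.inputs_y.apply t).apply i).apply j)
    (hE.execution_ry t i j)

theorem polyRes_cipherEst (hN0 : ∀ x, (E x).keys.N ≠ 0) (hE : Poly E) (hu : Poly u) {t : ℕ}
    (ht : t ≤ K) (a : Fin n) :
    PolyRes (fun x => (E x).keys.N) fun x => π.cipherEst (E x) (u x) t a :=
  .encEstimate hN0 hE.execution_keys.keys_N _ _ _ (polyRes_cipherX hN0 hE hu)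
    (polyRes_cipherY hN0 hE hu) t ht a

theorem poly_msgX (hN0 : ∀ x, (E x).keys.N ≠ 0) (hE : Poly E) (hu : Poly u) :
    Poly fun x => π.msgX (E x) (u x) :=
  .dataPair (.dataVec fun a => (polyRes_cipherX hN0 hE hu a).cipherData hE.execution_keys.keys_N)
    (.const _)

theorem poly_msgY (hN0 : ∀ x, (E x).keys.N ≠ 0) (hE : Poly E) (hu : Poly u) (i : Fin m)
    (t : Fin K) : Poly fun x => π.msgY (E x) (u x) i t :=
  .dataPair (.dataVec fun j =>
    (polyRes_cipherY hN0 hE hu t i j).cipherData hE.execution_keys.keys_N) (.const _)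

theorem poly_msgEst (hN0 : ∀ x, (E x).keys.N ≠ 0) (hE : Poly E) (hu : Poly u) (t : Fin K) :
    Poly fun x => π.msgEst (E x) (u x) t :=
  .dataPair (.dataVec fun a =>
    (π.polyRes_cipherEst hN0 hE hu (by omega) a).cipherData hE.execution_keys.keys_N) (.const _)

end Messages

/-- A message of the protocol, as a function of the execution and of the inputs: it can be
computed efficiently, and its size does not depend on the inputs. -/
structure IsMessage (f : Execution n p m K → Inputs n p m K → Data) : Prop where
  poly : ∀ {Γ : Type} [ToData Γ] {E : Γ → Execution n p m K} {u : Γ → Inputs n p m K},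
    (∀ x, (E x).keys.N ≠ 0) → Poly E → Poly u → Poly fun x => f (E x) (u x)
  size_eq : ∀ E u w, E.keys.N ≠ 0 → (f E u).size = (f E w).size

theorem isMessage_msgX : IsMessage π.msgX where
  poly := π.poly_msgX
  size_eq E u w hE := by
    simp only [msgX, Data.size]
    congr 2
    exact size_vec_congr fun a => by rw [size_cipherData hE, size_cipherData hE]

theorem isMessage_msgY (i : Fin m) (t : Fin K) : IsMessage fun E u => π.msgY E u i t where
  poly h hE hu := π.poly_msgY h hE hu i t
  size_eq E u w hE := by
    simp only [msgY, Data.size]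
    congr 2
    exact size_vec_congr fun a => by rw [size_cipherData hE, size_cipherData hE]

theorem isMessage_msgEst (t : Fin K) : IsMessage fun E u => π.msgEst E u t where
  poly h hE hu := π.poly_msgEst h hE hu t
  size_eq E u w hE := by
    simp only [msgEst, Data.size]
    congr 2
    exact size_vec_congr fun a => by rw [size_cipherData hE, size_cipherData hE]

/-- The traffic between parties outside a coalition, as a list of functions. -/
def traffic (c : Coalition m) : List (List (Execution n p m K → Inputs n p m K → Data)) :=
  let fromSensors := ((List.finRange m).filter fun i => i ∉ c.sensors).map fun i =>
    List.ofFn fun t => fun E u => π.msgY E u i t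
  match c.partner with
    | Partner.nobody => fromSensors ++ [[π.msgX], List.ofFn fun t => fun E u => π.msgEst E u t]
    | Partner.aggregator => []
    | Partner.query => fromSensors

/-- The shape of the traffic depends on the coalition alone; as a fixed list of functions it is
accessible to the calculus of polynomial-time functions. -/
theorem hiddenTraffic_eq (c : Coalition m) (E : Execution n p m K) (u : Inputs n p m K) :
    π.hiddenTraffic c E u = (π.traffic c).map fun l => l.map fun f => f E u := by
  unfold hiddenTraffic traffic
  rcases c.partner <;> simp [List.map_ofFn, Function.comp_def]

theorem isMessage_of_mem_traffic {c : Coalition m} {l} (hl : l ∈ π.traffic c) {f} (hf : f ∈ l) :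
    IsMessage f := by
  have key : l ∈ (((List.finRange m).filter fun i => i ∉ c.sensors).map fun i =>
      List.ofFn fun t => fun (E : Execution n p m K) (u : Inputs n p m K) => π.msgY E u i t) →
      IsMessage f := by
    intro h
    obtain ⟨i, -, rfl⟩ := List.mem_map.1 h
    obtain ⟨t, rfl⟩ := (List.mem_ofFn' _ _).1 hf
    exact π.isMessage_msgY i t
  unfold traffic at hl
  split at hl
  · rcases List.mem_append.1 hl with h | h
    · exact key h
    · simp only [List.mem_cons, List.not_mem_nil, or_false] at h
      rcases h with rfl | rfl
      · rw [List.mem_singleton.1 hf]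
        exact π.isMessage_msgX
      · obtain ⟨t, rfl⟩ := (List.mem_ofFn' _ _).1 hf
        exact π.isMessage_msgEst t
  · simp at hl
  · exact key hl

/-! ### Efficient simulation of executions and views -/

/-- An execution with nearly uniform encryption coins. -/
def approxExecution (κ : ℕ) : PMF (Execution n p m K) :=
  (π.keygen.keys κ).bind fun k =>
    (iidFamily (approxUnit k.N) (Fin n)).bind fun rx =>
      (iidFamily (approxUnit k.N) (Fin K × Fin m × Fin p)).map fun ry => ⟨k, rx, ry⟩

theorem ppt_coins {N : Γ → ℕ} (hN : Poly N) (ι : Type) [Fintype ι] {β : Type} [ToData β]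
    {f : Γ → (ι → ℕ) → β} (hf : Poly fun z : Γ × (Fin (Fintype.card ι) → ℕ) =>
      f z.1 fun i => z.2 (Fintype.equivFin ι i)) :
    PPT fun x => (iidFamily (approxUnit (N x)) ι).map (f x) := by
  have := ((ppt_approxUnit.comp hN).iid (Fintype.card ι)).map
    (g := fun x v => f x fun i => v (Fintype.equivFin ι i)) hf
  simp only [iidFamily, PMF.map_comp]
  exact this

theorem ppt_approxExecution : PPT fun s : Sec => π.approxExecution s.k := by
  have h1 : PPT fun z : Sec × Keys => iidFamily (approxUnit z.2.N) (Fin n) := by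
    have := ppt_coins (Γ := Sec × Keys) (Poly.keys_N (.snd .id)) (Fin n) (f := fun _ v => v)
      (.vec fun i => .apply (.snd .id) (Fintype.equivFin (Fin n) i))
    convert this using 2
    exact (PMF.map_id _).symm
  have h2 : PPT fun z : (Sec × Keys) × (Fin n → ℕ) =>
      (iidFamily (approxUnit z.1.2.N) (Fin K × Fin m × Fin p)).map fun ry =>
        (⟨z.1.2, z.2, ry⟩ : Execution n p m K) :=
    ppt_coins (Poly.keys_N (.snd (.fst .id))) _
      (.execution_mk (.snd (.fst (.fst .id))) (.snd (.fst .id)) fun s => .apply (.snd .id) _)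
  exact π.keygen.ppt_keys.bind (h1.bind h2)

/-- The messages that a coalition receives and its computations, as produced from inputs `w` for
the ciphertexts and from estimates `o` for the query node. -/
def simReceived (c : Coalition m) (E : Execution n p m K) (w : Inputs n p m K)
    (o : Fin K → Fin n → ℤ) : Data :=
  match c.partner with
    | Partner.query => Data.list
        [Data.pair (Data.num E.keys.P) (Data.num E.keys.Q),
         Data.vec fun t => Data.pair
          (Data.vec fun a => cipherData (genPow E.keys.N (o t a) *
            π.cipherEst E (Inputs.zero n p m K) (t + 1) a))
          (π.matData (π.plant.cov (t + 1))),
         Data.vec fun t => Data.vec fun a => Data.int ((o t a : ZMod E.keys.N).valMinAbs)]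
    | _ => π.received c E w

/-- The view of a coalition with given own inputs, in an execution with given random choices. -/
def simRun (κ : ℕ) (c : Coalition m) (own : Data) (w : Inputs n p m K) (o : Fin K → Fin n → ℤ)
    (E : Execution n p m K) : PMF Data :=
  (π.channel.links κ (π.hiddenTraffic c E.fix w)).map fun l =>
    Data.list [π.publicData, own, ownCoins c E, Data.num E.keys.N,
      π.simReceived c E.fix w o, Data.list l]

/-- The simulated view of a coalition. -/
def simView (κ : ℕ) (c : Coalition m) (own : Data) (w : Inputs n p m K)
    (o : Fin K → Fin n → ℤ) : PMF Data :=
  (π.approxExecution κ).bind (π.simRun κ c own w o)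

end Protocol

/-! ### Efficient sampling of the encrypted traffic and of simulated views. -/

theorem ChannelScheme.ppt_encList (C : ChannelScheme) {key : Γ → Data} (hkey : Poly key)
    {l : List (Γ → Data)} (hl : ∀ f ∈ l, Poly f) :
    PPT fun x => C.encList (key x) (l.map fun f => f x) := by
  induction l with
  | nil => exact Poly.const []
  | cons a l ih =>
    have h1 := C.enc_polyTime.ppt.comp (hkey.dataPair (hl a (by simp)))
    have h2 : PPT fun z : Γ × Data =>
        (C.encList (key z.1) (l.map fun f => f z.1)).map fun cs => z.2 :: cs :=
      ((ih fun f hf => hl f (by simp [hf])).comp (.fst .id)).map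
        (.of_toData (.dataPair (.snd (.fst .id)) (Poly.toData (.snd .id))))
    exact h1.bind h2

theorem Poly.dataList_id {f : Γ → List Data} (hf : Poly f) : Poly fun x => Data.list (f x) :=
  Poly.comp (g := Data.list) (.of_data .id fun l => by simp [ToData.toData]) hf

theorem ChannelScheme.ppt_link (C : ChannelScheme) {s : Γ → Sec} (hs : Poly s)
    {l : List (Γ → Data)} (hl : ∀ f ∈ l, Poly f) :
    PPT fun x => C.link (s x).k (l.map fun f => f x) := by
  have h1 : PPT fun x => C.gen.eval (Data.security (s x).k) :=
    C.gen_polyTime.ppt.comp hs.toData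
  have h := C.ppt_encList (Γ := Γ × Data) (key := Prod.snd) (.snd .id)
    (l := l.map fun f => fun z => f z.1) (by
      intro f hf
      obtain ⟨g, hg, rfl⟩ := List.mem_map.1 hf
      exact (hl g hg).comp (.fst .id))
  simp only [List.map_map, Function.comp_def] at h
  have h2 : PPT fun z : Γ × Data => (C.encList z.2 (l.map fun f => f z.1)).map Data.list :=
    h.map (Poly.dataList_id (.snd .id))
  exact h1.bind h2

theorem ChannelScheme.ppt_links (C : ChannelScheme) {s : Γ → Sec} (hs : Poly s)
    {L : List (List (Γ → Data))} (hL : ∀ l ∈ L, ∀ f ∈ l, Poly f) :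
    PPT fun x => C.links (s x).k (L.map fun l => l.map fun f => f x) := by
  induction L with
  | nil => exact Poly.const []
  | cons a L ih =>
    have h2 : PPT fun z : Γ × Data =>
        (C.links (s z.1).k (L.map fun l => l.map fun f => f z.1)).map fun cs => z.2 :: cs :=
      ((ih fun l hl => hL l (by simp [hl])).comp (.fst .id)).map
        (.of_toData (.dataPair (.snd (.fst .id)) (Poly.toData (.snd .id))))
    exact (C.ppt_link hs (hL a (by simp))).bind h2

namespace Protocol
variable {n p m K : ℕ} (π : Protocol n p m K)

theorem poly_ownCoins (c : Coalition m) {E : Γ → Execution n p m K} (hE : Poly E) :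
    Poly fun x => ownCoins c (E x) := by
  refine .dataPair ?_ (.dataVec fun i => ?_)
  · rcases c.partner
    · exact .const _
    · exact .const _
    · exact .dataPair hE.execution_keys.keys_coins.num (.dataVec fun a => (hE.execution_rx a).num)
  · split_ifs
    · exact .dataVec fun t => .dataVec fun j => (hE.execution_ry t i j).num
    · exact .const _

theorem poly_ownInputs (c : Coalition m) {u : Γ → Inputs n p m K} (hu : Poly u) :
    Poly fun x => ownInputs c (u x) := by
  refine .dataPair ?_ (.dataVec fun i => ?_)
  · rcases c.partner
    · exact .const _
    · exact .const _
    · exact .dataVec fun a => (hu.inputs_x.apply a).toData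
  · split_ifs
    · exact .dataVec fun t => .dataVec fun j => (((hu.inputs_y.apply t).apply i).apply j).toData
    · exact .const _

theorem poly_simReceived (c : Coalition m) {E : Γ → Execution n p m K} {w : Γ → Inputs n p m K}
    {o : Γ → Fin K → Fin n → ℤ} (hN0 : ∀ x, (E x).keys.N ≠ 0) (hE : Poly E) (hw : Poly w)
    (ho : Poly o) : Poly fun x => π.simReceived c (E x) (w x) (o x) := by
  have hk := hE.execution_keys
  obtain ⟨q, s⟩ := c
  rcases q
  · exact .const _
  · exact .dataPair (π.poly_msgX hN0 hE hw) (.dataPair (.dataVec fun i => .dataVec fun t =>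
      π.poly_msgY hN0 hE hw i t) (.dataPair (.dataVec fun t => π.poly_msgEst hN0 hE hw t)
        (.const _)))
  · refine .dataPair (.dataPair hk.keys_P.num hk.keys_Q.num) (.dataPair (.dataVec fun t =>
      .dataPair (.dataVec fun a => ?_) (.const _)) (.dataPair (.dataVec fun t => .dataVec fun a =>
        ?_) (.const _)))
    · exact ((PolyRes.genPow hN0 hk.keys_N ((ho.apply t).apply a)).mul hk.keys_N
        (π.polyRes_cipherEst hN0 hE (.const _) (by omega) a)).cipherData hk.keys_N
    · exact (Poly.valMinAbs hN0 hk.keys_N ((ho.apply t).apply a)).toData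

theorem ppt_simRun (c : Coalition m) {s : Γ → Sec} {own : Γ → Data} {w : Γ → Inputs n p m K}
    {o : Γ → Fin K → Fin n → ℤ} {E : Γ → Execution n p m K} (hs : Poly s) (hown : Poly own)
    (hw : Poly w) (ho : Poly o) (hE : Poly E) :
    PPT fun x => π.simRun (s x).k c (own x) (w x) (o x) (E x) := by
  have hN0 : ∀ x, (E x).fix.keys.N ≠ 0 := fun x => (E x).keys.N_fix_ne_zero
  have h := π.channel.ppt_links hs (L := (π.traffic c).map fun l => l.map fun f =>
    fun x => f (E x).fix (w x)) (by
      intro l hl f hf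
      obtain ⟨l', hl', rfl⟩ := List.mem_map.1 hl
      obtain ⟨f', hf', rfl⟩ := List.mem_map.1 hf
      exact (π.isMessage_of_mem_traffic hl' hf').poly hN0 hE.execution_fix hw)
  simp only [List.map_map, Function.comp_def] at h
  unfold simRun
  simp only [hiddenTraffic_eq]
  refine PPT.map h ?_
  have hf : Poly fun z : Γ × List Data => z.1 := .fst .id
  refine .dataPair (.const _) (.dataPair (hown.comp hf) (.dataPair ((poly_ownCoins c hE).comp hf)
    (.dataPair (hE.execution_keys.keys_N.num.comp hf) (.dataPair
      ((π.poly_simReceived c hN0 hE.execution_fix hw ho).comp hf)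
      (.dataPair (Poly.dataList_id (.snd .id)) (.const _))))))

theorem ppt_simView (c : Coalition m) {s : Γ → Sec} {own : Γ → Data} {w : Γ → Inputs n p m K}
    {o : Γ → Fin K → Fin n → ℤ} (hs : Poly s) (hown : Poly own) (hw : Poly w) (ho : Poly o) :
    PPT fun x => π.simView (s x).k c (own x) (w x) (o x) := by
  have hf : Poly fun z : Γ × Execution n p m K => z.1 := .fst .id
  exact (π.ppt_approxExecution.comp hs).bind
    (π.ppt_simRun c (hs.comp hf) (hown.comp hf) (hw.comp hf) (ho.comp hf) (.snd .id))

end Protocol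

end
end PrivateKalman

namespace PrivateKalman
noncomputable section
open ToData
variable {Γ : Type} [ToData Γ]

/-! ## Replacing the traffic on the encrypted channels -/

section Channel
variable {C : ChannelScheme}

/-- The generator of the messages discloses the whole sample `x` from which both lists are computed,
so whatever else depends on `x` can be added afterwards. -/
theorem ChannelScheme.Secure.link_indist (hC : C.Secure) {X : ℕ → PMF Γ}
    (hX : PPT fun s : Sec => X s.k) {l : List ((Γ → Data) × (Γ → Data))}
    (hl : ∀ f ∈ l, Poly f.1 ∧ Poly f.2 ∧ ∀ x, (f.1 x).size = (f.2 x).size) :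
    Indist (fun κ => (X κ).bind fun x => (C.link κ (l.map fun f => f.1 x)).map fun c => (x, c))
      (fun κ => (X κ).bind fun x => (C.link κ (l.map fun f => f.2 x)).map fun c => (x, c)) := by
  have h := hC (fun κ => (X κ).map fun x =>
    (toData x, l.map (fun f => f.1 x), l.map (fun f => f.2 x))) ?_ ?_
  · simp only [PMF.bind_map] at h
    unfold Indist
    simp only [PMF.map_bind, PMF.map_comp]
    exact h
  · have hp : PPT fun s : Sec => (X s.k).map fun x => Data.pair (toData x)
        (Data.pair (Data.list (l.map fun f => f.1 x)) (Data.list (l.map fun f => f.2 x))) := by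
      refine hX.map (g := fun _ x => Data.pair (toData x)
        (Data.pair (Data.list (l.map fun f => f.1 x)) (Data.list (l.map fun f => f.2 x)))) ?_
      have h2 : Poly fun z : Sec × Γ => z.2 := .snd .id
      have h3 : Poly fun x : Γ => Data.list (l.map fun f => f.1 x) := by
        have := Poly.dataList (l := l.map Prod.fst) (fun f hf => by
          obtain ⟨g, hg, rfl⟩ := List.mem_map.1 hf
          exact (hl g hg).1)
        simpa only [List.map_map, Function.comp_def] using this
      have h4 : Poly fun x : Γ => Data.list (l.map fun f => f.2 x) := by
        have := Poly.dataList (l := l.map Prod.snd) (fun f hf => by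
          obtain ⟨g, hg, rfl⟩ := List.mem_map.1 hf
          exact (hl g hg).2.1)
        simpa only [List.map_map, Function.comp_def] using this
      exact h2.toData.dataPair ((h3.comp h2).dataPair (h4.comp h2))
    obtain ⟨A, hA, h'⟩ := hp
    refine ⟨A, hA, fun κ => (h' ⟨κ⟩).trans ?_⟩
    simp only [PMF.map_comp]
    rfl
  · intro κ τ hτ
    obtain ⟨x, -, rfl⟩ := (PMF.mem_support_map_iff _ _ _).1 hτ
    simp only [List.map_map]
    exact List.map_congr_left fun f hf => (hl f hf).2.2 x

/-- A hybrid argument over the channels, whose number is fixed and whose keys are independent. -/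
theorem ChannelScheme.Secure.links_indist (hC : C.Secure) {Γ : Type} [ToData Γ] {X : ℕ → PMF Γ}
    (hX : PPT fun s : Sec => X s.k) {L : List (List ((Γ → Data) × (Γ → Data)))}
    (hL : ∀ l ∈ L, ∀ f ∈ l, Poly f.1 ∧ Poly f.2 ∧ ∀ x, (f.1 x).size = (f.2 x).size) :
    Indist (fun κ => (X κ).bind fun x =>
        (C.links κ (L.map fun l => l.map fun f => f.1 x)).map fun c => (x, c))
      (fun κ => (X κ).bind fun x =>
        (C.links κ (L.map fun l => l.map fun f => f.2 x)).map fun c => (x, c)) := by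
  obtain ⟨k, hk⟩ : ∃ k, L.length = k := ⟨_, rfl⟩
  induction k generalizing Γ with
  | zero =>
    rw [List.length_eq_zero_iff.1 hk]
    exact .refl _
  | succ k ih =>
    obtain ⟨a, L, rfl⟩ := List.exists_cons_of_length_eq_add_one hk
    have ha := hL a (by simp)
    have hL' := fun l (hl : l ∈ L) => hL l (by simp [hl])
    have h1 := hC.link_indist hX ha
    have p1 : PPT fun z : Sec × (Γ × Data) =>
        (C.links z.1.k (L.map fun l => l.map fun f => f.1 z.2.1)).map fun cs =>
          (z.2.1, z.2.2 :: cs) := by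
      have := C.ppt_links (Γ := Sec × (Γ × Data)) (s := Prod.fst) (.fst .id)
        (L := L.map fun l => l.map fun f z => f.1 z.2.1) (by
          intro l hl f hf
          obtain ⟨l', hl', rfl⟩ := List.mem_map.1 hl
          obtain ⟨f', hf', rfl⟩ := List.mem_map.1 hf
          exact (hL' l' hl' f' hf').1.comp (.fst (.snd .id)))
      simp only [List.map_map, Function.comp_def] at this
      exact this.map (.pair (.fst (.snd (.fst .id)))
        (.of_toData (.dataPair (.snd (.snd (.fst .id))) (Poly.toData (.snd .id)))))
    -- In the first hybrid step the reduction itself produces the traffic of all the remaining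
    -- channels.
    have h2 := Indist.bind (G := fun κ (z : Γ × Data) =>
      (C.links κ (L.map fun l => l.map fun f => f.1 z.1)).map fun cs => (z.1, z.2 :: cs)) p1 h1
    have hX' : PPT fun s : Sec => (X s.k).bind fun x =>
        (C.link s.k (a.map fun f => f.2 x)).map fun c => (x, c) := by
      have := C.ppt_link (Γ := Sec × Γ) (s := Prod.fst) (.fst .id)
        (l := a.map fun f z => f.2 z.2) (by
          intro f hf
          obtain ⟨f', hf', rfl⟩ := List.mem_map.1 hf
          exact (ha f' hf').2.1.comp (.snd .id))
      simp only [List.map_map, Function.comp_def] at this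
      exact hX.bind (this.map (.pair (.snd (.fst .id)) (.snd .id)))
    -- The traffic of the first channel becomes part of the disclosed sample, to which the induction
    -- hypothesis applies.
    obtain ⟨X', hX₀⟩ : ∃ X' : ℕ → PMF (Γ × Data), X' = fun κ => (X κ).bind fun x =>
      (C.link κ (a.map fun f => f.2 x)).map fun c => (x, c) := ⟨_, rfl⟩
    have h3 := ih (X := X') (by rw [hX₀]; exact hX')
      (L := L.map fun l => l.map fun f => (fun z : Γ × Data => f.1 z.1, fun z => f.2 z.1)) (by
      intro l hl f hf
      obtain ⟨l', hl', rfl⟩ := List.mem_map.1 hl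
      obtain ⟨f', hf', rfl⟩ := List.mem_map.1 hf
      obtain ⟨q1, q2, q3⟩ := hL' l' hl' f' hf'
      exact ⟨q1.comp (.fst .id), q2.comp (.fst .id), fun z => q3 z.1⟩)
      (by simpa using hk)
    have q0 : Poly fun z : Sec × ((Γ × Data) × List Data) => z.2 := .snd .id
    have p3 : Poly fun z : Sec × ((Γ × Data) × List Data) => (z.2.1.1, z.2.1.2 :: z.2.2) :=
      q0.fst.fst.pair (.of_toData (q0.fst.snd.toData.dataPair q0.snd.toData))
    have h4 := Indist.map (g := fun _ (z : (Γ × Data) × List Data) => (z.1.1, z.1.2 :: z.2)) p3 h3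
    simp only [List.map_map, Function.comp_def, PMF.map_bind, PMF.bind_map, PMF.map_comp,
      PMF.bind_bind, List.map_cons, ChannelScheme.links, hX₀] at h2 h4 ⊢
    exact h2.trans h4

end Channel

/-! ## Slots for private numbers -/

section Slots
variable {n p m K : ℕ}

/-- The indices of all the private numbers. -/
abbrev Slot (n p m K : ℕ) : Type := Fin n ⊕ (Fin K × Fin m × Fin p)

/-- The private number with a given index. -/
def Inputs.plain (u : Inputs n p m K) : Slot n p m K → ℤ :=
  Sum.elim u.x fun s => u.y s.1 s.2.1 s.2.2

/-- Replacing some of the private numbers by zero. -/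
def Inputs.mask (S : Finset (Slot n p m K)) (u : Inputs n p m K) : Inputs n p m K where
  x a := if Sum.inl a ∈ S then 0 else u.x a
  y t i j := if Sum.inr (t, i, j) ∈ S then 0 else u.y t i j

theorem Inputs.plain_mask (S : Finset (Slot n p m K)) (u : Inputs n p m K) (σ : Slot n p m K) :
    (u.mask S).plain σ = if σ ∈ S then 0 else u.plain σ := by
  rcases σ with a | ⟨t, i, j⟩ <;> rfl

theorem Inputs.mask_empty (u : Inputs n p m K) : u.mask ∅ = u := by
  simp [mask]

theorem poly_mask (S : Finset (Slot n p m K)) {u : Γ → Inputs n p m K} (hu : Poly u) :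
    Poly fun x => (u x).mask S := by
  refine .inputs_mk (.vec fun a => ?_) (.vec fun t => .vec fun i => .vec fun j => ?_)
  · split_ifs
    · exact .const 0
    · exact hu.inputs_x.apply a
  · split_ifs
    · exact .const 0
    · exact ((hu.inputs_y.apply t).apply i).apply j

theorem poly_plain {u : Γ → Inputs n p m K} (hu : Poly u) (σ : Slot n p m K) :
    Poly fun x => (u x).plain σ := by
  rcases σ with a | ⟨t, i, j⟩
  · exact hu.inputs_x.apply a
  · exact ((hu.inputs_y.apply t).apply i).apply j

open Classical in
/-- The indices of the private numbers of the parties outside a coalition. -/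
def Coalition.hidden (n p K : ℕ) (c : Coalition m) : Finset (Slot n p m K) :=
  Finset.univ.filter fun σ => Sum.elim (fun _ => c.partner ≠ Partner.query)
    (fun s => s.2.1 ∉ c.sensors) σ

end Slots

theorem poly_fixedEstimate {n p m K : ℕ} (θ : Plant n p m) (β e : ℕ) :
    ∀ t ≤ K, ∀ a, Poly fun u : Inputs n p m K => fixedEstimate θ β e u t a := by
  intro t
  induction t with
  | zero => intro _ a; exact Poly.apply (Poly.inputs_x .id) a
  | succ t ih =>
    intro ht a
    have h1 : ∀ u : Inputs n p m K, extend (fun s => stack (u.y s)) t = stack (u.y ⟨t, ht⟩) :=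
      fun u => dif_pos ht
    have hmul : ∀ {ι ι' : Type} [Fintype ι'] (A : Matrix ι ι' ℤ) {v : Inputs n p m K → ι' → ℤ},
        (∀ j, Poly fun u => v u j) → ∀ i, Poly fun u => A.mulVec (v u) i := by
      intro ι ι' _ A v hv i
      exact .intSum _ fun j => (Poly.const (A i j)).intMul (hv j)
    have h2 := hmul (encodeMat β e θ.F) (ih (by omega))
    have h3 := hmul (encodeMat β e θ.stackH) h2
    simp only [fixedEstimate, h1, Pi.add_apply, Pi.smul_apply, smul_eq_mul]
    refine ((Poly.const _).intMul (h2 a)).intAdd (hmul _ (fun ji => ?_) a)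
    simp only [Pi.sub_apply, Pi.smul_apply, smul_eq_mul]
    exact ((Poly.const _).intMul
      (((Poly.inputs_y .id).apply _).apply _ |>.apply _)).intSub (h3 ji)

namespace Protocol
variable {n p m K : ℕ} (π : Protocol n p m K)

theorem poly_target : Poly π.target :=
  .vec fun t => .vec fun a => poly_fixedEstimate π.plant π.base π.prec (t + 1) (by omega) a

/-- Only the aggregator receives ciphertexts of the inputs; the simulated messages to the query node
are made from the estimates `o`. -/
theorem simReceived_eq {c : Coalition m} (hc : c.partner ≠ Partner.aggregator)
    (E : Execution n p m K) (u w : Inputs n p m K) (o : Fin K → Fin n → ℤ) :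
    π.simReceived c E u o = π.simReceived c E w o := by
  obtain ⟨q, s⟩ := c
  rcases q
  · rfl
  · exact absurd rfl hc
  · rfl

/-- Without the aggregator the inputs `u` behind the ciphertexts affect the view only through the
hidden traffic, so channel security suffices. No property of Paillier encryption is used, as is
necessary against the owner of the private key. -/
theorem simView_indist_of_secure (hC : π.channel.Secure) {U : ℕ → PMF (Inputs n p m K)}
    (hU : PPT fun s : Sec => U s.k) {c : Coalition m} (hc : c.partner ≠ Partner.aggregator)
    {w : Inputs n p m K → Inputs n p m K} (hw : Poly w)
    {o : Inputs n p m K → Fin K → Fin n → ℤ} (ho : Poly o) :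
    Indist (fun κ => (U κ).bind fun u =>
        (π.simView κ c (ownInputs c u) u (o u)).map fun v => (u, v))
      (fun κ => (U κ).bind fun u =>
        (π.simView κ c (ownInputs c u) (w u) (o u)).map fun v => (u, v)) := by
  have hX : PPT fun s : Sec => (U s.k).bind fun u =>
      (π.approxExecution s.k).map fun E => (u, E) :=
    hU.bind ((π.ppt_approxExecution.comp (.fst .id)).map (g := fun z E => (z.2, E))
      (.pair (.snd (.fst .id)) (.snd .id)))
  have hE : Poly fun x : Inputs n p m K × Execution n p m K => x.2.fix :=
    .execution_fix (.snd .id)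
  have hN0 : ∀ x : Inputs n p m K × Execution n p m K, x.2.fix.keys.N ≠ 0 :=
    fun x => x.2.keys.N_fix_ne_zero
  have h := hC.links_indist (X := fun κ => (U κ).bind fun u =>
      (π.approxExecution κ).map fun E => (u, E)) hX (L := (π.traffic c).map fun l => l.map fun f =>
    ((fun x : Inputs n p m K × Execution n p m K => f x.2.fix x.1), fun x => f x.2.fix (w x.1))) (by
      intro l hl f hf
      obtain ⟨l', hl', rfl⟩ := List.mem_map.1 hl
      obtain ⟨f', hf', rfl⟩ := List.mem_map.1 hf
      have hm := π.isMessage_of_mem_traffic hl' hf'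
      exact ⟨hm.poly hN0 hE (.fst .id), hm.poly hN0 hE (hw.comp (.fst .id)),
        fun x => hm.size_eq _ _ _ (hN0 x)⟩)
  have hz : Poly fun z : Sec × ((Inputs n p m K × Execution n p m K) × List Data) => z.2.1 :=
    .fst (.snd .id)
  have hg : Poly fun z : Sec × ((Inputs n p m K × Execution n p m K) × List Data) =>
      (z.2.1.1, Data.list [π.publicData, ownInputs c z.2.1.1, ownCoins c z.2.1.2,
        Data.num z.2.1.2.keys.N, π.simReceived c z.2.1.2.fix z.2.1.1 (o z.2.1.1),
        Data.list z.2.2]) := by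
    refine .pair (.fst hz) (.dataPair (.const _) (.dataPair (poly_ownInputs c (.fst hz))
      (.dataPair (poly_ownCoins c (.snd hz)) (.dataPair (Poly.num (.keys_N (.execution_keys
        (.snd hz)))) (.dataPair ?_ (.dataPair (Poly.dataList_id (.snd (.snd .id))) (.const _)))))))
    exact π.poly_simReceived c (fun z => hN0 z.2.1) (hE.comp hz) (.fst hz) (ho.comp (.fst hz))
  -- The rest of the view is an efficient function of the disclosed inputs, keys and coins.
  have h2 := Indist.map (g := fun _ (z : (Inputs n p m K × Execution n p m K) × List Data) =>
    (z.1.1, Data.list [π.publicData, ownInputs c z.1.1, ownCoins c z.1.2,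
      Data.num z.1.2.keys.N, π.simReceived c z.1.2.fix z.1.1 (o z.1.1), Data.list z.2])) hg h
  simp only [List.map_map, Function.comp_def, PMF.map_bind, PMF.bind_map, PMF.map_comp,
    PMF.bind_bind] at h2
  simp only [simView, simRun, hiddenTraffic_eq, PMF.map_bind, PMF.map_comp, Function.comp_def,
    fun E u => π.simReceived_eq hc E (w u) u (o u)]
  exact h2

/-! ### The statistical part -/

/-- The view in an execution, with given own inputs, inputs `w` for the ciphertexts and estimates
`o` for the query node. -/
def run (κ : ℕ) (c : Coalition m) (own : Data) (w : Inputs n p m K) (o : Fin K → Fin n → ℤ)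
    (E : Execution n p m K) : PMF Data :=
  (π.channel.links κ (π.hiddenTraffic c E w)).map fun l =>
    Data.list [π.publicData, own, ownCoins c E, Data.num E.keys.N,
      π.simReceived c E w o, Data.list l]

theorem simRun_eq (κ : ℕ) (c : Coalition m) (own : Data) (w : Inputs n p m K)
    (o : Fin K → Fin n → ℤ) {E : Execution n p m K} (hE : E.keys.N ≠ 0) :
    π.simRun κ c own w o E = π.run κ c own w o E := by
  rw [simRun, run, E.fix_eq hE]

/-- A bound for the statistical distance of an execution and its simulation. -/
def gap (κ : ℕ) : ℝ :=
  (π.keygen.failure κ).toReal + (n + (Fintype.card (Fin K × Fin m × Fin p) : ℝ)) * (6 / 2 ^ κ)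

theorem negligible_gap : Negligible π.gap := by
  refine π.keygen.negligible_failure.add ?_
  convert negligible_two_pow.const_mul ((n + (Fintype.card (Fin K × Fin m × Fin p) : ℝ)) * 6)
    using 2
  ring

theorem gap_nonneg (κ : ℕ) : 0 ≤ π.gap κ := by unfold gap; positivity

theorem ofReal_failure (κ : ℕ) :
    ENNReal.ofReal (π.keygen.failure κ).toReal = π.keygen.failure κ :=
  ENNReal.ofReal_toReal (π.keygen.failure_ne_top κ)

theorem ofReal_gap (κ : ℕ) : ENNReal.ofReal (π.gap κ) = π.keygen.failure κ +
    (n * ENNReal.ofReal (6 / 2 ^ κ) +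
      Fintype.card (Fin K × Fin m × Fin p) * ENNReal.ofReal (6 / 2 ^ κ)) := by
  rw [gap, ENNReal.ofReal_add (by positivity) (by positivity), ofReal_failure,
    ENNReal.ofReal_mul (by positivity), ENNReal.ofReal_add (by positivity) (by positivity),
    ENNReal.ofReal_natCast, ENNReal.ofReal_natCast, add_mul]

theorem statClose_execution (κ : ℕ) : StatClose (ENNReal.ofReal (π.gap κ)) (π.execution κ)
    (π.approxExecution κ) := by
  rw [ofReal_gap]
  refine StatClose.bind_of_notMem {k | ¬ ValidPrimes κ k.P k.Q} le_rfl fun k _ hk => ?_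
  have h := statClose_approxUnit (not_not.1 hk)
  simp only [uniformUnits_eq]
  have h1 := (h.iidFamily (Fin n))
  rw [Fintype.card_fin] at h1
  exact h1.bind_bind fun rx => (h.iidFamily _).map _

/-- Two errors, each at most `gap`: the repair of invalid keys, and the nearly uniform coins. -/
theorem statClose_run (κ : ℕ) (c : Coalition m) (own : Data) (w : Inputs n p m K)
    (o : Fin K → Fin n → ℤ) : StatClose (ENNReal.ofReal (2 * π.gap κ))
      ((π.execution κ).bind (π.run κ c own w o)) (π.simView κ c own w o) := by
  have h1 : StatClose (π.keygen.failure κ + 0) ((π.execution κ).bind (π.run κ c own w o))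
      ((π.execution κ).bind (π.simRun κ c own w o)) := by
    refine StatClose.bind_of_notMem {E | ¬ ValidPrimes κ E.keys.P E.keys.Q}
      (π.toOuterMeasure_execution κ).le fun E _ hE => ?_
    rw [π.simRun_eq κ c own w o (zero_lt_one.trans (not_not.1 hE).one_lt_mul).ne']
    exact .refl _ _
  refine (h1.trans ((π.statClose_execution κ).bind _)).mono ?_
  rw [two_mul, ENNReal.ofReal_add (π.gap_nonneg κ) (π.gap_nonneg κ), add_zero]
  gcongr
  rw [ofReal_gap]
  exact le_self_add

/-- For valid keys the messages and decrypted values of the query node are literally those made from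
the estimates, by `cipherEst_eq` and `decrypted_eq`. Besides the errors of `statClose_run` only the
failure of the key generator enters. -/
theorem statClose_view {κ : ℕ} (hκ : 3 ≤ κ) (c : Coalition m) (u : Inputs n p m K) :
    StatClose (ENNReal.ofReal (3 * π.gap κ)) (π.view κ c u)
      (π.simView κ c (ownInputs c u) u (π.target u)) := by
  have h1 : StatClose (π.keygen.failure κ + 0) (π.view κ c u)
      ((π.execution κ).bind (π.run κ c (ownInputs c u) u (π.target u))) := by
    refine StatClose.bind_of_notMem {E | ¬ ValidPrimes κ E.keys.P E.keys.Q}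
      (π.toOuterMeasure_execution κ).le fun E hs hE => ?_
    have hv := not_not.1 hE
    have hN : E.keys.N ≠ 0 := (zero_lt_one.trans hv.one_lt_mul).ne'
    obtain ⟨hx, hy⟩ := π.mem_support_execution hs hN
    have hr : π.received c E u = π.simReceived c E u (π.target u) := by
      obtain ⟨q, s⟩ := c
      rcases q
      · rfl
      · rfl
      · simp only [received, simReceived, msgEst, π.decrypted_eq hκ hv hx hy,
          fun t : Fin K => π.cipherEst_eq E hN u (t := t + 1) (by omega)]
        rfl
    rw [run, hr]
    exact .refl _ _
  refine (h1.trans (π.statClose_run κ c _ u _)).mono ?_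
  rw [show 3 * π.gap κ = π.gap κ + 2 * π.gap κ by ring, ENNReal.ofReal_add (π.gap_nonneg κ)
    (by have := π.gap_nonneg κ; positivity), add_zero]
  gcongr
  rw [ofReal_gap]
  exact le_self_add

theorem view_indist_simView (U : ℕ → PMF (Inputs n p m K)) (c : Coalition m) :
    Indist (fun κ => (U κ).bind fun u => (π.view κ c u).map fun v => (u, v))
      (fun κ => (U κ).bind fun u =>
        (π.simView κ c (ownInputs c u) u (π.target u)).map fun v => (u, v)) := by
  refine .of_statClose (π.negligible_gap.const_mul 3) ?_
  filter_upwards [eventually_ge_atTop 3] with κ hκ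
  exact .bind_right fun u => (π.statClose_view hκ c u).map _

theorem run_indist_simView (U : ℕ → PMF (Inputs n p m K)) (c : Coalition m)
    (w : Inputs n p m K → Inputs n p m K) (o : Inputs n p m K → Fin K → Fin n → ℤ) :
    Indist (fun κ => (U κ).bind fun u =>
        ((π.execution κ).bind (π.run κ c (ownInputs c u) (w u) (o u))).map fun v => (u, v))
      (fun κ => (U κ).bind fun u =>
        (π.simView κ c (ownInputs c u) (w u) (o u)).map fun v => (u, v)) :=
  .of_statClose (π.negligible_gap.const_mul 2) (.of_forall fun κ =>
    .bind_right fun _ => (π.statClose_run κ c _ _ _).map _)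

end Protocol

end
end PrivateKalman

namespace PrivateKalman
noncomputable section
open ToData
variable {Γ : Type} [ToData Γ]

/-! ## Replacing ciphertexts under the residuosity assumption -/

/-- An injective map of a finite set into itself is a permutation. -/
theorem uniformOr_map {α : Type} {s : Finset α} (hs : s.Nonempty) (a : α) {f : α → α}
    (hf : Set.MapsTo f s s) (hinj : Set.InjOn f s) : (uniformOr s a).map f = uniformOr s a := by
  classical
  ext y
  rw [PMF.map_apply, uniformOr_apply, if_pos hs]
  simp only [uniformOr_apply, if_pos hs]
  have himg : s.image f = s := Finset.eq_of_subset_of_card_le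
    (Finset.image_subset_iff.2 fun x hx => hf hx) (Finset.card_image_of_injOn hinj).ge
  by_cases hy : y ∈ s
  · obtain ⟨x, hx, rfl⟩ := Finset.mem_image.1 (himg.symm ▸ hy)
    rw [if_pos hy, tsum_eq_single x, if_pos rfl, if_pos hx]
    intro x' hx'
    split_ifs with h1 h2
    · exact absurd (hinj h2 hx h1.symm) hx'
    · rfl
    · rfl
  · rw [if_neg hy, ENNReal.tsum_eq_zero]
    intro x
    split_ifs with h1 h2
    · exact absurd (h1 ▸ hf h2) hy
    · rfl
    · rfl

theorem genPow_isUnit {N : ℕ} [NeZero N] (z : ℤ) : IsUnit (genPow N z) := by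
  refine IsUnit.of_mul_eq_one (genPow N (-z)) ?_
  rw [← genPow_add, add_neg_cancel, genPow_zero]

/-- Multiplication by a unit preserves the uniform law on the units. -/
theorem map_mul_unitResidues {M : ℕ} (hM : M ≠ 0) {g : ZMod M} (hg : IsUnit g) :
    ((uniformOr (unitResidues M) 1).map fun u : ℕ => g * (u : ZMod M)) =
      (uniformOr (unitResidues M) 1).map fun u : ℕ => (u : ZMod M) := by
  have : NeZero M := ⟨hM⟩
  have hne : (unitResidues M).Nonempty := by
    refine ⟨(1 : ZMod M).val, Finset.mem_filter.2 ⟨Finset.mem_range.2 (ZMod.val_lt _), ?_⟩⟩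
    rw [← ZMod.isUnit_iff_coprime, ZMod.natCast_zmod_val]
    exact isUnit_one
  have h := uniformOr_map hne 1 (f := fun u => (g * (u : ZMod M)).val) ?_ ?_
  · conv_rhs => rw [← h, PMF.map_comp]
    congr 1
    funext u
    simp
  · intro u hu
    have hu' := (Finset.mem_filter.1 (Finset.mem_coe.1 hu)).2
    refine Finset.mem_coe.2 (Finset.mem_filter.2 ⟨Finset.mem_range.2 (ZMod.val_lt _), ?_⟩)
    rw [← ZMod.isUnit_iff_coprime, ZMod.natCast_zmod_val]
    exact hg.mul ((ZMod.isUnit_iff_coprime _ _).2 hu')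
  · intro u hu v hv huv
    have hu' := Finset.mem_range.1 (Finset.mem_filter.1 (Finset.mem_coe.1 hu)).1
    have hv' := Finset.mem_range.1 (Finset.mem_filter.1 (Finset.mem_coe.1 hv)).1
    have h1 := hg.mul_left_cancel (ZMod.val_injective M huv)
    have h2 := congrArg ZMod.val h1
    rwa [ZMod.val_natCast, ZMod.val_natCast, Nat.mod_eq_of_lt hu', Nat.mod_eq_of_lt hv'] at h2

/-- A random modulus `N` with a random `N`-th residue modulo `N ^ 2`. -/
def KeyGenerator.residue (G : KeyGenerator) (κ : ℕ) : PMF (ℕ × ℕ) :=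
  (G.keys κ).bind fun k => (uniformOr (unitResidues k.N) 1).map fun r : ℕ =>
    (k.N, ((r : ZMod (k.N ^ 2)) ^ k.N).val)

/-- A random modulus `N` with a random unit modulo `N ^ 2`. -/
def KeyGenerator.unit (G : KeyGenerator) (κ : ℕ) : PMF (ℕ × ℕ) :=
  (G.keys κ).bind fun k => (uniformOr (unitResidues (k.N ^ 2)) 1).map fun u => (k.N, u)

theorem DCRA.indist {G : KeyGenerator} (h : DCRA G) : Indist G.residue G.unit := by
  -- In the assumption the coin is cast to `ZMod (N ^ 2)` before the map is applied, here inside it.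
  have e : ∀ k : Keys, ((uniformOr (unitResidues k.N) 1).map fun r : ℕ =>
      Data.pair (Data.num k.N) (Data.num ((r : ZMod (k.N ^ 2)) ^ k.N).val)) =
      ((uniformOr (unitResidues k.N) 1).bind fun a => PMF.pure (a : ZMod (k.N ^ 2))).map fun r =>
        Data.pair (Data.num k.N) (Data.num (r ^ k.N).val) := by
    intro k
    rw [PMF.map_bind]
    simp only [PMF.pure_map]
    rfl
  unfold Indist KeyGenerator.residue KeyGenerator.unit
  simp only [PMF.map_bind, PMF.map_comp]
  refine Eq.mp (congrArg (fun X => CompIndist X _) (funext fun κ => ?_)) h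
  exact congrArg _ (funext fun k => (e k).symm)

/-- Joins the coins of the query node and of the sensors into one family over all slots, which the
hybrid argument treats uniformly. -/
theorem iidFamily_sum {α : Type} (q : PMF α) (ι ι' : Type) [Fintype ι] [Fintype ι'] :
    iidFamily q (ι ⊕ ι') = (iidFamily q ι).bind fun f => (iidFamily q ι').map fun g =>
      Sum.elim f g := by
  classical
  ext x
  rw [iidFamily_apply, Fintype.prod_sum_type, PMF.bind_apply,
    tsum_eq_single fun i => x (Sum.inl i), PMF.map_apply, tsum_eq_single fun i => x (Sum.inr i)]
  · rw [if_pos (by funext i; cases i <;> rfl), iidFamily_apply, iidFamily_apply]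
  · intro g hg
    refine if_neg fun h => hg ?_
    rw [h]
    rfl
  · intro f hf
    rw [PMF.map_apply, ENNReal.tsum_eq_zero.2, mul_zero]
    intro g
    refine if_neg fun h => hf ?_
    rw [h]
    rfl

namespace Protocol
variable {n p m K : ℕ} (π : Protocol n p m K)

/-- What the aggregator and the sensors in `s` see, from the modulus, their inputs, the coins and
the ciphertexts of all the private numbers. -/
def aggView (s : Finset (Fin m)) (N : ℕ) (own : Data) (r : Slot n p m K → ℕ)
    (c : Slot n p m K → ZMod (N ^ 2)) : Data :=
  Data.list [π.publicData, own,
    ownCoins ⟨Partner.aggregator, s⟩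
      (⟨⟨0, 0, 0⟩, fun a => r (Sum.inl a), fun a => r (Sum.inr a)⟩ : Execution n p m K),
    Data.num N,
    Data.list
      [Data.pair (Data.vec fun a => cipherData (c (Sum.inl a))) (π.matData π.plant.P₀),
       Data.vec fun i => Data.vec fun t => Data.pair
        (Data.vec fun j => cipherData (c (Sum.inr (t, i, j)))) (π.matData (π.plant.R (t + 1) i)),
       Data.vec fun t : Fin K => Data.pair
        (Data.vec fun a => cipherData (encEstimate π.plant π.base π.prec
          (fun a => c (Sum.inl a)) (fun t i j => c (Sum.inr (t, i, j))) (t + 1) a))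
        (π.matData (π.plant.cov (t + 1)))],
    Data.list []]

theorem poly_aggView (s : Finset (Fin m)) {N : Γ → ℕ} (hN0 : ∀ x, N x ≠ 0) (hN : Poly N)
    {own : Γ → Data} (hown : Poly own) {r : Γ → Slot n p m K → ℕ} (hr : ∀ σ, Poly fun x => r x σ)
    {c : ∀ x, Slot n p m K → ZMod (N x ^ 2)} (hc : ∀ σ, PolyRes N fun x => c x σ) :
    Poly fun x => π.aggView s (N x) (own x) (r x) (c x) := by
  have h1 : Poly fun x => (⟨⟨0, 0, 0⟩, fun a => r x (Sum.inl a), fun a => r x (Sum.inr a)⟩ :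
      Execution n p m K) := .execution_mk (.const _) (.vec fun _ => hr _) fun _ => hr _
  refine .dataPair (.const _) (.dataPair hown (.dataPair (poly_ownCoins _ h1) (.dataPair hN.num
    (.dataPair (.dataPair ?_ (.dataPair ?_ (.dataPair ?_ (.const _)))) (.const _)))))
  · exact .dataPair (.dataVec fun a => (hc _).cipherData hN) (.const _)
  · exact .dataVec fun i => .dataVec fun t => .dataPair
      (.dataVec fun j => (hc _).cipherData hN) (.const _)
  · exact .dataVec fun t => .dataPair (.dataVec fun a => (PolyRes.encEstimate hN0 hN _ _ _
      (fun _ => hc _) (fun _ _ _ => hc _) _ (by omega) a).cipherData hN) (.const _)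

/-- The view of the aggregator and the sensors in `s` when the numbers `w` are encrypted. -/
def aggRun (κ : ℕ) (s : Finset (Fin m)) (own : Data) (w : Slot n p m K → ℤ) : PMF Data :=
  (π.keygen.keys κ).bind fun k =>
    (iidFamily (uniformOr (unitResidues k.N) 1) (Slot n p m K)).map fun r =>
      π.aggView s k.N own r fun σ => encrypt k.N (w σ) (r σ)

/-- No channel is hidden from the aggregator, and the private key does not enter its view: the view
is a function of the modulus, the coins and the ciphertexts. This makes a reduction to the
residuosity problem possible. -/
theorem bind_run_aggregator (κ : ℕ) (s : Finset (Fin m)) (own : Data) (w : Inputs n p m K)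
    (o : Fin K → Fin n → ℤ) :
    (π.execution κ).bind (π.run κ ⟨Partner.aggregator, s⟩ own w o) =
      π.aggRun κ s own w.plain := by
  simp only [execution, aggRun, uniformUnits_eq, iidFamily_sum, PMF.bind_bind, PMF.map_bind,
    PMF.bind_map, PMF.map_comp]
  congr 1
  funext k
  congr 1
  funext rx
  rw [PMF.map]
  congr 1
  funext ry
  simp only [Function.comp_apply, run, hiddenTraffic, ChannelScheme.links, PMF.pure_map]
  rfl

/-- The modulus, or one if it is zero. -/
def safe (N : ℕ) : ℕ := if N = 0 then 1 else N

theorem safe_ne_zero (N : ℕ) : safe N ≠ 0 := by unfold safe; split_ifs <;> simp_all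

theorem safe_eq {N : ℕ} (h : N ≠ 0) : safe N = N := if_neg h

/-- The view when the mask of the ciphertext with index `σ` is `u`. -/
def challenge (s : Finset (Fin m)) (own : Data) (w : Slot n p m K → ℤ) (σ : Slot n p m K)
    (N u : ℕ) : PMF Data :=
  (iidFamily (approxUnit N) (Slot n p m K)).map fun r =>
    π.aggView s (safe N) own r (Function.update (fun σ' => encrypt (safe N) (w σ') (r σ')) σ
      (genPow (safe N) (w σ) * (u : ZMod (safe N ^ 2))))

/-- The coin of a hidden slot is not part of the view, so a challenge with unknown `N`-th root can
be put in its place. -/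
theorem aggView_update {s : Finset (Fin m)} {σ : Slot n p m K}
    (hσ : σ ∈ Coalition.hidden n p K ⟨Partner.aggregator, s⟩) (N : ℕ) (own : Data)
    (r : Slot n p m K → ℕ) (a : ℕ) (c : Slot n p m K → ZMod (N ^ 2)) :
    π.aggView s N own (Function.update r σ a) c = π.aggView s N own r c := by
  have h : ownCoins ⟨Partner.aggregator, s⟩ (⟨⟨0, 0, 0⟩, fun b => Function.update r σ a (Sum.inl b),
      fun b => Function.update r σ a (Sum.inr b)⟩ : Execution n p m K) =
      ownCoins ⟨Partner.aggregator, s⟩ (⟨⟨0, 0, 0⟩, fun b => r (Sum.inl b),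
      fun b => r (Sum.inr b)⟩ : Execution n p m K) := by
    simp only [ownCoins]
    congr 2
    funext i
    split_ifs with hi
    · congr! 5 with t j
      refine Function.update_of_ne ?_ _ _
      rintro rfl
      simp [Coalition.hidden] at hσ
      exact hσ hi
    · rfl
  rw [aggView, h, aggView]

/-- If the challenge is an `N`-th residue, its root plays the role of the coin at `σ`, and the view
is the real one except for the approximation of the coins. -/
theorem statClose_challenge {κ : ℕ} {s : Finset (Fin m)} {σ : Slot n p m K}
    (hσ : σ ∈ Coalition.hidden n p K ⟨Partner.aggregator, s⟩) (own : Data)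
    (w : Slot n p m K → ℤ) {k : Keys} (hk : ValidPrimes κ k.P k.Q) :
    StatClose (Fintype.card (Slot n p m K) * ENNReal.ofReal (6 / 2 ^ κ))
      ((iidFamily (uniformOr (unitResidues k.N) 1) (Slot n p m K)).map fun r =>
        π.aggView s k.N own r fun σ => encrypt k.N (w σ) (r σ))
      ((uniformOr (unitResidues k.N) 1).bind fun a =>
        π.challenge s own w σ k.N ((a : ZMod (k.N ^ 2)) ^ k.N).val) := by
  have hN : k.N ≠ 0 := (zero_lt_one.trans hk.one_lt_mul).ne'
  have : NeZero (k.N ^ 2) := ⟨pow_ne_zero 2 hN⟩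
  -- Separates the coin at `σ`, which becomes the challenge, from the others, which the reduction
  -- samples itself.
  rw [← iidFamily_resample (uniformOr (unitResidues k.N) 1) σ, PMF.map_bind]
  refine .bind_right fun a => ?_
  rw [PMF.map_comp, challenge, safe_eq hN]
  refine Eq.mp (congrArg (fun X => StatClose _ X _) ?_)
    (((statClose_approxUnit hk).iidFamily (Slot n p m K)).map _)
  congr 1
  funext r
  rw [Function.comp_apply, aggView_update _ hσ, ZMod.natCast_zmod_val]
  congr 1
  funext τ
  by_cases h : τ = σ
  · subst h
    simp [encrypt, genPow]
  · simp [h]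

/-- A uniform unit hides the plaintext perfectly: multiplication by the unit `genPow` of the
plaintext preserves the uniform law. -/
theorem bind_challenge (s : Finset (Fin m)) (own : Data) (w : Slot n p m K → ℤ)
    (σ : Slot n p m K) {N : ℕ} (hN : N ≠ 0) :
    (uniformOr (unitResidues (N ^ 2)) 1).bind (π.challenge s own w σ N) =
      (uniformOr (unitResidues (N ^ 2)) 1).bind
        (π.challenge s own (Function.update w σ 0) σ N) := by
  have key : ∀ v : Slot n p m K → ℤ, (∀ τ, τ ≠ σ → v τ = w τ) →
      (uniformOr (unitResidues (N ^ 2)) 1).bind (π.challenge s own v σ N) =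
        ((uniformOr (unitResidues (N ^ 2)) 1).map fun u : ℕ => (u : ZMod (N ^ 2))).bind fun c =>
          (iidFamily (approxUnit N) (Slot n p m K)).map fun r =>
            π.aggView s N own r (Function.update (fun σ' => encrypt N (w σ') (r σ')) σ c) := by
    intro v hv
    have : NeZero N := ⟨hN⟩
    rw [← map_mul_unitResidues (pow_ne_zero 2 hN) (genPow_isUnit (v σ)), PMF.bind_map]
    congr 1
    funext u
    rw [challenge, safe_eq hN, Function.comp_apply]
    congr! 3 with r
    funext τ
    by_cases h : τ = σ
    · subst h; simp
    · simp [h, hv τ h]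
  rw [key w fun _ _ => rfl, key _ fun τ hτ => Function.update_of_ne hτ _ _]

/-- The reduction draws the private data itself, which is where efficient generation of these data
is needed. -/
theorem ppt_challenge {U : ℕ → PMF (Inputs n p m K)} (hU : PPT fun s : Sec => U s.k)
    (s : Finset (Fin m)) (σ : Slot n p m K) {w : Inputs n p m K → Slot n p m K → ℤ}
    (hw : ∀ τ, Poly fun u => w u τ) {own : Inputs n p m K → Data} (hown : Poly own) :
    PPT fun z : Sec × (ℕ × ℕ) => (U z.1.k).bind fun u =>
      (π.challenge s (own u) (w u) σ z.2.1 z.2.2).map fun v => (u, v) := by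
  have h1 : PPT fun z : (Sec × (ℕ × ℕ)) × Inputs n p m K =>
      (π.challenge s (own z.2) (w z.2) σ z.1.2.1 z.1.2.2).map fun v => (z.2, v) := by
    simp only [challenge, PMF.map_comp]
    refine ppt_coins (.fst (.snd (.fst .id))) _ ?_
    have hN : Poly fun z : ((Sec × (ℕ × ℕ)) × Inputs n p m K) ×
        (Fin (Fintype.card (Slot n p m K)) → ℕ) => safe z.1.1.2.1 :=
      .ite (.fst (.snd (.fst (.fst .id)))) (.const 1) (.fst (.snd (.fst (.fst .id))))
    have hu : Poly fun z : ((Sec × (ℕ × ℕ)) × Inputs n p m K) ×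
        (Fin (Fintype.card (Slot n p m K)) → ℕ) => z.1.2 := .snd (.fst .id)
    have hr : ∀ τ : Slot n p m K, Poly fun z : ((Sec × (ℕ × ℕ)) × Inputs n p m K) ×
        (Fin (Fintype.card (Slot n p m K)) → ℕ) => z.2 (Fintype.equivFin _ τ) :=
      fun τ => .apply (.snd .id) _
    refine hu.pair (π.poly_aggView s (fun _ => safe_ne_zero _) hN (hown.comp hu) hr fun τ => ?_)
    by_cases h : τ = σ
    · subst h
      simp only [Function.update_self]
      exact (PolyRes.genPow (fun _ => safe_ne_zero _) hN ((hw τ).comp hu)).mul hN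
        (.natCast hN (.snd (.snd (.fst (.fst .id)))))
    · simp only [Function.update_of_ne h]
      exact .encrypt (fun _ => safe_ne_zero _) hN ((hw τ).comp hu) (hr τ)
  exact (hU.comp (.fst .id)).bind h1

/-- A bound for the statistical error of one replacement. -/
def slotGap (κ : ℕ) : ℝ :=
  (π.keygen.failure κ).toReal + Fintype.card (Slot n p m K) * (6 / 2 ^ κ)

theorem negligible_slotGap : Negligible π.slotGap := by
  refine π.keygen.negligible_failure.add ?_
  convert negligible_two_pow.const_mul ((Fintype.card (Slot n p m K) : ℝ) * 6) using 2
  ring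

theorem ofReal_slotGap (κ : ℕ) : ENNReal.ofReal (π.slotGap κ) = π.keygen.failure κ +
    Fintype.card (Slot n p m K) * ENNReal.ofReal (6 / 2 ^ κ) := by
  rw [slotGap, ENNReal.ofReal_add (by positivity) (by positivity), ofReal_failure,
    ENNReal.ofReal_mul (by positivity), ENNReal.ofReal_natCast]

theorem aggRun_indist_challenge (U : ℕ → PMF (Inputs n p m K)) {s : Finset (Fin m)}
    {σ : Slot n p m K} (hσ : σ ∈ Coalition.hidden n p K ⟨Partner.aggregator, s⟩)
    (w : Inputs n p m K → Slot n p m K → ℤ) (own : Inputs n p m K → Data) :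
    Indist (fun κ => (U κ).bind fun u => (π.aggRun κ s (own u) (w u)).map fun v => (u, v))
      (fun κ => (π.keygen.residue κ).bind fun z => (U κ).bind fun u =>
          (π.challenge s (own u) (w u) σ z.1 z.2).map fun v => (u, v)) := by
  refine .of_statClose π.negligible_slotGap (.of_forall fun κ => ?_)
  rw [ofReal_slotGap]
  simp only [KeyGenerator.residue, aggRun, PMF.map_bind, PMF.bind_bind, PMF.bind_map,
    Function.comp_def]
  -- Keys and private data are independent, so the keys may be drawn first, as in the residuosity
  -- problem.
  rw [PMF.bind_comm]
  refine StatClose.bind_of_notMem {k | ¬ ValidPrimes κ k.P k.Q} le_rfl fun k _ hk => ?_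
  rw [PMF.bind_comm (uniformOr (unitResidues k.N) 1)]
  refine .bind_right fun u => ?_
  have := (π.statClose_challenge hσ (own u) (w u) (not_not.1 hk)).map fun v => (u, v)
  rwa [PMF.map_bind] at this

theorem challenge_indist_zero (U : ℕ → PMF (Inputs n p m K)) (s : Finset (Fin m))
    (σ : Slot n p m K) (w : Inputs n p m K → Slot n p m K → ℤ) (own : Inputs n p m K → Data) :
    Indist (fun κ => (π.keygen.unit κ).bind fun z =>
          (U κ).bind fun u => (π.challenge s (own u) (w u) σ z.1 z.2).map fun v => (u, v))
      (fun κ => (π.keygen.unit κ).bind fun z =>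
          (U κ).bind fun u => (π.challenge s (own u) (Function.update (w u) σ 0) σ z.1 z.2).map
            fun v => (u, v)) := by
  refine .of_statClose π.keygen.negligible_failure (.of_forall fun κ => ?_)
  rw [ofReal_failure, ← add_zero (π.keygen.failure κ)]
  simp only [KeyGenerator.unit, PMF.bind_bind, PMF.bind_map, Function.comp_def]
  refine StatClose.bind_of_notMem {k | ¬ ValidPrimes κ k.P k.Q} le_rfl fun k _ hk => ?_
  have hN : k.N ≠ 0 := (zero_lt_one.trans (not_not.1 hk).one_lt_mul).ne'
  rw [PMF.bind_comm, PMF.bind_comm (uniformOr (unitResidues (k.N ^ 2)) 1)]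
  refine .bind_right fun u => ?_
  rw [← PMF.map_bind, ← PMF.map_bind, π.bind_challenge s _ _ σ hN]
  exact .refl _ _

/-- One hybrid step: real view, residue as mask, unit as mask, plaintext replaced by zero, and the
same way back with the new plaintext. -/
theorem aggRun_indist_update (hD : DCRA π.keygen) {U : ℕ → PMF (Inputs n p m K)}
    (hU : PPT fun s : Sec => U s.k) {s : Finset (Fin m)} {σ : Slot n p m K}
    (hσ : σ ∈ Coalition.hidden n p K ⟨Partner.aggregator, s⟩)
    {w : Inputs n p m K → Slot n p m K → ℤ} (hw : ∀ τ, Poly fun u => w u τ)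
    {own : Inputs n p m K → Data} (hown : Poly own) :
    Indist (fun κ => (U κ).bind fun u => (π.aggRun κ s (own u) (w u)).map fun v => (u, v))
      (fun κ => (U κ).bind fun u =>
        (π.aggRun κ s (own u) (Function.update (w u) σ 0)).map fun v => (u, v)) := by
  have hw' : ∀ τ, Poly fun u => Function.update (w u) σ 0 τ := by
    intro τ
    by_cases h : τ = σ
    · subst h
      simpa only [Function.update_self] using Poly.const 0
    · simpa only [Function.update_of_ne h] using hw τ
  have h1 := Indist.bind (G := fun κ (z : ℕ × ℕ) => (U κ).bind fun u =>
    (π.challenge s (own u) (w u) σ z.1 z.2).map fun v => (u, v))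
    (π.ppt_challenge hU s σ hw hown) hD.indist
  have h2 := Indist.bind (G := fun κ (z : ℕ × ℕ) => (U κ).bind fun u =>
    (π.challenge s (own u) (Function.update (w u) σ 0) σ z.1 z.2).map fun v => (u, v))
    (π.ppt_challenge hU s σ hw' hown) hD.indist
  exact (((π.aggRun_indist_challenge U hσ w own).trans h1).trans
    (π.challenge_indist_zero U s σ w own)).trans
    (h2.symm.trans (π.aggRun_indist_challenge U hσ _ own).symm)

/-- The number of slots does not depend on `κ`, so finitely many hybrid steps keep the error
negligible. -/
theorem aggRun_indist_mask (hD : DCRA π.keygen) {U : ℕ → PMF (Inputs n p m K)}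
    (hU : PPT fun s : Sec => U s.k) {s : Finset (Fin m)} {own : Inputs n p m K → Data}
    (hown : Poly own) {S : Finset (Slot n p m K)}
    (hS : S ⊆ Coalition.hidden n p K ⟨Partner.aggregator, s⟩) :
    Indist (fun κ => (U κ).bind fun u => (π.aggRun κ s (own u) u.plain).map fun v => (u, v))
      (fun κ => (U κ).bind fun u =>
        (π.aggRun κ s (own u) (u.mask S).plain).map fun v => (u, v)) := by
  induction S using Finset.induction_on with
  | empty => simpa only [Inputs.mask_empty] using Indist.refl _
  | insert σ S hσ ih =>
    have hS' := Finset.insert_subset_iff.1 hS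
    refine (ih hS'.2).trans ?_
    have h := π.aggRun_indist_update hD hU hS'.1 (w := fun u => (u.mask S).plain)
      (fun τ => poly_plain (poly_mask S .id) τ) hown
    have e : ∀ u : Inputs n p m K, Function.update (u.mask S).plain σ 0 =
        (u.mask (insert σ S)).plain := by
      intro u
      funext τ
      by_cases h : τ = σ
      · subst h; simp [Inputs.plain_mask]
      · simp [Inputs.plain_mask, h]
    simpa only [e] using h

end Protocol

end
end PrivateKalman

namespace PrivateKalman
noncomputable section
open ToData
variable {Γ : Type} [ToData Γ]

/-! ## The simulator -/

/-- The integer with a given representation. -/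
def Data.toInt (d : Data) : ℤ := if d.left.toNat = 0 then d.right.toNat else -d.right.toNat

theorem Data.toInt_int (z : ℤ) : (Data.int z).toInt = z := by
  unfold toInt int
  by_cases h : z < 0
  · simp only [left, right, toNat, if_pos h, one_ne_zero, if_false]
    omega
  · simp only [left, right, toNat, if_neg h, if_true]
    omega

theorem Poly.toInt {f : Γ → Data} (hf : Poly f) : Poly fun x => (f x).toInt := by
  have h : Poly fun x => (((f x).right.toNat : ℕ) : ℤ) := by
    simpa using hf.dataRight.toNat.natSub (.const 0)
  exact .ite hf.dataLeft.toNat h h.intNeg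

theorem Data.vec_injective {k : ℕ} : Function.Injective (Data.vec : (Fin k → Data) → Data) :=
  fun f g h => funext fun i => by rw [← nth_vec f i, h, nth_vec]

theorem Coalition.data_injective {m : ℕ} :
    Function.Injective (Coalition.data : Coalition m → Data) := by
  rintro ⟨q, s⟩ ⟨q', s'⟩ h
  simp only [Coalition.data, Data.pair.injEq, Data.num.injEq] at h
  obtain ⟨h1, h2⟩ := h
  have h3 : s = s' := by
    ext i
    have := congrFun (Data.vec_injective h2) i
    simp only [Data.num.injEq] at this
    by_cases hi : i ∈ s <;> by_cases hi' : i ∈ s' <;> simp_all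
  have h4 : q = q' := by rcases q <;> rcases q' <;> simp_all
  rw [h3, h4]

section Decoding
variable {n p m K : ℕ}

/-- The private data with the given own inputs of a coalition and zeros elsewhere. -/
def Coalition.decodeInputs (n p K : ℕ) (c : Coalition m) (d : Data) : Inputs n p m K where
  x a := match c.partner with
    | Partner.query => (nth a d.left).toInt
    | _ => 0
  y t i j := if i ∈ c.sensors then (nth j (nth t (nth i d.right))).toInt else 0

theorem Coalition.decodeInputs_ownInputs (c : Coalition m) (u : Inputs n p m K) :
    c.decodeInputs n p K (Protocol.ownInputs c u) = u.mask (c.hidden n p K) := by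
  obtain ⟨q, s⟩ := c
  have hy : ∀ t i j, (Coalition.decodeInputs n p K ⟨q, s⟩ (Protocol.ownInputs ⟨q, s⟩ u)).y t i j =
      (u.mask (Coalition.hidden n p K ⟨q, s⟩)).y t i j := by
    intro t i j
    by_cases hi : i ∈ s <;>
      simp [decodeInputs, Protocol.ownInputs, Data.right, nth_vec, Data.toInt_int, hi,
        Inputs.mask, hidden]
  have hx : ∀ a, (Coalition.decodeInputs n p K ⟨q, s⟩ (Protocol.ownInputs ⟨q, s⟩ u)).x a =
      (u.mask (Coalition.hidden n p K ⟨q, s⟩)).x a := by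
    intro a
    rcases q <;>
      simp [decodeInputs, Protocol.ownInputs, Data.left, nth_vec, Data.toInt_int,
        Inputs.mask, hidden]
  cases h1 : Coalition.decodeInputs n p K ⟨q, s⟩ (Protocol.ownInputs ⟨q, s⟩ u)
  cases h2 : u.mask (Coalition.hidden n p K ⟨q, s⟩)
  rw [h1, h2] at hx hy
  congr
  · exact funext hx
  · exact funext fun t => funext fun i => funext fun j => hy t i j

theorem poly_decodeInputs (c : Coalition m) {d : Γ → Data} (hd : Poly d) :
    Poly fun x => c.decodeInputs n p K (d x) := by
  refine .inputs_mk (.vec fun a => ?_) (.vec fun t => .vec fun i => .vec fun j => ?_)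
  · rcases c.partner
    · exact .const 0
    · exact .const 0
    · exact (hd.dataLeft.nth _).toInt
  · split_ifs
    · exact (((hd.dataRight.nth _).nth _).nth _).toInt
    · exact .const 0

/-- The estimates with a given representation. -/
def decodeEstimates (n K : ℕ) (d : Data) (t : Fin K) (a : Fin n) : ℤ := (nth a (nth t d)).toInt

theorem poly_decodeEstimates {d : Γ → Data} (hd : Poly d) :
    Poly fun x => decodeEstimates n K (d x) :=
  .vec fun _ => .vec fun _ => ((hd.nth _).nth _).toInt

end Decoding

namespace Protocol
variable {n p m K : ℕ} (π : Protocol n p m K)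

theorem simView_congr_estimates {c : Coalition m} (hc : c.partner ≠ Partner.query) (κ : ℕ)
    (own : Data) (w : Inputs n p m K) (o o' : Fin K → Fin n → ℤ) :
    π.simView κ c own w o = π.simView κ c own w o' := by
  obtain ⟨q, s⟩ := c
  rcases q
  · rfl
  · rfl
  · exact absurd rfl hc

theorem simView_ownOutputs (κ : ℕ) (c : Coalition m) (own : Data) (u w : Inputs n p m K) :
    π.simView κ c own w (decodeEstimates n K (π.ownOutputs c u)) =
      π.simView κ c own w (π.target u) := by
  by_cases hc : c.partner = Partner.query
  · obtain ⟨q, s⟩ := c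
    subst hc
    congr 1
    funext t a
    simp [decodeEstimates, ownOutputs, nth_vec, Data.toInt_int]
  · exact π.simView_congr_estimates hc _ _ _ _ _

/-- A program simulates the views of the coalitions in a list. -/
theorem exists_simulator (l : List (Coalition m)) : ∃ S : Prog, S.PolyTime ∧ ∀ c ∈ l,
    ∀ κ own out, S.eval (Data.list [Data.security κ, c.data, own, out]) =
      π.simView κ c own (c.decodeInputs n p K own) (decodeEstimates n K out) := by
  classical
  induction l with
  | nil => exact ⟨Prog.skip, Prog.polyTime_skip, fun c hc => by simp at hc⟩
  | cons c l ih =>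
    obtain ⟨S, hS, h⟩ := ih
    -- The last factor stands for the terminator `num 0` of the argument list.
    obtain ⟨A, hA, hA'⟩ := π.ppt_simView (Γ := Sec × Data × Data × Data × Data) c
      (s := fun x => x.1) (own := fun x => x.2.2.1)
      (w := fun x => c.decodeInputs n p K x.2.2.1) (o := fun x => decodeEstimates n K x.2.2.2.1)
      (.fst .id) (.fst (.snd (.snd .id))) (poly_decodeInputs c (.fst (.snd (.snd .id))))
      (poly_decodeEstimates (.fst (.snd (.snd (.snd .id)))))
    have hc : Poly fun d : Data => if d.right.left = c.data then 1 else 0 :=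
      Poly.comp (g := fun d : Data => if d = c.data then 1 else 0)
        (by convert Poly.ite_eq c.data) (.dataLeft (.dataRight .id))
    -- The new program compares the given name with that of `c`, runs `A` if they agree and the
    -- previous simulator otherwise.
    obtain ⟨T, hT, hT'⟩ := (PPT.ite hc hS.ppt hA.ppt).exists_eval_eq
    refine ⟨T, hT, fun c' hc' κ own out => ?_⟩
    rw [hT']
    by_cases h' : c' = c
    · subst h'
      rw [if_neg (by simp [Data.list, Data.right, Data.left])]
      exact (hA' (⟨κ⟩, c'.data, own, out, Data.num 0)).trans (PMF.map_id _)
    · rw [if_pos, h c' ((List.mem_cons.1 hc').resolve_left h')]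
      rw [if_neg]
      exact fun e => h' (Coalition.data_injective e)

/-- The aggregator is handled by the residuosity assumption, every other coalition by channel
security. In the first case the view is returned to uniform coins before the hybrid argument and
taken back afterwards. -/
theorem view_indist_mask (hD : DCRA π.keygen) (hC : π.channel.Secure)
    {U : ℕ → PMF (Inputs n p m K)} (hU : PPT fun s : Sec => U s.k) (c : Coalition m) :
    Indist (fun κ => (U κ).bind fun u => (π.view κ c u).map fun v => (u, v))
      (fun κ => (U κ).bind fun u => (π.simView κ c (ownInputs c u) (u.mask (c.hidden n p K))
        (π.target u)).map fun v => (u, v)) := by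
  have hm : Poly fun u : Inputs n p m K => u.mask (c.hidden n p K) := poly_mask _ .id
  refine (π.view_indist_simView U c).trans ?_
  by_cases hc : c.partner = Partner.aggregator
  · obtain ⟨q, s⟩ := c
    subst hc
    refine (π.run_indist_simView U _ (fun u => u) π.target).symm.trans (.trans ?_
      (π.run_indist_simView U _ (fun u => u.mask _) π.target))
    simp only [bind_run_aggregator]
    exact π.aggRun_indist_mask hD hU (poly_ownInputs _ .id) subset_rfl
  · exact π.simView_indist_of_secure hC hU hc hm π.poly_target

theorem simulates_of_eval (hD : DCRA π.keygen) (hC : π.channel.Secure) {S : Prog}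
    {c : Coalition m} (hS : ∀ κ own out,
      S.eval (Data.list [Data.security κ, c.data, own, out]) =
        π.simView κ c own (c.decodeInputs n p K own) (decodeEstimates n K out)) :
    π.Simulates S c := by
  rintro U ⟨A, hA, hA'⟩
  have h := (π.view_indist_mask hD hC (U := U) ⟨A, hA, fun s => hA' s.k⟩ c).symm
  unfold Indist at h
  simp only [PMF.map_bind, PMF.map_comp] at h
  simp only [hS, simView_ownOutputs, Coalition.decodeInputs_ownInputs]
  exact h

end Protocol

end
end PrivateKalman

/-! ### The theorem. -/

open PrivateKalman in
theorem theorem1 {n p m K : ℕ} (hn : 0 < n) (hp : 0 < p) (π : Protocol n p m K)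
    (hinv : ∀ t < K, IsUnit (π.plant.predCov t))
    (hDCRA : DCRA π.keygen) (hchannel : π.channel.Secure) :
    π.ComputesEstimates ∧
    ∃ S : Prog, S.PolyTime ∧
      (∀ s : Finset (Fin m), s ≠ Finset.univ →
        π.PrivateAgainst S ⟨Partner.nobody, s⟩) ∧
      (∀ s : Finset (Fin m), s ≠ Finset.univ →
        π.PrivateAgainst S ⟨Partner.aggregator, s⟩) ∧
      (∀ s : Finset (Fin m), s ≠ Finset.univ → n < p * sᶜ.card →
        π.PrivateAgainst S ⟨Partner.query, s⟩ ∧ π.plant.Underdetermined K s) := by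
  refine ⟨π.computesEstimates, ?_⟩
  -- There are finitely many coalitions, so one program can serve them all.
  obtain ⟨S, hS, h⟩ := π.exists_simulator
    (Finset.univ.toList.flatMap fun s : Finset (Fin m) =>
      [⟨Partner.nobody, s⟩, ⟨Partner.aggregator, s⟩, ⟨Partner.query, s⟩])
  -- Simulation holds for every coalition; the number of sensors outside matters only for what the
  -- outputs leave open.
  have hsim : ∀ c : Coalition m, π.Simulates S c := by
    rintro ⟨q, s⟩
    refine π.simulates_of_eval hDCRA hchannel (h _ ?_)
    simp only [List.mem_flatMap, Finset.mem_toList, Finset.mem_univ, true_and]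
    exact ⟨s, by rcases q <;> simp⟩
  refine ⟨S, hS, fun s hs => ⟨hsim _, ?_⟩, fun s hs => ⟨hsim _, ?_⟩,
    fun s _ hs => ⟨⟨hsim _, ?_⟩, ?_⟩⟩
  · exact π.noInference_of_partner_ne hn hp (by simp) hs
  · exact π.noInference_of_partner_ne hn hp (by simp) hs
  · exact π.noInference_query hn hs
  · exact π.plant.underdetermined K hs
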